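/- For \(x=(x_1,x_2)\in\mathbb R^2\) write \(x^\perp=(-x_2,x_1)\), let \((r,\theta)\) be polar coordinates, and let \(K[\omega](x)=\frac1{2\pi}\int_{\mathbb R^2}\frac{(x-y)^\perp}{|x-y|^2}\,\omega(y)\,dy\) be the Biot–Savart law. Let \(q:[0,\infty)\to\mathbb R\) be smooth and rapidly decreasing together with all its derivatives, put \(Q(r)=\int_0^r q(s)\,ds\), \(w_*(x)=\frac1\pi q(|x|^2)\), \(v_*=K[w_*]\), and assume that \(\int_{\mathbb R^2}w_*\,dx=1\) and \[ q'(r)<0\ \ (r\ge 0),\qquad \sup_{r>0}\frac{-r^2q'(r)}{Q(r)}<1,\qquad \sup_{r>0}\frac{r^kq(r)^2}{|q'(r)|}<\infty,\qquad \sup_{r>0}\frac{r^kq''(r)^2}{|q'(r)|}<\infty\quad\text{for all }k\in\mathbb N . \] Let \(X=\{\omega\in L^2(\mathbb R^2):\int|\omega|^2p(|x|^2)\,dx<\infty\}\) with \(p=-1/q'\) and scalar product \(\langle\omega_1,\omega_2\rangle=\int\omega_1\omega_2\,p(|x|^2)\,dx\). Let \(\Lambda\omega=v_*\cdot\nabla\omega+K[\omega]\cdot\nabla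 w_*\) on the domain \(D(\Lambda)=\{\omega\in X: v_*\cdot\nabla\omega\in X\}\), where \(v_*\cdot\nabla\omega\) is taken in the sense of distributions, and let \(\mathrm{Ker}(\Lambda)^\perp\) be the orthogonal complement in \(X\) of its kernel. Put \(g(r)=-\frac2\pi q'(r^2)\). **Proposition.** There are functions \(\omega^{(2)},\omega^{(3)},\omega^{(4)}\in X\cap D(\Lambda)\cap\mathrm{Ker}(\Lambda)^\perp\), each unique up to equality almost everywhere and smooth after modification on a null set, such that \[ \Lambda\omega^{(n)}+\frac{g(r)}{2\pi}(-1)^nr^n\sin(n\theta)=0\quad(n=2,3),\qquad \Lambda\omega^{(4)}+B(r)\sin(4\theta)+C(r)\sin(2\theta)=0 . \] Here \(\omega^{(2)}=a_2(r)\cos(2\theta)\), \[ B(r)=\frac1r\bigl(A_2'(r)a_2(r)-A_2(r)a_2'(r)\bigr)+\frac1{4\pi}\bigl(2a_2(r)-ra_2'(r)\bigr)+\frac{r^4g(r)}{2\pi},\qquad C(r)=\frac2\pi a_2(r), \] and \(A_2(r)=\frac14\bigl(\int_0^r(\tfrac sr)^2s\,a_2(s)\,ds+\int_r^\infty(\tfrac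 rs)^2s\,a_2(s)\,ds\bigr)\) is the regular solution of \(-A_2''-\frac1rA_2'+\frac4{r^2}A_2=a_2\) on \((0,\infty)\). For these (smooth) profiles and for \(d>0\) put \(x_d=(d/2,0)\), \[ w=w_*+\sum_{n=2}^4d^{-n}\omega^{(n)},\qquad v=v_*+\sum_{n=2}^4d^{-n}K[\omega^{(n)}],\qquad \tilde\Omega[w]=-\frac2d\int_{\mathbb R^2}(K[w])_2(-x-2x_d)\,w(x)\,dx . \] Then \[ \Bigl(v(x)-v(-x-2x_d)-\tilde\Omega[w]\,(x+x_d)^\perp\Bigr)\cdot\nabla w(x)=\mathcal O(d^{-5})\qquad\text{as } d\to\infty, \] both in the norm of \(X\) (the left-hand side belongs to \(X\) for all large \(d\)) and uniformly for \(x\in\mathbb R^2\). -/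

import Mathlib

open MeasureTheory

noncomputable section

namespace VortexPair

/-- The Euclidean plane. -/
abbrev Plane : Type := EuclideanSpace ℝ (Fin 2)

/-- Rotation by a right angle: `(x₁, x₂)^⊥ = (-x₂, x₁)`. -/
def perp (x : Plane) : Plane := !₂[-(x 1), x 0]

/-- The polar angle of a point of the plane; the polar radius is `‖x‖`. -/
def angle (x : Plane) : ℝ := Complex.arg ⟨x 0, x 1⟩

/-- The Biot-Savart law `K[ω](x) = (1/2π) ∫ (x - y)^⊥ / |x - y|² ω(y) dy`. -/
def biotSavart (ω : Plane → ℝ) (x : Plane) : Plane :=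
  (1 / (2 * Real.pi)) • ∫ y : Plane, (ω y / ‖x - y‖ ^ 2) • perp (x - y)

/-! ### The radial profile -/

/-- `q'` on `[0, ∞)` (one-sided at `0`). -/
def dq (q : ℝ → ℝ) : ℝ → ℝ := derivWithin q (Set.Ici 0)

/-- `q''` on `[0, ∞)` (one-sided at `0`). -/
def ddq (q : ℝ → ℝ) : ℝ → ℝ := derivWithin (dq q) (Set.Ici 0)

/-- `Q(r) = ∫_0^r q(s) ds`. -/
def primitiveQ (q : ℝ → ℝ) (r : ℝ) : ℝ := ∫ s in (0 : ℝ)..r, q s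

/-- The radial vorticity profile `w_*(x) = q(|x|²) / π`. -/
def wStar (q : ℝ → ℝ) (x : Plane) : ℝ := q (‖x‖ ^ 2) / Real.pi

/-- The velocity field `v_* = K[w_*]`. -/
def vStar (q : ℝ → ℝ) : Plane → Plane := biotSavart (wStar q)

/-- The assumptions on the asymptotic profile `w_*`. -/
structure AdmissibleProfile (q : ℝ → ℝ) : Prop where
  /-- `q` is smooth on `[0, ∞)`. -/
  smooth : ContDiffOn ℝ (⊤ : ℕ∞) q (Set.Ici 0)
  /-- `q` and all its derivatives decrease rapidly, so that `w_*` is a Schwartz function. -/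
  rapid : ∀ k n : ℕ, ∃ C : ℝ, ∀ r : ℝ, 0 ≤ r →
    r ^ k * |iteratedDerivWithin n q (Set.Ici 0) r| ≤ C
  /-- `∫ w_* = 1`. -/
  mass : ∫ x : Plane, wStar q x = 1
  /-- `q' < 0`. -/
  decreasing : ∀ r : ℝ, 0 ≤ r → dq q r < 0
  /-- `sup_{r > 0} -r² q'(r) / Q(r) < 1`. -/
  stable : ∃ c : ℝ, c < 1 ∧ ∀ r : ℝ, 0 < r → -(r ^ 2 * dq q r) / primitiveQ q r ≤ c
  /-- `sup_{r > 0} r^k q(r)² / |q'(r)| < ∞` for all `k`. -/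
  decay : ∀ k : ℕ, ∃ C : ℝ, ∀ r : ℝ, 0 < r → r ^ k * q r ^ 2 / |dq q r| ≤ C
  /-- `sup_{r > 0} r^k q''(r)² / |q'(r)| < ∞` for all `k`. -/
  decay_second : ∀ k : ℕ, ∃ C : ℝ, ∀ r : ℝ, 0 < r → r ^ k * ddq q r ^ 2 / |dq q r| ≤ C

/-! ### The weighted space `X` -/

/-- The weight `p(|x|²)`, where `p = -1/q'`. -/
def weight (q : ℝ → ℝ) (x : Plane) : ℝ := -1 / dq q (‖x‖ ^ 2)

/-- Membership in `X = {ω ∈ L²(ℝ²) : ∫ |ω|² p(|x|²) dx < ∞}`. -/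
def InX (q : ℝ → ℝ) (ω : Plane → ℝ) : Prop :=
  MemLp ω 2 volume ∧ Integrable (fun x : Plane => ω x ^ 2 * weight q x) volume

/-- The scalar product of `X`. -/
def innerX (q : ℝ → ℝ) (ω₁ ω₂ : Plane → ℝ) : ℝ :=
  ∫ x : Plane, ω₁ x * ω₂ x * weight q x

/-- The norm of `X`. -/
def normX (q : ℝ → ℝ) (ω : Plane → ℝ) : ℝ := Real.sqrt (innerX q ω ω)

/-! ### The linearized operator `Λ` on its maximal domain -/

/-- `v · ∇ω = h` in the sense of distributions, for a smooth divergence-free field `v`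
(so that the formal adjoint of `v · ∇` is `-v · ∇`). -/
def HasWeakTransport (v : Plane → Plane) (ω h : Plane → ℝ) : Prop :=
  ∀ χ : Plane → ℝ, ContDiff ℝ (⊤ : ℕ∞) χ → HasCompactSupport χ →
    ∫ x : Plane, ω x * fderiv ℝ χ x (v x) = -∫ x : Plane, h x * χ x

/-- `ω ∈ D(Λ) = {ω ∈ X : v_* · ∇ω ∈ X}` and `Λω = f` almost everywhere, where
`Λω = v_* · ∇ω + K[ω] · ∇w_*`. -/
def LambdaEq (q : ℝ → ℝ) (ω f : Plane → ℝ) : Prop :=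
  InX q ω ∧ ∃ h : Plane → ℝ, InX q h ∧ HasWeakTransport (vStar q) ω h ∧
    ∀ᵐ x : Plane, h x + fderiv ℝ (wStar q) x (biotSavart ω x) = f x

/-- `ω` is orthogonal in `X` to `Ker(Λ) = {κ ∈ D(Λ) : Λκ = 0}`. -/
def PerpKer (q : ℝ → ℝ) (ω : Plane → ℝ) : Prop :=
  ∀ κ : Plane → ℝ, LambdaEq q κ (fun _ => 0) → innerX q ω κ = 0

/-- `ω ∈ X ∩ D(Λ) ∩ Ker(Λ)^⊥` and `Λω + F = 0`. -/
def IsProfile (q : ℝ → ℝ) (F ω : Plane → ℝ) : Prop :=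
  LambdaEq q ω (fun x => -F x) ∧ PerpKer q ω

/-! ### The forcing terms -/

/-- `g(r) = -2 q'(r²) / π`. -/
def gCoef (q : ℝ → ℝ) (r : ℝ) : ℝ := -(2 * dq q (r ^ 2)) / Real.pi

/-- The forcing `(g(r) / 2π) (-1)^n r^n sin(nθ)` of order `d^{-n}` for `n = 2, 3`. -/
def forcing (q : ℝ → ℝ) (n : ℕ) (x : Plane) : ℝ :=
  gCoef q ‖x‖ / (2 * Real.pi) * (-1) ^ n * ‖x‖ ^ n * Real.sin (n * angle x)

/-- The values `r ↦ ω(r, 0)`; this is `a(r)` if `ω = a(r) cos(nθ)`. -/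
def axisProfile (ω : Plane → ℝ) (r : ℝ) : ℝ := ω !₂[r, 0]

/-- The regular solution `A` of `-A'' - A'/r + (n²/r²) A = a` on `(0, ∞)`, so that
`A(r) cos(nθ)` is the stream function of the vorticity `a(r) cos(nθ)`. -/
def streamCoef (n : ℕ) (a : ℝ → ℝ) (r : ℝ) : ℝ :=
  1 / (2 * n) * ((∫ s in (0 : ℝ)..r, (s / r) ^ n * (s * a s)) +
    ∫ s in Set.Ioi r, (r / s) ^ n * (s * a s))

/-- `B(r) = (A₂' a₂ - A₂ a₂') / r + (2 a₂ - r a₂') / (4π) + r⁴ g(r) / (2π)`. -/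
def coefB (q a : ℝ → ℝ) (r : ℝ) : ℝ :=
  1 / r * (deriv (streamCoef 2 a) r * a r - streamCoef 2 a r * deriv a r)
    + 1 / (4 * Real.pi) * (2 * a r - r * deriv a r)
    + r ^ 4 * gCoef q r / (2 * Real.pi)

/-- `C(r) = (2/π) a₂(r)`. -/
def coefC (a : ℝ → ℝ) (r : ℝ) : ℝ := 2 / Real.pi * a r

/-- The forcing `B(r) sin(4θ) + C(r) sin(2θ)` of order `d^{-4}`, computed from the
second-order profile `ω₂ = a₂(r) cos(2θ)`. -/
def forcingFour (q : ℝ → ℝ) (ω₂ : Plane → ℝ) (x : Plane) : ℝ :=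
  coefB q (axisProfile ω₂) ‖x‖ * Real.sin (4 * angle x)
    + coefC (axisProfile ω₂) ‖x‖ * Real.sin (2 * angle x)

/-! ### The rotating vortex-pair equation -/

/-- The vortex center `x_d = (d/2, 0)`. -/
def center (d : ℝ) : Plane := !₂[d / 2, 0]

/-- The rotation speed `Ω[w] = -(2/d) ∫ v₂(-x - 2x_d) w(x) dx`, where `v = K[w]`
(normalized by the circulation). -/
def angularSpeed (d : ℝ) (w : Plane → ℝ) : ℝ :=
  -(2 / d) * ∫ x : Plane, biotSavart w (-x - (2 : ℝ) • center d) 1 * w x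

/-- The left-hand side
`(v(x) - v(-x - 2x_d) - Ω[w] (x + x_d)^⊥) · ∇w(x)` of the rotating vortex-pair equation. -/
def pairResidual (d : ℝ) (w : Plane → ℝ) (v : Plane → Plane) (x : Plane) : ℝ :=
  fderiv ℝ w x
    (v x - v (-x - (2 : ℝ) • center d) - angularSpeed d w • perp (x + center d))

/-- `w = w_* + d^{-2} ω₂ + d^{-3} ω₃ + d^{-4} ω₄`. -/
def approxVorticity (q : ℝ → ℝ) (ω₂ ω₃ ω₄ : Plane → ℝ) (d : ℝ) (x : Plane) : ℝ :=
  wStar q x + (1 / d ^ 2 * ω₂ x + 1 / d ^ 3 * ω₃ x + 1 / d ^ 4 * ω₄ x)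

/-- `v = v_* + d^{-2} K[ω₂] + d^{-3} K[ω₃] + d^{-4} K[ω₄]`. -/
def approxVelocity (q : ℝ → ℝ) (ω₂ ω₃ ω₄ : Plane → ℝ) (d : ℝ) (x : Plane) : Plane :=
  vStar q x + ((1 / d ^ 2) • biotSavart ω₂ x + (1 / d ^ 3) • biotSavart ω₃ x
    + (1 / d ^ 4) • biotSavart ω₄ x)

/-- The residual of the approximate steady state. -/
def steadyResidual (q : ℝ → ℝ) (ω₂ ω₃ ω₄ : Plane → ℝ) (d : ℝ) : Plane → ℝ :=
  pairResidual d (approxVorticity q ω₂ ω₃ ω₄ d) (approxVelocity q ω₂ ω₃ ω₄ d)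

end VortexPair

end

open VortexPair

open MeasureTheory

noncomputable section


/-! With z = x₁ + i x₂ and s = |x|², every vorticity in the problem is a sum of modes Re(ζ zⁿ) h(s),
and for n ≥ 2 the operator Λ acts on modes through a one-dimensional problem. If b is the
coefficient of the vorticity and α that of its stream function, then -4(sα'' + (n+1)α') = b, that
is, α = G_n b with an explicit Green operator (`green`, `biotSavart_mode`). The field v_* rotates
with angular velocity m(s)/2π, m = Q(s)/s. With V = -4q'/m, the equation Λω + F = 0 becomes b = Vα +
φ, where φ is a constant times the radial part of F divided by m (`lambdaPt_mode`). The stability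
condition says sV ≤ 4c with c < 1, and 4 is exactly the constant for which α ↦ G_n(Vα + φ) contracts
a weighted sup norm for all n ≥ 2 (`exists_potential_bound`, `abs_green_le`, `exists_fixed_point`).
Regularity and decay then follow by bootstrapping (`exists_radialSolution`).

The weight of X makes Λ skew-symmetric: transport along v_* ignores radial weights, p∇w_* = -(2/π)x,
and the kernel x·(x-y)^⊥/|x-y|² is antisymmetric. So the range of Λ is orthogonal to its kernel
(`perpKer_of_lambdaPt`). Solving the radial equation a second time puts each profile in the range of
Λ (`RadialSolution.exists_preimage`). Any other candidate differs from it by an element of the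
kernel orthogonal to itself, which gives uniqueness (`isProfile_iff`).

For the residual to lie in X, the gradients of the profiles must be square integrable against p
times powers of |x|. The fourth profile is forced by the derivative of the second one, so its
gradient involves q''', about which nothing is assumed. The missing bound ∫ sᵏ q'''²/|q'| ds < ∞ is
derived from the other hypotheses (`integrableOn_third_deriv_sq_div`): interpolation bounds the
derivatives of q by almost the first power of q, while |q'| is at least a multiple of q². On short
intervals either q''' is small, or it has a fixed sign and then |q'| can be very small only on a
very short set.

Finally the residual is expanded in 1/d. The conjugated velocity at the reflected point is a Cauchy
integral of ω(y)/(d + z + ζ), where ζ = y₁ + i y₂; its geometric series has coefficients given by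
moments, most of which vanish by symmetry (`exists_far_bound`, `exists_reflected_velocity_bound`).
The translation of order 1/d is cancelled by the rotation of the center. The strain fields of orders
d⁻², d⁻³, d⁻⁴, applied to ∇w_* and ∇ω⁽²⁾, produce the prescribed forcings (`fderiv_wStar_strain₂`,
`fderiv_wStar_strain₃`, `fourth_order`), so the profile equations cancel all orders below d⁻⁵
(`abs_residual_le`). The rest is at most a polynomial in |x| times gradients of the profiles. -/

/-! ### Interpolation on half-lines and the third derivative of the profile. -/

/-- A sequence of reals with nonnegative second differences lies below its chords. -/
theorem convex_seq_le_chord (c : ℕ → ℝ) (hc : ∀ i, 2 * c (i + 1) ≤ c i + c (i + 2))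
    (m i : ℕ) (him : i ≤ m) : (m : ℝ) * c i ≤ (m - i : ℝ) * c 0 + i * c m := by
  have mono : Monotone fun k => c (k + 1) - c k :=
    monotone_nat_of_le_succ fun k => by have := hc k; simp only [add_assoc]; norm_num; linarith
  have left : ∀ i : ℕ, c i - c 0 ≤ i * (c (i + 1) - c i) := by
    intro i
    induction i with
    | zero => simp
    | succ k ih =>
      have h1 := mono (Nat.le_succ k)
      simp only at h1
      push_cast
      have : (k : ℝ) * (c (k + 1) - c k) ≤ k * (c (k + 1 + 1) - c (k + 1)) :=
        mul_le_mul_of_nonneg_left h1 (Nat.cast_nonneg k)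
      linarith
  have right : ∀ j : ℕ, (j : ℝ) * (c (i + 1) - c i) ≤ c (i + j) - c i := by
    intro j
    induction j with
    | zero => simp
    | succ k ih =>
      have h1 := mono (Nat.le_add_right i k)
      simp only at h1
      push_cast
      rw [← add_assoc]
      linarith
  -- The increment at i lies between the slopes of the chords over [0, i] and [i, i + j]; weighting
  -- the two bounds by j and i eliminates it.
  obtain ⟨j, rfl⟩ := Nat.exists_eq_add_of_le him
  have h1 := left i
  have h2 := right j
  have h3 := mul_le_mul_of_nonneg_left h1 (Nat.cast_nonneg j : (0 : ℝ) ≤ j)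
  have h4 := mul_le_mul_of_nonneg_left h2 (Nat.cast_nonneg i : (0 : ℝ) ≤ i)
  push_cast
  nlinarith

/-- Landau's inequality on a half-line. -/
theorem landau_half_line {g g' g'' : ℝ → ℝ} {x A B h : ℝ} (hh : 0 < h)
    (hg : ∀ y, x ≤ y → HasDerivAt g (g' y) y) (hg' : ∀ y, x ≤ y → HasDerivAt g' (g'' y) y)
    (hA : ∀ y, x ≤ y → |g y| ≤ A) (hB : ∀ y, x ≤ y → |g'' y| ≤ B) :
    |g' x| ≤ 2 * A / h + B * h := by
  have hB0 : 0 ≤ B := (abs_nonneg _).trans (hB x le_rfl)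
  -- The mean value theorem gives a point ξ within h of x where the derivative equals a difference
  -- quotient, hence is at most 2A/h. A second application bounds the change of the derivative
  -- between x and ξ by Bh.
  obtain ⟨ξ, hξ, e1⟩ := exists_hasDerivAt_eq_slope g g' (show x < x + h by linarith)
    (fun y hy => (hg y hy.1).continuousAt.continuousWithinAt) (fun y hy => hg y hy.1.le)
  obtain ⟨η, hη, e2⟩ := exists_hasDerivAt_eq_slope g' g'' hξ.1
    (fun y hy => (hg' y hy.1).continuousAt.continuousWithinAt) (fun y hy => hg' y hy.1.le)
  have h1 : |g' ξ| ≤ 2 * A / h := by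
    rw [e1, add_sub_cancel_left, abs_div, abs_of_pos hh]
    gcongr
    have := abs_sub (g (x + h)) (g x)
    have := hA (x + h) (by linarith)
    have := hA x le_rfl
    linarith
  have h2 : |g' ξ - g' x| ≤ B * h := by
    have hne : ξ - x ≠ 0 := by linarith [hξ.1]
    rw [eq_div_iff hne] at e2
    rw [← e2, abs_mul, abs_of_pos (by linarith [hξ.1] : 0 < ξ - x)]
    exact mul_le_mul (hB η hη.1.le) (by linarith [hξ.2]) (by linarith [hξ.1]) hB0
  have h3 : |g' x| ≤ |g' ξ| + |g' ξ - g' x| := by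
    have := abs_sub (g' ξ) (g' ξ - g' x)
    rwa [sub_sub_cancel] at this
  linarith

/-- On an interval where `|f''| ≥ ρ`, a nonnegative function is small only on a small set. -/
theorem exists_small_sublevel {f f' f'' : ℝ → ℝ} {a b ρ w : ℝ} (hρ : 0 < ρ) (hw : 0 < w)
    (hf : ∀ y ∈ Set.Icc a b, HasDerivAt f (f' y) y)
    (hf' : ∀ y ∈ Set.Icc a b, HasDerivAt f' (f'' y) y)
    (hpos : ∀ y ∈ Set.Icc a b, 0 ≤ f y)
    (hsign : (∀ y ∈ Set.Icc a b, ρ ≤ f'' y) ∨ (∀ y ∈ Set.Icc a b, f'' y ≤ -ρ)) :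
    ∃ S : Set ℝ, MeasurableSet S ∧ volume S ≤ ENNReal.ofReal (2 * w) ∧
      ∀ y ∈ Set.Icc a b, y ∉ S → ρ * w ^ 2 / 2 ≤ f y := by
  have hq : ∀ y : ℝ, HasDerivAt (fun y : ℝ => ρ / 2 * y ^ 2) (ρ * y) y := fun y => by
    have := (hasDerivAt_pow 2 y).const_mul (ρ / 2)
    exact this.congr_deriv (by norm_num; ring)
  have hq' : ∀ y : ℝ, HasDerivAt (fun y : ℝ => ρ * y) ρ y := fun y => by
    simpa using (hasDerivAt_id y).const_mul ρ
  rcases hsign with hs | hs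
  -- Convex case: two points with f < ρw²/2 and a midpoint with f ≥ 0 satisfy ρ/8 · (y₁ - y₂)² ≤
  -- ρw²/2, so the sublevel set has diameter at most 2w. Its closure is taken only for
  -- measurability.
  · have hconv : ConvexOn ℝ (Set.Icc a b) (fun y => f y - ρ / 2 * y ^ 2) := by
      refine convexOn_of_hasDerivWithinAt2_nonneg (f' := fun y => f' y - ρ * y)
        (f'' := fun y => f'' y - ρ) (convex_Icc a b)
        (fun y hy => ((hf y hy).sub (hq y)).continuousAt.continuousWithinAt) ?_ ?_ ?_
      · intro y hy
        exact ((hf y (interior_subset hy)).sub (hq y)).hasDerivWithinAt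
      · intro y hy
        exact ((hf' y (interior_subset hy)).sub (hq' y)).hasDerivWithinAt
      · intro y hy
        linarith [hs y (interior_subset hy)]
    let T : Set ℝ := {y | y ∈ Set.Icc a b ∧ f y < ρ * w ^ 2 / 2}
    have hdiam : ∀ y₁ ∈ T, ∀ y₂ ∈ T, dist y₁ y₂ ≤ 2 * w := by
      intro y₁ h₁ y₂ h₂
      have hm : f (1 / 2 * y₁ + 1 / 2 * y₂) - ρ / 2 * (1 / 2 * y₁ + 1 / 2 * y₂) ^ 2
          ≤ 1 / 2 * (f y₁ - ρ / 2 * y₁ ^ 2) + 1 / 2 * (f y₂ - ρ / 2 * y₂ ^ 2) :=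
        hconv.2 h₁.1 h₂.1 (by norm_num : (0 : ℝ) ≤ 1 / 2) (by norm_num : (0 : ℝ) ≤ 1 / 2)
          (by norm_num)
      have hmid : 0 ≤ f (1 / 2 * y₁ + 1 / 2 * y₂) := hpos _ (convex_Icc a b h₁.1 h₂.1 (by norm_num : (0 : ℝ) ≤ 1 / 2)
        (by norm_num : (0 : ℝ) ≤ 1 / 2) (by norm_num))
      have k1 := h₁.2
      have k2 := h₂.2
      rw [Real.dist_eq]
      refine abs_le_of_sq_le_sq ?_ (by linarith)
      have : ρ * (y₁ - y₂) ^ 2 ≤ ρ * (2 * w) ^ 2 := by nlinarith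
      exact le_of_mul_le_mul_left this hρ
    refine ⟨closure T, isClosed_closure.measurableSet, ?_, fun y hy hyS => ?_⟩
    · refine (Real.volume_le_diam _).trans ?_
      rw [Metric.ediam_closure]
      exact Metric.ediam_le fun y₁ h₁ y₂ h₂ => by
        rw [edist_dist]; exact ENNReal.ofReal_le_ofReal (hdiam y₁ h₁ y₂ h₂)
    · by_contra hlt
      exact hyS (subset_closure ⟨hy, not_le.mp hlt⟩)
  -- Concave case: f ≥ 0 at both endpoints forces f ≥ ρ/2 · (y - a)(b - y), so f can be small only
  -- within w of an endpoint.
  · have hconc : ConcaveOn ℝ (Set.Icc a b) (fun y => f y + ρ / 2 * y ^ 2) := by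
      refine concaveOn_of_hasDerivWithinAt2_nonpos (f' := fun y => f' y + ρ * y)
        (f'' := fun y => f'' y + ρ) (convex_Icc a b)
        (fun y hy => ((hf y hy).add (hq y)).continuousAt.continuousWithinAt) ?_ ?_ ?_
      · intro y hy
        exact ((hf y (interior_subset hy)).add (hq y)).hasDerivWithinAt
      · intro y hy
        exact ((hf' y (interior_subset hy)).add (hq' y)).hasDerivWithinAt
      · intro y hy
        linarith [hs y (interior_subset hy)]
    refine ⟨Set.Icc a (a + w) ∪ Set.Icc (b - w) b, by measurability, ?_, fun y hy hyS => ?_⟩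
    · refine (measure_union_le _ _).trans ?_
      rw [Real.volume_Icc, Real.volume_Icc, ← ENNReal.ofReal_add (by linarith) (by linarith)]
      exact ENNReal.ofReal_le_ofReal (by linarith)
    · have h1 : a + w < y := by
        by_contra h; exact hyS (Or.inl ⟨hy.1, not_lt.mp h⟩)
      have h2 : y < b - w := by
        by_contra h; exact hyS (Or.inr ⟨not_lt.mp h, hy.2⟩)
      have hab : a < b := by linarith
      have ha : a ∈ Set.Icc a b := ⟨le_rfl, hab.le⟩
      have hb : b ∈ Set.Icc a b := ⟨hab.le, le_rfl⟩
      have hba : 0 < b - a := by linarith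
      have hm := hconc.2 ha hb (show 0 ≤ (b - y) / (b - a) from div_nonneg (by linarith [hy.2]) hba.le)
        (show 0 ≤ (y - a) / (b - a) from div_nonneg (by linarith [hy.1]) hba.le)
        (by field_simp; ring)
      simp only [smul_eq_mul] at hm
      have e : (b - y) / (b - a) * a + (y - a) / (b - a) * b = y := by field_simp; ring
      rw [e] at hm
      have n1 : 0 ≤ (b - y) / (b - a) * f a :=
        mul_nonneg (div_nonneg (by linarith [hy.2]) hba.le) (hpos a ha)
      have n2 : 0 ≤ (y - a) / (b - a) * f b :=
        mul_nonneg (div_nonneg (by linarith [hy.1]) hba.le) (hpos b hb)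
      have e2 : (b - y) / (b - a) * a ^ 2 + (y - a) / (b - a) * b ^ 2 - y ^ 2
          = (y - a) * (b - y) := by field_simp; ring
      have h3 : ρ / 2 * ((y - a) * (b - y)) ≤ f y := by rw [← e2]; nlinarith
      have h4 : w * w ≤ (y - a) * (b - y) :=
        mul_le_mul (by linarith) (by linarith) hw.le (by linarith)
      nlinarith

/-- If a nonnegative function on `[1, ∞)` has integral over `[x, x + ℓ(x)]` at most that of an
integrable function, for a positive decreasing `ℓ`, then it is integrable. -/
theorem integrableOn_of_local_bound {F P ℓ : ℝ → ℝ} (hF : ContinuousOn F (Set.Ici 1))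
    (hF0 : ∀ x, 1 ≤ x → 0 ≤ F x) (hP : IntegrableOn P (Set.Ioi 1)) (hP0 : ∀ x, 1 ≤ x → 0 ≤ P x)
    (hℓ : ∀ x, 1 ≤ x → 0 < ℓ x) (hℓa : ∀ x y, 1 ≤ x → x ≤ y → ℓ y ≤ ℓ x)
    (hloc : ∀ x, 1 ≤ x → ∫ y in x..x + ℓ x, F y ≤ ∫ y in x..x + ℓ x, P y) :
    IntegrableOn F (Set.Ioi 1) := by
  -- Consecutive intervals of length ℓ(X n) tile [1, ∞), and the local bounds are summed over them.
  let X : ℕ → ℝ := fun n => Nat.rec 1 (fun _ x => x + ℓ x) n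
  have X0 : X 0 = 1 := rfl
  have Xs : ∀ n, X (n + 1) = X n + ℓ (X n) := fun n => rfl
  have X1 : ∀ n, 1 ≤ X n := by
    intro n
    induction n with
    | zero => exact le_of_eq X0.symm
    | succ n ih => rw [Xs]; linarith [hℓ _ ih]
  have iF : ∀ x y, 1 ≤ x → x ≤ y → IntervalIntegrable F volume x y := fun x y hx hxy =>
    (hF.mono (by rw [Set.uIcc_of_le hxy]; exact fun t ht => hx.trans ht.1)).intervalIntegrable
  have iP : ∀ x y, 1 ≤ x → x ≤ y → IntervalIntegrable P volume x y := fun x y hx hxy =>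
    (intervalIntegrable_iff_integrableOn_Ioc_of_le hxy).2
      (hP.mono_set fun t ht => lt_of_le_of_lt hx ht.1)
  have hle : ∀ n, ∫ y in (1 : ℝ)..X n, F y ≤ ∫ y in (1 : ℝ)..X n, P y := by
    intro n
    induction n with
    | zero => simp [X0]
    | succ n ih =>
      have h1 := X1 n
      have h2 : X n ≤ X (n + 1) := by rw [Xs]; linarith [hℓ _ h1]
      rw [← intervalIntegral.integral_add_adjacent_intervals (iF _ _ le_rfl h1) (iF _ _ h1 h2),
        ← intervalIntegral.integral_add_adjacent_intervals (iP _ _ le_rfl h1) (iP _ _ h1 h2)]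
      exact add_le_add ih (by rw [Xs]; exact hloc _ h1)
  have hmono : Monotone X := monotone_nat_of_le_succ fun n => by rw [Xs]; linarith [hℓ _ (X1 n)]
  have htend : Filter.Tendsto X Filter.atTop Filter.atTop := by
    refine Filter.tendsto_atTop_atTop_of_monotone hmono fun b => ?_
    by_contra! hb
    have hb1 : 1 ≤ b := (X1 0).trans (hb 0).le
    -- If the tiling stayed below b, every step would be at least ℓ(b) > 0 because ℓ is decreasing,
    -- which is absurd.
    have hgrow : ∀ n : ℕ, 1 + n * ℓ b ≤ X n := by
      intro n
      induction n with
      | zero => simp [X0]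
      | succ n ih =>
        rw [Xs]; push_cast
        linarith [hℓa (X n) b (X1 n) (hb n).le]
    obtain ⟨n, hn⟩ := exists_nat_gt (b / ℓ b)
    rw [div_lt_iff₀ (hℓ b hb1)] at hn
    linarith [hgrow n, hb n]
  refine integrableOn_Ioi_of_intervalIntegral_norm_bounded (∫ y in Set.Ioi 1, P y) 1
    (fun n => ?_) htend (Filter.Eventually.of_forall fun n => ?_)
  · exact ((intervalIntegrable_iff_integrableOn_Ioc_of_le (X1 n)).1 (iF _ _ le_rfl (X1 n)))
  · have e : ∫ y in (1 : ℝ)..X n, ‖F y‖ = ∫ y in (1 : ℝ)..X n, F y := by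
      refine intervalIntegral.integral_congr fun y hy => ?_
      rw [Set.uIcc_of_le (X1 n)] at hy
      exact Real.norm_of_nonneg (hF0 y hy.1)
    rw [e]
    refine (hle n).trans ?_
    rw [intervalIntegral.integral_of_le (X1 n)]
    refine setIntegral_mono_set hP ?_ (Set.Ioc_subset_Ioi_self.eventuallyLE)
    filter_upwards [ae_restrict_mem measurableSet_Ioi] with y hy using hP0 y (le_of_lt hy)


/-- Interpolation on half-lines for a decaying smooth function: lower-order derivatives are
bounded by almost the first power of the function itself. -/
theorem deriv_le_rpow_of_decay {h : ℕ → ℝ → ℝ}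
    (hd : ∀ i x, 0 < x → HasDerivAt (h i) (h (i + 1) x) x)
    (hb : ∀ i k : ℕ, ∃ C : ℝ, ∀ x, 0 < x → x ^ k * |h i x| ≤ C)
    (hpos : ∀ x, 0 < x → 0 < h 0 x) (hanti : ∀ x y, 0 < x → x ≤ y → h 0 y ≤ h 0 x) :
    ∃ C : ℝ, 0 < C ∧ ∀ i ≤ 4, 1 ≤ i → ∀ x y, 0 < x → x ≤ y → |h i y| ≤ C * h 0 x ^ (31 / 32 : ℝ) := by
  choose K hK using fun i => hb i 0
  simp only [pow_zero, one_mul] at hK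
  -- Suprema over half-lines, rather than pointwise values, are what Landau's inequality
  -- interpolates between.
  let N : ℕ → ℝ → ℝ := fun i x => ⨆ y : Set.Ici x, |h i y|
  have bdd : ∀ (i : ℕ) (x : ℝ), 0 < x → BddAbove (Set.range fun y : Set.Ici x => |h i y|) := by
    rintro i x hx
    exact ⟨K i, by rintro _ ⟨y, rfl⟩; exact hK i _ (hx.trans_le y.2)⟩
  have leN : ∀ i x y, 0 < x → x ≤ y → |h i y| ≤ N i x := fun i x y hx hxy =>
    le_ciSup (bdd i x hx) ⟨y, hxy⟩
  have Nle : ∀ i x A, 0 < x → (∀ y, x ≤ y → |h i y| ≤ A) → N i x ≤ A := by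
    intro i x A hx hA
    have : Nonempty (Set.Ici x) := ⟨⟨x, le_refl x⟩⟩
    exact ciSup_le fun y => hA y y.2
  have NK : ∀ i x, 0 < x → N i x ≤ K i := fun i x hx =>
    Nle i x _ hx fun y hy => hK i y (hx.trans_le hy)
  have N0 : ∀ x, 0 < x → N 0 x = h 0 x := by
    intro x hx
    refine le_antisymm (Nle 0 x _ hx fun y hy => ?_) ?_
    · rw [abs_of_pos (hpos y (hx.trans_le hy))]; exact hanti x y hx hy
    · exact (le_abs_self _).trans (leN 0 x x hx le_rfl)
  have Nnn : ∀ i x, 0 < x → 0 ≤ N i x := fun i x hx => (abs_nonneg _).trans (leN i x x hx le_rfl)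
  have Npos : ∀ i x, 0 < x → 0 < N i x := by
    intro i x hx
    induction i with
    | zero => rw [N0 x hx]; exact hpos x hx
    | succ i ih =>
      -- Positivity is needed for the logarithms below. Were N (i + 1) zero, the i-th derivative
      -- would be constant on the half-line, hence zero by decay, against the induction hypothesis.
      refine lt_of_le_of_ne (Nnn _ x hx) fun h0 => ?_
      have hz : ∀ y, x ≤ y → h (i + 1) y = 0 := fun y hy => by
        have := leN (i + 1) x y hx hy
        rw [← h0] at this
        exact abs_eq_zero.1 (le_antisymm this (abs_nonneg _))
      have hconst : ∀ y, x ≤ y → h i y = h i x := by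
        intro y hy
        refine constant_of_has_deriv_right_zero (a := x) (b := y)
          (fun t ht => (hd i t (hx.trans_le ht.1)).continuousAt.continuousWithinAt)
          (fun t ht => ?_) y ⟨hy, le_rfl⟩
        have := hd i t (hx.trans_le ht.1)
        rw [hz t ht.1] at this
        exact this.hasDerivWithinAt
      obtain ⟨C, hC⟩ := hb i 1
      have hix : h i x = 0 := by
        by_contra hne
        have hp : 0 < |h i x| := abs_pos.2 hne
        have h1 := hC (max x (C / |h i x| + 1)) (lt_max_of_lt_left hx)
        rw [hconst _ (le_max_left _ _), pow_one] at h1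
        have h2 : (C / |h i x| + 1) * |h i x| ≤ C :=
          (mul_le_mul_of_nonneg_right (le_max_right _ _) hp.le).trans h1
        rw [add_mul, div_mul_cancel₀ _ hp.ne'] at h2
        linarith
      have : N i x ≤ 0 := Nle i x 0 hx fun y hy => by rw [hconst y hy, hix, abs_zero]
      linarith
  have Nsq : ∀ i x, 0 < x → N (i + 1) x ^ 2 ≤ 9 * (N i x * N (i + 2) x) := by
    intro i x hx
    have pa := Npos i x hx
    have pb := Npos (i + 2) x hx
    set A := N i x
    set B := N (i + 2) x
    -- With this step length both terms of Landau's bound are multiples of √(AB), and their sum is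
    -- 3√(AB).
    have hh : 0 < √(A / B) := Real.sqrt_pos.2 (div_pos pa pb)
    have key : N (i + 1) x ≤ 2 * A / √(A / B) + B * √(A / B) :=
      Nle _ x _ hx fun y hy => landau_half_line hh
        (fun t ht => hd i t (hx.trans_le (hy.trans ht)))
        (fun t ht => hd (i + 1) t (hx.trans_le (hy.trans ht)))
        (fun t ht => leN i x t hx (hy.trans ht)) (fun t ht => leN (i + 2) x t hx (hy.trans ht))
    have e : 2 * A / √(A / B) + B * √(A / B) = 3 * (B * √(A / B)) := by
      have hs : √(A / B) * √(A / B) = A / B := Real.mul_self_sqrt (div_pos pa pb).le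
      have : A / √(A / B) = B * √(A / B) := by
        rw [div_eq_iff hh.ne', mul_assoc, hs]; field_simp
      rw [mul_div_assoc, this]; ring
    rw [e] at key
    calc N (i + 1) x ^ 2 ≤ (3 * (B * √(A / B))) ^ 2 := pow_le_pow_left₀ (Nnn _ x hx) key 2
      _ = 9 * (B ^ 2 * √(A / B) ^ 2) := by ring
      _ = 9 * (A * B) := by
        rw [Real.sq_sqrt (div_pos pa pb).le]; field_simp
  have hlog : ∀ i ≤ 4, 1 ≤ i → ∀ x, 0 < x → 128 * Real.log (N i x) ≤
      124 * Real.log (h 0 x) + (|Real.log (K 0)| * 4 + |Real.log (K 128)| * 4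
        + 4 * 128 ^ 2 * Real.log 3) := by
    intro i hi hi1 x hx
    have l3 : 0 < Real.log 3 := Real.log_pos (by norm_num)
    -- The quadratic term has second difference 2 log 3, which absorbs the factor 9 and makes the
    -- sequence convex. On the chord from 0 to 128 the indices i ≤ 4 give log N 0 the weight (128 -
    -- i)/128 ≥ 31/32, while N 128 only needs to be bounded.
    have hc := convex_seq_le_chord (fun j => Real.log (N j x) + j ^ 2 * Real.log 3) (fun j => by
      have h1 := Real.log_le_log (pow_pos (Npos (j + 1) x hx) 2) (Nsq j x hx)
      rw [Real.log_mul (by norm_num) (mul_pos (Npos j x hx) (Npos (j + 2) x hx)).ne',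
        Real.log_mul (Npos j x hx).ne' (Npos (j + 2) x hx).ne', Real.log_pow,
        show (9 : ℝ) = 3 ^ 2 by norm_num, Real.log_pow] at h1
      push_cast at h1 ⊢
      nlinarith) 128 i (by omega)
    simp only [N0 x hx] at hc
    have hi4 : (i : ℝ) ≤ 4 := by exact_mod_cast hi
    have hi0 : (1 : ℝ) ≤ i := by exact_mod_cast hi1
    have b1 : Real.log (N 128 x) ≤ |Real.log (K 128)| :=
      (Real.log_le_log (Npos 128 x hx) (NK 128 x hx)).trans (le_abs_self _)
    have b0 : Real.log (h 0 x) ≤ |Real.log (K 0)| := by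
      rw [← N0 x hx]
      exact (Real.log_le_log (Npos 0 x hx) (NK 0 x hx)).trans (le_abs_self _)
    have c1 : (i : ℝ) * Real.log (N 128 x) ≤ 4 * |Real.log (K 128)| :=
      (mul_le_mul_of_nonneg_left b1 (by linarith)).trans
        (mul_le_mul_of_nonneg_right hi4 (abs_nonneg _))
    have c0 : (4 - i : ℝ) * Real.log (h 0 x) ≤ 4 * |Real.log (K 0)| :=
      (mul_le_mul_of_nonneg_left b0 (by linarith)).trans
        (mul_le_mul_of_nonneg_right (by linarith) (abs_nonneg _))
    have c2 : (i : ℝ) * 128 ^ 2 * Real.log 3 ≤ 4 * 128 ^ 2 * Real.log 3 := by gcongr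
    have c3 : 0 ≤ 128 * ((i : ℝ) ^ 2 * Real.log 3) := by positivity
    push_cast at hc
    linarith
  set E := |Real.log (K 0)| * 4 + |Real.log (K 128)| * 4 + 4 * 128 ^ 2 * Real.log 3
  refine ⟨Real.exp (E / 128), Real.exp_pos _, fun i hi hi1 x y hx hxy => (leN i x y hx hxy).trans ?_⟩
  have := hlog i hi hi1 x hx
  rw [Real.rpow_def_of_pos (hpos x hx), ← Real.exp_add, ← Real.log_le_iff_le_exp (Npos i x hx)]
  linarith


/-- Bound for `∫ f''² / f` over a short interval, given a lower bound for `f` and control of the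
oscillation of `f''`. -/
theorem setIntegral_sq_div_le {f f' f'' : ℝ → ℝ} {a b A m₀ ρ w : ℝ} (hab : a ≤ b)
    (hρ : 0 < ρ) (hw : 0 < w) (hm₀ : 0 < m₀)
    (hf : ∀ y ∈ Set.Icc a b, HasDerivAt f (f' y) y)
    (hf' : ∀ y ∈ Set.Icc a b, HasDerivAt f' (f'' y) y)
    (hf'' : ContinuousOn f'' (Set.Icc a b))
    (hlow : ∀ y ∈ Set.Icc a b, m₀ ≤ f y) (hA : ∀ y ∈ Set.Icc a b, |f'' y| ≤ A)
    (hosc : ∀ y ∈ Set.Icc a b, ∀ z ∈ Set.Icc a b, |f'' y - f'' z| ≤ ρ) :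
    ∫ y in a..b, f'' y ^ 2 / f y
      ≤ 4 * ρ ^ 2 / m₀ * (b - a) + A ^ 2 * (2 * w / m₀ + 2 * (b - a) / (ρ * w ^ 2)) := by
  have hcont : ContinuousOn (fun y => f'' y ^ 2 / f y) (Set.Icc a b) :=
    (hf''.pow 2).div (fun y hy => (hf y hy).continuousAt.continuousWithinAt)
      fun y hy => (hm₀.trans_le (hlow y hy)).ne'
  have hint : IntegrableOn (fun y => f'' y ^ 2 / f y) (Set.Icc a b) :=
    hcont.integrableOn_compact isCompact_Icc
  rw [intervalIntegral.integral_of_le hab, ← integral_Icc_eq_integral_Ioc]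
  have t1 : 0 ≤ A ^ 2 * (2 * w / m₀ + 2 * (b - a) / (ρ * w ^ 2)) := by
    have : 0 ≤ b - a := by linarith
    positivity
  have t2 : 0 ≤ 4 * ρ ^ 2 / m₀ * (b - a) := by
    have : 0 ≤ b - a := by linarith
    positivity
  -- Either f'' is small throughout, and the lower bound m₀ suffices, or it exceeds 2ρ somewhere. In
  -- the second case, oscillation at most ρ gives it a fixed sign with |f''| ≥ ρ, so f ≥ ρw²/2 off a
  -- set of measure 2w, and m₀ is used only on that set.
  by_cases hcase : ∀ y ∈ Set.Icc a b, |f'' y| ≤ 2 * ρ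
  · have : ∫ y in Set.Icc a b, f'' y ^ 2 / f y ≤ ∫ y in Set.Icc a b, 4 * ρ ^ 2 / m₀ := by
      refine setIntegral_mono_on hint (by simp) measurableSet_Icc fun y hy => ?_
      have h1 : f'' y ^ 2 ≤ 4 * ρ ^ 2 := by
        rw [← sq_abs]
        nlinarith [hcase y hy, abs_nonneg (f'' y)]
      exact div_le_div₀ (by positivity) h1 hm₀ (hlow y hy)
    refine this.trans ?_
    rw [setIntegral_const]
    simp only [Real.volume_real_Icc_of_le hab, smul_eq_mul]
    linarith
  · push Not at hcase
    obtain ⟨y₀, hy₀, hbig⟩ := hcase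
    have hsign : (∀ y ∈ Set.Icc a b, ρ ≤ f'' y) ∨ (∀ y ∈ Set.Icc a b, f'' y ≤ -ρ) := by
      rcases lt_abs.1 hbig with h | h
      · left; intro y hy
        have := (abs_le.1 (hosc y hy y₀ hy₀)).1
        linarith
      · right; intro y hy
        have := (abs_le.1 (hosc y hy y₀ hy₀)).2
        linarith
    obtain ⟨S, hS, hSv, hSf⟩ := exists_small_sublevel hρ hw hf hf'
      (fun y hy => (hm₀.trans_le (hlow y hy)).le) hsign
    have hSfin : volume S ≠ ⊤ := (hSv.trans_lt ENNReal.ofReal_lt_top).ne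
    have hi1 : Integrable (S.indicator fun _ : ℝ => A ^ 2 / m₀) :=
      (integrable_indicator_iff hS).2 (integrableOn_const hSfin)
    have hi2 : IntegrableOn (fun _ : ℝ => A ^ 2 * (2 / (ρ * w ^ 2))) (Set.Icc a b) :=
      integrableOn_const isCompact_Icc.measure_ne_top
    have hle : ∫ y in Set.Icc a b, f'' y ^ 2 / f y ≤
        ∫ y in Set.Icc a b, (S.indicator (fun _ : ℝ => A ^ 2 / m₀) y + A ^ 2 * (2 / (ρ * w ^ 2))) := by
      refine setIntegral_mono_on hint (hi1.integrableOn.add hi2) measurableSet_Icc fun y hy => ?_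
      have h1 : f'' y ^ 2 ≤ A ^ 2 := by
        rw [← sq_abs]; exact pow_le_pow_left₀ (abs_nonneg _) (hA y hy) 2
      by_cases hyS : y ∈ S
      · rw [Set.indicator_of_mem hyS]
        have : 0 ≤ A ^ 2 * (2 / (ρ * w ^ 2)) := by positivity
        have := div_le_div₀ (by positivity) h1 hm₀ (hlow y hy)
        linarith
      · rw [Set.indicator_of_notMem hyS, zero_add]
        have h2 := hSf y hy hyS
        have := div_le_div₀ (by positivity) h1 (by positivity) h2
        refine this.trans (le_of_eq ?_)
        field_simp
    refine hle.trans ?_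
    rw [integral_add hi1.integrableOn hi2]
    have e1 : ∫ y in Set.Icc a b, S.indicator (fun _ : ℝ => A ^ 2 / m₀) y ≤ 2 * w * (A ^ 2 / m₀) := by
      have : ∫ y in Set.Icc a b, S.indicator (fun _ : ℝ => A ^ 2 / m₀) y
          ≤ ∫ y, S.indicator (fun _ : ℝ => A ^ 2 / m₀) y :=
        setIntegral_le_integral hi1 (Filter.Eventually.of_forall fun y =>
          Set.indicator_nonneg (fun _ _ => by positivity) y)
      refine this.trans ?_
      rw [integral_indicator hS, setIntegral_const, smul_eq_mul]
      refine mul_le_mul_of_nonneg_right ?_ (by positivity)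
      exact ENNReal.toReal_le_of_le_ofReal (by linarith) hSv
    have e2 : ∫ y in Set.Icc a b, A ^ 2 * (2 / (ρ * w ^ 2)) = (b - a) * (A ^ 2 * (2 / (ρ * w ^ 2))) := by
      rw [setIntegral_const]
      simp only [Real.volume_real_Icc_of_le hab, smul_eq_mul]
    rw [e2]
    have e3 : A ^ 2 * (2 * w / m₀ + 2 * (b - a) / (ρ * w ^ 2))
        = 2 * w * (A ^ 2 / m₀) + (b - a) * (A ^ 2 * (2 / (ρ * w ^ 2))) := by ring
    linarith

/-- For a positive, decreasing, smooth and rapidly decaying function `h` such that `h² ≤ C |h'|`,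
the quotient `h'''² / |h'|` is integrable against every power. -/
theorem integrableOn_third_deriv_sq_div {h : ℕ → ℝ → ℝ}
    (hd : ∀ i x, 0 < x → HasDerivAt (h i) (h (i + 1) x) x)
    (hb : ∀ i k : ℕ, ∃ C : ℝ, ∀ x, 0 < x → x ^ k * |h i x| ≤ C)
    (hpos : ∀ x, 0 < x → 0 < h 0 x) (hneg : ∀ x, 0 < x → h 1 x < 0)
    (hdec : ∃ C : ℝ, ∀ x, 0 < x → h 0 x ^ 2 ≤ C * (-h 1 x)) (k : ℕ) :
    IntegrableOn (fun x => x ^ k * (h 3 x ^ 2 / (-h 1 x))) (Set.Ioi 1) := by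
  have hanti : ∀ x y, 0 < x → x ≤ y → h 0 y ≤ h 0 x := by
    intro x y hx hxy
    refine antitoneOn_of_deriv_nonpos (convex_Ici x)
      (fun t ht => (hd 0 t (hx.trans_le ht)).continuousAt.continuousWithinAt)
      (fun t ht => (hd 0 t (hx.trans_le (interior_subset ht))).differentiableAt.differentiableWithinAt)
      (fun t ht => ?_) (le_refl x) hxy hxy
    have ht' := hx.trans_le (interior_subset ht)
    rw [(hd 0 t ht').deriv]; exact (hneg t ht').le
  obtain ⟨C₁, hC₁, hi⟩ := deriv_le_rpow_of_decay hd hb hpos hanti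
  obtain ⟨C₂, hC₂⟩ := hdec
  have hC₂pos : 0 < C₂ := by
    have h1 := hC₂ 1 one_pos
    have h2 := hneg 1 one_pos
    have h3 := pow_pos (hpos 1 one_pos) 2
    by_contra hc
    nlinarith
  -- `τ = h^{1/32}`
  let τ : ℝ → ℝ := fun x => h 0 x ^ (1 / 32 : ℝ)
  have τpos : ∀ x, 0 < x → 0 < τ x := fun x hx => Real.rpow_pos_of_pos (hpos x hx) _
  have τ32 : ∀ x, 0 < x → τ x ^ 32 = h 0 x := fun x hx => by
    simp only [τ]
    rw [← Real.rpow_natCast, ← Real.rpow_mul (hpos x hx).le]; norm_num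
  have τ31 : ∀ x, 0 < x → h 0 x ^ (31 / 32 : ℝ) = τ x ^ 31 := fun x hx => by
    simp only [τ]
    rw [← Real.rpow_natCast, ← Real.rpow_mul (hpos x hx).le]; norm_num
  have τanti : ∀ x y, 0 < x → x ≤ y → τ y ≤ τ x := fun x y hx hxy =>
    Real.rpow_le_rpow (hpos y (hx.trans_le hxy)).le (hanti x y hx hxy) (by norm_num)
  have hi' : ∀ i ≤ 4, 1 ≤ i → ∀ x y, 0 < x → x ≤ y → |h i y| ≤ C₁ * τ x ^ 31 :=
    fun i h4 h1 x y hx hxy => by rw [← τ31 x hx]; exact hi i h4 h1 x y hx hxy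
  obtain ⟨T, hT1, hT⟩ : ∃ T, 1 ≤ T ∧ ∀ x, 1 ≤ x → τ x ≤ T :=
    ⟨max 1 (τ 1), le_max_left _ _, fun x hx => (τanti 1 x one_pos hx).trans (le_max_right _ _)⟩
  -- the length of the intervals
  obtain ⟨c, hc, hc1, hc2, hc3⟩ : ∃ c : ℝ, 0 < c ∧ c * T ^ 2 ≤ 1 ∧ c * C₁ * T ≤ 1 / 2 ∧
      c * C₁ ≤ 1 := by
    refine ⟨1 / (2 * (C₁ + 1) * T ^ 2), by positivity, ?_, ?_, ?_⟩
    · rw [div_mul_eq_mul_div, div_le_one (by positivity)]; nlinarith [sq_nonneg T]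
    · rw [div_mul_eq_mul_div, div_mul_eq_mul_div, div_le_iff₀ (by positivity)]
      nlinarith [sq_nonneg T, mul_le_mul_of_nonneg_left hT1 hC₁.le]
    · rw [div_mul_eq_mul_div, div_le_one (by positivity)]
      nlinarith [mul_le_mul_of_nonneg_left (one_le_pow₀ hT1 : 1 ≤ T ^ 2) hC₁.le, sq_nonneg T]
  let ℓ : ℝ → ℝ := fun x => c * τ x ^ 2
  have ℓpos : ∀ x, 1 ≤ x → 0 < ℓ x := fun x hx => by
    have := τpos x (by linarith); positivity
  have ℓ1 : ∀ x, 1 ≤ x → ℓ x ≤ 1 := fun x hx => by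
    have := pow_le_pow_left₀ (τpos x (by linarith)).le (hT x hx) 2
    exact (mul_le_mul_of_nonneg_left this hc.le).trans hc1
  -- Over one interval h loses at most half its value, as |h'| ≤ C₁τ³¹, the length is cτ², and h =
  -- τ³². The lower bound on -h' is therefore uniform there.
  have half : ∀ x y, 1 ≤ x → x ≤ y → y ≤ x + ℓ x → h 0 x / 2 ≤ h 0 y := by
    intro x y hx hxy hy
    have hx0 : 0 < x := by linarith
    have hbd := Convex.norm_image_sub_le_of_norm_hasDerivWithin_le (f := h 0) (f' := h 1)
      (C := C₁ * τ x ^ 31) (s := Set.Icc x y)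
      (fun t ht => (hd 0 t (hx0.trans_le ht.1)).hasDerivWithinAt)
      (fun t ht => hi' 1 (by norm_num) le_rfl x t hx0 ht.1) (convex_Icc x y)
      (Set.left_mem_Icc.2 hxy) (Set.right_mem_Icc.2 hxy)
    rw [Real.norm_eq_abs, Real.norm_eq_abs, abs_of_nonneg (sub_nonneg.2 hxy)] at hbd
    have h1 : C₁ * τ x ^ 31 * (y - x) ≤ C₁ * τ x ^ 31 * ℓ x := by
      have := τpos x hx0
      exact mul_le_mul_of_nonneg_left (by linarith) (by positivity)
    have h2 : C₁ * τ x ^ 31 * ℓ x = (c * C₁ * τ x) * τ x ^ 32 := by simp only [ℓ]; ring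
    have h3 : c * C₁ * τ x ≤ 1 / 2 :=
      (mul_le_mul_of_nonneg_left (hT x hx) (by positivity)).trans hc2
    have h4 : (c * C₁ * τ x) * τ x ^ 32 ≤ 1 / 2 * τ x ^ 32 :=
      mul_le_mul_of_nonneg_right h3 (by have := τpos x hx0; positivity)
    rw [τ32 x hx0] at h4 h2
    have := (abs_le.1 hbd).1
    linarith
  -- the local estimate
  obtain ⟨D, hD, hlocal⟩ : ∃ D : ℝ, 0 < D ∧ ∀ x, 1 ≤ x →
      ∫ y in x..x + ℓ x, h 3 y ^ 2 / (-h 1 y) ≤ ℓ x * (D * τ x ^ 2) := by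
    refine ⟨16 * C₂ + C₁ ^ 2 * (8 * C₂ * T ^ 8 / c + 2 * T ^ 3), by positivity, fun x hx => ?_⟩
    have hx0 : 0 < x := by linarith
    have tp := τpos x hx0
    have hm : 0 < τ x ^ 64 / (4 * C₂) := by positivity
    -- The parameters are powers of τ, with A of size τ³¹. The oscillation of the third derivative
    -- is at most C₁τ³¹ · cτ² ≤ τ³³ = ρ. Divided by the length cτ², the three terms have sizes ρ²/m₀
    -- ~ τ², A²w/(m₀τ²) ~ τ⁸ and A²/(ρw²) ~ τ⁵, so each is bounded by a multiple of τ².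
    have := setIntegral_sq_div_le (f := fun y => -h 1 y) (f' := fun y => -h 2 y)
      (f'' := fun y => -h 3 y) (a := x) (b := x + ℓ x) (A := C₁ * τ x ^ 31)
      (m₀ := τ x ^ 64 / (4 * C₂)) (ρ := τ x ^ 33) (w := τ x ^ 12) (by linarith [ℓpos x hx])
      (by positivity) (by positivity) hm
      (fun y hy => (hd 1 y (hx0.trans_le hy.1)).neg)
      (fun y hy => (hd 2 y (hx0.trans_le hy.1)).neg)
      (fun y hy => (hd 3 y (hx0.trans_le hy.1)).continuousAt.neg.continuousWithinAt)
      (fun y hy => by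
        have h1 := half x y hx hy.1 hy.2
        have h2 := hC₂ y (hx0.trans_le hy.1)
        rw [div_le_iff₀ (by positivity)]
        have h3 : (h 0 x / 2) ^ 2 ≤ h 0 y ^ 2 :=
          pow_le_pow_left₀ (by have := hpos x hx0; positivity) h1 2
        have h4 : τ x ^ 64 = h 0 x ^ 2 := by rw [← τ32 x hx0]; ring
        rw [h4]
        linarith)
      (fun y hy => by rw [abs_neg]; exact hi' 3 (by norm_num) (by norm_num) x y hx0 hy.1)
      (fun y hy z hz => by
        have hbd := Convex.norm_image_sub_le_of_norm_hasDerivWithin_le (f := h 3) (f' := h 4)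
          (C := C₁ * τ x ^ 31) (s := Set.Icc x (x + ℓ x))
          (fun t ht => (hd 3 t (hx0.trans_le ht.1)).hasDerivWithinAt)
          (fun t ht => hi' 4 le_rfl (by norm_num) x t hx0 ht.1) (convex_Icc _ _) hy hz
        rw [Real.norm_eq_abs, Real.norm_eq_abs] at hbd
        have e : -h 3 y - -h 3 z = h 3 z - h 3 y := by ring
        rw [e]
        refine hbd.trans ?_
        have h1 : |z - y| ≤ ℓ x := abs_le.2 ⟨by linarith [hy.2, hz.1], by linarith [hy.1, hz.2]⟩
        refine (mul_le_mul_of_nonneg_left h1 (by positivity)).trans ?_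
        have e2 : C₁ * τ x ^ 31 * ℓ x = (c * C₁) * τ x ^ 33 := by simp only [ℓ]; ring
        rw [e2]
        exact mul_le_of_le_one_left (by positivity) hc3)
    simp only [neg_sq, add_sub_cancel_left] at this
    refine this.trans ?_
    have e1 : 4 * (τ x ^ 33) ^ 2 / (τ x ^ 64 / (4 * C₂)) * ℓ x
        = ℓ x * (16 * C₂ * τ x ^ 2) := by field_simp; ring
    have e2 : (C₁ * τ x ^ 31) ^ 2 * (2 * τ x ^ 12 / (τ x ^ 64 / (4 * C₂)) +
        2 * ℓ x / (τ x ^ 33 * (τ x ^ 12) ^ 2))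
        = ℓ x * (C₁ ^ 2 * (8 * C₂ * τ x ^ 6 / c + 2 * τ x ^ 3) * τ x ^ 2) := by
      simp only [ℓ]; field_simp; ring
    rw [e1, e2, ← mul_add]
    refine mul_le_mul_of_nonneg_left ?_ (ℓpos x hx).le
    rw [← add_mul]
    refine mul_le_mul_of_nonneg_right ?_ (by positivity)
    have t6 : τ x ^ 6 ≤ T ^ 8 :=
      (pow_le_pow_left₀ tp.le (hT x hx) 6).trans (pow_le_pow_right₀ hT1 (by norm_num))
    have t3 : τ x ^ 3 ≤ T ^ 3 := pow_le_pow_left₀ tp.le (hT x hx) 3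
    gcongr
  -- decay of `τ`
  obtain ⟨M, hM⟩ : ∃ M : ℝ, ∀ x, 0 < x → x ^ (k + 2) * τ x ^ 2 ≤ M := by
    -- As τ³² = h, the sixteenth power of xᵏ⁺²τ² is x^{16(k+2)} h, which is bounded.
    obtain ⟨M, hM⟩ := hb 0 ((k + 2) * 16)
    have hM0 : 0 ≤ M := le_trans (by positivity) (hM 1 one_pos)
    refine ⟨max 1 M, fun x hx => ?_⟩
    have h1 := hM x hx
    rw [abs_of_pos (hpos x hx), ← τ32 x hx, pow_mul] at h1
    have h2 : (x ^ (k + 2) * τ x ^ 2) ^ 16 ≤ M := by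
      rw [mul_pow, ← pow_mul (τ x)]; exact h1
    by_contra hlt
    push Not at hlt
    have h3 : 1 < x ^ (k + 2) * τ x ^ 2 := (le_max_left _ _).trans_lt hlt
    have h4 := le_self_pow₀ h3.le (by norm_num : (16 : ℕ) ≠ 0)
    linarith [le_max_right 1 M]
  have hM0 : 0 ≤ M := le_trans (by have := τpos 1 one_pos; positivity) (hM 1 one_pos)
  have hcontF : ContinuousOn (fun x => x ^ k * (h 3 x ^ 2 / (-h 1 x))) (Set.Ici 1) := by
    intro x hx
    have hx0 : (0 : ℝ) < x := lt_of_lt_of_le one_pos hx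
    refine ContinuousAt.continuousWithinAt ?_
    refine (continuousAt_id.pow k).mul (((hd 3 x hx0).continuousAt.pow 2).div
      (hd 1 x hx0).continuousAt.neg ?_)
    have := hneg x hx0
    linarith
  have hF0 : ∀ x, 1 ≤ x → 0 ≤ h 3 x ^ 2 / (-h 1 x) := fun x hx =>
    div_nonneg (sq_nonneg _) (by linarith [hneg x (by linarith)])
  -- The local estimate gives size xᵏτ² ≤ M x⁻² per unit length. Since ℓ ≤ 1 ≤ x, each interval lies
  -- in [x, 2x], so passing between x and y costs the factors 2ᵏ and 4.
  refine integrableOn_of_local_bound (P := fun y => 2 ^ k * 4 * (D * M) * y ^ (-2 : ℝ)) (ℓ := ℓ)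
    hcontF (fun x hx => mul_nonneg (by positivity) (hF0 x hx))
    ((integrableOn_Ioi_rpow_of_lt (by norm_num) one_pos).const_mul _)
    (fun x hx => by have : 0 < x := by linarith
                    positivity) ℓpos
    (fun x y hx hxy => by
      have := τanti x y (by linarith) hxy
      have h0 := τpos y (by linarith)
      exact mul_le_mul_of_nonneg_left (pow_le_pow_left₀ h0.le this 2) hc.le) fun x hx => ?_
  have hx0 : 0 < x := by linarith
  have hlx := ℓpos x hx
  have hxl : x ≤ x + ℓ x := by linarith
  have iF : IntervalIntegrable (fun y => h 3 y ^ 2 / (-h 1 y)) volume x (x + ℓ x) := by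
    refine ContinuousOn.intervalIntegrable fun y hy => ?_
    rw [Set.uIcc_of_le hxl] at hy
    have hy0 : 0 < y := hx0.trans_le hy.1
    exact (((hd 3 y hy0).continuousAt.pow 2).div
      (hd 1 y hy0).continuousAt.neg (neg_pos.2 (hneg y hy0)).ne').continuousWithinAt
  have s1 : ∫ y in x..x + ℓ x, y ^ k * (h 3 y ^ 2 / (-h 1 y))
      ≤ ∫ y in x..x + ℓ x, (2 * x) ^ k * (h 3 y ^ 2 / (-h 1 y)) := by
    refine intervalIntegral.integral_mono_on hxl ?_ (iF.const_mul _) fun y hy => ?_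
    · exact (hcontF.mono (by rw [Set.uIcc_of_le hxl]; exact fun t ht => hx.trans ht.1)).intervalIntegrable
    · refine mul_le_mul_of_nonneg_right (pow_le_pow_left₀ (by linarith [hy.1]) ?_ k)
        (hF0 y (hx.trans hy.1))
      linarith [hy.2, ℓ1 x hx]
  rw [intervalIntegral.integral_const_mul] at s1
  have s2 : (2 * x) ^ k * (ℓ x * (D * τ x ^ 2)) ≤ ∫ y in x..x + ℓ x, 2 ^ k * (D * M) * x ^ (-2 : ℝ) := by
    rw [intervalIntegral.integral_const, add_sub_cancel_left, smul_eq_mul, mul_pow]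
    have h1 := hM x hx0
    have e : x ^ (-2 : ℝ) = 1 / x ^ 2 := by
      rw [Real.rpow_neg hx0.le, one_div]; norm_num
    rw [e]
    have h2 : x ^ k * τ x ^ 2 ≤ M * (1 / x ^ 2) := by
      rw [mul_one_div, le_div_iff₀ (by positivity)]
      calc x ^ k * τ x ^ 2 * x ^ 2 = x ^ (k + 2) * τ x ^ 2 := by ring
        _ ≤ M := h1
    calc 2 ^ k * x ^ k * (ℓ x * (D * τ x ^ 2)) = (ℓ x * 2 ^ k * D) * (x ^ k * τ x ^ 2) := by ring
      _ ≤ (ℓ x * 2 ^ k * D) * (M * (1 / x ^ 2)) := mul_le_mul_of_nonneg_left h2 (by positivity)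
      _ = _ := by ring
  have s3 : ∫ y in x..x + ℓ x, 2 ^ k * (D * M) * x ^ (-2 : ℝ)
      ≤ ∫ y in x..x + ℓ x, 2 ^ k * 4 * (D * M) * y ^ (-2 : ℝ) := by
    refine intervalIntegral.integral_mono_on hxl (by simp) ?_ fun y hy => ?_
    · refine ContinuousOn.intervalIntegrable fun y hy => ?_
      rw [Set.uIcc_of_le hxl] at hy
      exact ((Real.continuousAt_rpow_const y _ (Or.inl (by linarith [hy.1]))).const_mul
        _).continuousWithinAt
    · have hy0 : 0 < y := hx0.trans_le hy.1
      have hy2 : y ≤ 2 * x := by linarith [hy.2, ℓ1 x hx]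
      have e : ∀ t : ℝ, 0 < t → t ^ (-2 : ℝ) = 1 / t ^ 2 := fun t ht => by
        rw [Real.rpow_neg ht.le, one_div]; norm_num
      rw [e x hx0, e y hy0]
      have h1 : 1 / x ^ 2 ≤ 4 * (1 / y ^ 2) := by
        rw [mul_one_div, div_le_div_iff₀ (by positivity) (by positivity)]
        nlinarith
      calc 2 ^ k * (D * M) * (1 / x ^ 2) ≤ 2 ^ k * (D * M) * (4 * (1 / y ^ 2)) :=
            mul_le_mul_of_nonneg_left h1 (by positivity)
        _ = _ := by ring
  exact s1.trans ((mul_le_mul_of_nonneg_left (hlocal x hx) (by positivity)).trans (s2.trans s3))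

namespace VortexPair

/-! ### One-sided calculus on `[0, ∞)` -/

/-- Smoothness on `[0, ∞)`. -/
def SmoothHalf (h : ℝ → ℝ) : Prop := ContDiffOn ℝ (⊤ : ℕ∞) h (Set.Ici 0)

theorem SmoothHalf.dq {h : ℝ → ℝ} (hh : SmoothHalf h) : SmoothHalf (VortexPair.dq h) :=
  ContDiffOn.derivWithin hh (uniqueDiffOn_Ici 0) (by exact_mod_cast le_rfl)

theorem dq_hasDeriv {h : ℝ → ℝ} (hh : ContDiffOn ℝ 1 h (Set.Ici 0)) {s : ℝ} (hs : 0 ≤ s) :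
    HasDerivWithinAt h (dq h s) (Set.Ici 0) s :=
  ((hh.differentiableOn one_ne_zero) s hs).hasDerivWithinAt

theorem SmoothHalf.one {h : ℝ → ℝ} (hh : SmoothHalf h) : ContDiffOn ℝ 1 h (Set.Ici 0) :=
  ContDiffOn.of_le hh (by exact_mod_cast le_top)

theorem SmoothHalf.hasDeriv {h : ℝ → ℝ} (hh : SmoothHalf h) {s : ℝ} (hs : 0 ≤ s) :
    HasDerivWithinAt h (VortexPair.dq h s) (Set.Ici 0) s := dq_hasDeriv hh.one hs

theorem SmoothHalf.continuousOn {h : ℝ → ℝ} (hh : SmoothHalf h) : ContinuousOn h (Set.Ici 0) :=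
  ContDiffOn.continuousOn hh

theorem hasDerivAt_of_within {h : ℝ → ℝ} {a s : ℝ} (hh : HasDerivWithinAt h a (Set.Ici 0) s)
    (hs : 0 < s) : HasDerivAt h a s := hh.hasDerivAt (Ici_mem_nhds hs)

theorem dq_eq {h : ℝ → ℝ} {a s : ℝ} (hh : HasDerivWithinAt h a (Set.Ici 0) s) (hs : 0 ≤ s) :
    dq h s = a := hh.derivWithin (uniqueDiffOn_Ici 0 s hs)

theorem contDiffOn_succ_of_hasDeriv {f f' : ℝ → ℝ} {k : ℕ}
    (hf : ∀ s, 0 ≤ s → HasDerivWithinAt f (f' s) (Set.Ici 0) s)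
    (hf' : ContDiffOn ℝ k f' (Set.Ici 0)) : ContDiffOn ℝ (k + 1 : ℕ) f (Set.Ici 0) := by
  push_cast
  rw [contDiffOn_succ_iff_derivWithin (uniqueDiffOn_Ici 0)]
  refine ⟨fun s hs => (hf s hs).differentiableWithinAt, fun h => ?_, ?_⟩
  · exact absurd h (by simp)
  · exact hf'.congr fun s hs => dq_eq (hf s hs) hs

theorem SmoothHalf.congr {f g : ℝ → ℝ} (hg : SmoothHalf g) (h : ∀ s, 0 ≤ s → f s = g s) :
    SmoothHalf f := ContDiffOn.congr hg h

theorem dq_congr {f g : ℝ → ℝ} (h : ∀ s, 0 ≤ s → f s = g s) {s : ℝ} (hs : 0 ≤ s) :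
    dq f s = dq g s := derivWithin_congr h (h s hs)

/-! ### Weighted means -/

/-- `M_n h (t) = ∫_0^1 τ^n h(tτ) dτ`. -/
def mean (n : ℕ) (h : ℝ → ℝ) (t : ℝ) : ℝ := ∫ τ in (0 : ℝ)..1, τ ^ n * h (t * τ)

theorem continuous_comp_abs {h : ℝ → ℝ} (hh : ContinuousOn h (Set.Ici 0)) :
    Continuous fun s => h |s| := hh.comp_continuous continuous_abs fun s => abs_nonneg s

theorem mean_congr {n : ℕ} {h k : ℝ → ℝ} (hk : ∀ s, 0 ≤ s → h s = k s) {t : ℝ} (ht : 0 ≤ t) :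
    mean n h t = mean n k t := by
  refine intervalIntegral.integral_congr fun τ hτ => ?_
  rw [Set.uIcc_of_le zero_le_one] at hτ
  simp only [hk _ (mul_nonneg ht hτ.1)]

theorem continuousOn_mean {n : ℕ} {h : ℝ → ℝ} (hh : ContinuousOn h (Set.Ici 0)) :
    ContinuousOn (mean n h) (Set.Ici 0) := by
  have hc : Continuous (mean n fun s => h |s|) := by
    refine intervalIntegral.continuous_parametric_intervalIntegral_of_continuous' ?_ 0 1
    exact (continuous_snd.pow n).mul ((continuous_comp_abs hh).comp (continuous_fst.mul continuous_snd))
  exact hc.continuousOn.congr fun t ht => mean_congr (fun s hs => by rw [abs_of_nonneg hs]) ht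

theorem mean_integrand_intervalIntegrable {n : ℕ} {h : ℝ → ℝ} (hh : ContinuousOn h (Set.Ici 0))
    {t : ℝ} (ht : 0 ≤ t) : IntervalIntegrable (fun τ => τ ^ n * h (t * τ)) volume 0 1 := by
  refine ContinuousOn.intervalIntegrable ?_
  rw [Set.uIcc_of_le zero_le_one]
  exact (continuousOn_id.pow n).mul (hh.comp (by fun_prop) fun τ hτ => mul_nonneg ht hτ.1)

theorem mul_pow_mean {n : ℕ} {h : ℝ → ℝ} {t : ℝ} (ht : 0 < t) :
    t ^ (n + 1) * mean n h t = ∫ u in (0 : ℝ)..t, u ^ n * h u := by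
  have h1 := intervalIntegral.integral_comp_mul_left (a := 0) (b := 1)
    (fun u => u ^ n * h u) ht.ne'
  simp only [mul_zero, mul_one, smul_eq_mul] at h1
  rw [eq_inv_mul_iff_mul_eq₀ ht.ne'] at h1
  rw [← h1, mean, pow_succ, mul_comm (t ^ n) t, mul_assoc, ← intervalIntegral.integral_const_mul]
  congr 1
  refine intervalIntegral.integral_congr fun τ _ => ?_
  simp only [mul_pow]; ring

theorem hasDerivAt_mean {n : ℕ} {h : ℝ → ℝ} (hh : ContinuousOn h (Set.Ici 0)) {t : ℝ} (ht : 0 < t) :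
    HasDerivAt (mean n h) ((h t - (n + 1) * mean n h t) / t) t := by
  have hc : ContinuousOn (fun u => u ^ n * h u) (Set.Ici 0) := (continuousOn_id.pow n).mul hh
  have hi : IntervalIntegrable (fun u => u ^ n * h u) volume 0 t :=
    (hc.mono (by rw [Set.uIcc_of_le ht.le]; exact fun u hu => hu.1)).intervalIntegrable
  have hat : ContinuousAt (fun u => u ^ n * h u) t := hc.continuousAt (Ici_mem_nhds ht)
  have hm : StronglyMeasurableAtFilter (fun u => u ^ n * h u) (nhds t) volume :=
    (hc.mono Set.Ioi_subset_Ici_self).stronglyMeasurableAtFilter isOpen_Ioi t ht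
  have hF := intervalIntegral.integral_hasDerivAt_right hi hm hat
  have hp : HasDerivAt (fun t : ℝ => t ^ (n + 1)) ((n + 1 : ℝ) * t ^ n) t := by
    simpa using hasDerivAt_pow (n + 1) t
  have hq := hF.div hp (pow_ne_zero _ ht.ne')
  have heq : mean n h =ᶠ[nhds t]
      fun t => (∫ u in (0 : ℝ)..t, u ^ n * h u) / t ^ (n + 1) := by
    filter_upwards [Ioi_mem_nhds ht] with u hu
    rw [← mul_pow_mean hu, mul_div_cancel_left₀ _ (pow_ne_zero _ (ne_of_gt hu))]
  refine (hq.congr_of_eventuallyEq heq).congr_deriv ?_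
  rw [← mul_pow_mean ht]
  field_simp
  ring

theorem mean_zero_arg {n : ℕ} {h : ℝ → ℝ} : mean n h 0 = h 0 / (n + 1) := by
  simp only [mean, zero_mul, intervalIntegral.integral_mul_const, integral_pow]
  simp; ring

/-- Integration by parts of τⁿ⁺¹ h(tτ). The right side is what differentiating the mean produces
over t, so the identity removes the apparent singularity at t = 0. -/
theorem mean_succ_dq {n : ℕ} {h : ℝ → ℝ} (hh : ContDiffOn ℝ 1 h (Set.Ici 0)) {t : ℝ} (ht : 0 < t) :
    t * mean (n + 1) (dq h) t = h t - (n + 1) * mean n h t := by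
  have hdc : ContinuousOn (dq h) (Set.Ici 0) :=
    hh.continuousOn_derivWithin (uniqueDiffOn_Ici 0) le_rfl
  have i1 := (mean_integrand_intervalIntegrable (n := n + 1) hdc ht.le).const_mul t
  have i2 := (mean_integrand_intervalIntegrable (n := n) hh.continuousOn ht.le).const_mul (n + 1 : ℝ)
  have key := intervalIntegral.integral_eq_sub_of_hasDerivAt_of_le (a := 0) (b := 1)
    (f := fun τ => τ ^ (n + 1) * h (t * τ))
    (f' := fun τ => t * (τ ^ (n + 1) * dq h (t * τ)) + (n + 1 : ℝ) * (τ ^ n * h (t * τ)))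
    zero_le_one
    ((continuousOn_id.pow _).mul (hh.continuousOn.comp (by fun_prop)
      fun τ hτ => mul_nonneg ht.le hτ.1))
    (fun τ hτ => by
      have h1 : HasDerivAt h (dq h (t * τ)) (t * τ) :=
        hasDerivAt_of_within (dq_hasDeriv hh (mul_pos ht hτ.1).le) (mul_pos ht hτ.1)
      have h2 : HasDerivAt (fun τ : ℝ => t * τ) t τ := by simpa using (hasDerivAt_id τ).const_mul t
      have h3 : HasDerivAt (fun τ : ℝ => τ ^ (n + 1)) ((n + 1 : ℝ) * τ ^ n) τ := by
        simpa using hasDerivAt_pow (n + 1) τ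
      refine (h3.mul (h1.comp τ h2)).congr_deriv ?_
      simp only [Function.comp]
      ring)
    (i1.add i2)
  rw [intervalIntegral.integral_add i1 i2, intervalIntegral.integral_const_mul,
    intervalIntegral.integral_const_mul] at key
  simp only [mul_one, one_pow, one_mul, mul_zero, ne_eq, Nat.add_eq_zero_iff, one_ne_zero, and_false,
    not_false_eq_true, zero_pow, zero_mul, sub_zero] at key
  change t * mean (n + 1) (dq h) t + (n + 1) * mean n h t = h t at key
  linarith

/-- For t > 0 this combines the quotient formula with integration by parts; at t = 0 it follows
because the derivative extends continuously. -/
theorem mean_hasDeriv {n : ℕ} {h : ℝ → ℝ} (hh : ContDiffOn ℝ 1 h (Set.Ici 0)) {t : ℝ} (ht : 0 ≤ t) :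
    HasDerivWithinAt (mean n h) (mean (n + 1) (dq h) t) (Set.Ici 0) t := by
  have pos : ∀ t, 0 < t → HasDerivAt (mean n h) (mean (n + 1) (dq h) t) t := fun t ht =>
    (hasDerivAt_mean hh.continuousOn ht).congr_deriv (by
      rw [← mean_succ_dq hh ht, mul_div_cancel_left₀ _ ht.ne'])
  rcases ht.eq_or_lt with rfl | ht
  · have hdc : ContinuousOn (dq h) (Set.Ici 0) :=
      hh.continuousOn_derivWithin (uniqueDiffOn_Ici 0) le_rfl
    refine hasDerivWithinAt_Ici_of_tendsto_deriv (s := Set.Ioi 0)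
      (fun t ht => (pos t ht).differentiableAt.differentiableWithinAt)
      (((continuousOn_mean hh.continuousOn) 0 (le_refl (0 : ℝ))).mono Set.Ioi_subset_Ici_self)
      self_mem_nhdsWithin ?_
    have := ((continuousOn_mean (n := n + 1) hdc) 0 (le_refl (0 : ℝ))).mono Set.Ioi_subset_Ici_self
    refine this.tendsto.congr' ?_
    filter_upwards [self_mem_nhdsWithin] with t ht using (pos t ht).deriv.symm
  · exact (pos t ht).hasDerivWithinAt

/-- Differentiation turns the n-th mean of h into the (n+1)-st mean of h', so the induction on the
order of smoothness must leave n and h free. -/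
theorem contDiffOn_mean (k : ℕ) : ∀ (n : ℕ) {h : ℝ → ℝ}, ContDiffOn ℝ k h (Set.Ici 0) →
    ContDiffOn ℝ k (mean n h) (Set.Ici 0) := by
  induction k with
  | zero =>
    intro n h hh
    exact contDiffOn_zero.2 (continuousOn_mean (contDiffOn_zero.1 hh))
  | succ k ih =>
    intro n h hh
    have h1 : ContDiffOn ℝ 1 h (Set.Ici 0) := hh.of_le (by exact_mod_cast Nat.le_add_left 1 k)
    exact contDiffOn_succ_of_hasDeriv (fun s hs => mean_hasDeriv h1 hs)
      (ih (n + 1) (hh.derivWithin (uniqueDiffOn_Ici 0) (by exact_mod_cast le_rfl)))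

theorem SmoothHalf.mean {h : ℝ → ℝ} (hh : SmoothHalf h) (n : ℕ) : SmoothHalf (mean n h) :=
  contDiffOn_infty.2 fun k => contDiffOn_mean k n (contDiffOn_infty.1 hh k)

theorem SmoothHalf.dq_mean {h : ℝ → ℝ} (hh : SmoothHalf h) (n : ℕ) {t : ℝ} (ht : 0 ≤ t) :
    VortexPair.dq (VortexPair.mean n h) t = VortexPair.mean (n + 1) (VortexPair.dq h) t :=
  dq_eq (mean_hasDeriv hh.one ht) ht

theorem abs_mean_le {n : ℕ} {h k : ℝ → ℝ} (hk : ContinuousOn k (Set.Ici 0))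
    (hle : ∀ s, 0 ≤ s → |h s| ≤ k s) {t : ℝ} (ht : 0 ≤ t) : |mean n h t| ≤ mean n k t := by
  rw [← Real.norm_eq_abs]
  refine intervalIntegral.norm_integral_le_of_norm_le zero_le_one
    (Filter.Eventually.of_forall fun τ hτ => ?_) (mean_integrand_intervalIntegrable hk ht)
  rw [norm_mul, Real.norm_eq_abs, Real.norm_eq_abs, abs_of_nonneg (pow_nonneg hτ.1.le n)]
  exact mul_le_mul_of_nonneg_left (hle _ (mul_nonneg ht hτ.1.le)) (pow_nonneg hτ.1.le n)

theorem abs_mean_le_const {n : ℕ} {h : ℝ → ℝ} {C : ℝ} (hle : ∀ s, 0 ≤ s → |h s| ≤ C) {t : ℝ}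
    (ht : 0 ≤ t) : |mean n h t| ≤ C := by
  have hC : 0 ≤ C := (abs_nonneg _).trans (hle 0 le_rfl)
  refine (abs_mean_le (k := fun _ => C) continuousOn_const hle ht).trans ?_
  simp only [mean, intervalIntegral.integral_mul_const, integral_pow]
  simp only [one_pow, ne_eq, Nat.add_eq_zero_iff, one_ne_zero, and_false, not_false_eq_true,
    zero_pow, sub_zero]
  refine mul_le_of_le_one_left hC ?_
  rw [div_le_one (by positivity)]
  linarith [(Nat.cast_nonneg n : (0 : ℝ) ≤ n)]

/-- Means of order `n ≥ 2` preserve the decay `(s + δ)^{-2}`. -/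
theorem abs_mean_le_sq {n : ℕ} (hn : 2 ≤ n) {h : ℝ → ℝ} {H δ : ℝ} (hδ : 0 < δ)
    (hle : ∀ s, 0 ≤ s → |h s| ≤ H / (s + δ) ^ 2) {t : ℝ} (ht : 0 ≤ t) :
    |mean n h t| ≤ H / ((n - 1) * (t + δ) ^ 2) := by
  have hH : 0 ≤ H := by
    have := (abs_nonneg _).trans (hle 0 le_rfl)
    by_contra hneg
    have : H / (0 + δ) ^ 2 < 0 := div_neg_of_neg_of_pos (not_le.1 hneg) (by positivity)
    linarith
  have hn1 : (0 : ℝ) < n - 1 := by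
    have : (2 : ℝ) ≤ n := by exact_mod_cast hn
    linarith
  have hk : ContinuousOn (fun s : ℝ => H / (s + δ) ^ 2) (Set.Ici 0) := by
    refine continuousOn_const.div (by fun_prop) fun s hs => ?_
    have : 0 < s + δ := by have : 0 ≤ s := hs
                           linarith
    positivity
  refine (abs_mean_le hk hle ht).trans ?_
  have hb : mean n (fun s => H / (s + δ) ^ 2) t ≤
      ∫ τ in (0 : ℝ)..1, τ ^ (n - 2) * (H / (t + δ) ^ 2) := by
    refine intervalIntegral.integral_mono_on zero_le_one (mean_integrand_intervalIntegrable hk ht)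
      ((by fun_prop : Continuous fun τ : ℝ => τ ^ (n - 2) * (H / (t + δ) ^ 2)).intervalIntegrable _ _)
      fun τ hτ => ?_
    have e : τ ^ n = τ ^ (n - 2) * τ ^ 2 := by rw [← pow_add]; congr 1; omega
    rw [e, mul_assoc]
    refine mul_le_mul_of_nonneg_left ?_ (pow_nonneg hτ.1 _)
    rw [← mul_div_assoc, div_le_div_iff₀ (by have := mul_nonneg ht hτ.1; positivity) (by positivity)]
    -- The comparison of weights uses up two factors τ. The remaining integral of τⁿ⁻² equals 1/(n -
    -- 1), the sharp constant wanted here.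
    have h1 : τ * (t + δ) ≤ t * τ + δ := by nlinarith [hτ.2]
    have h2 : (τ * (t + δ)) ^ 2 ≤ (t * τ + δ) ^ 2 :=
      pow_le_pow_left₀ (mul_nonneg hτ.1 (by linarith)) h1 2
    calc τ ^ 2 * H * (t + δ) ^ 2 = H * (τ * (t + δ)) ^ 2 := by ring
      _ ≤ H * (t * τ + δ) ^ 2 := mul_le_mul_of_nonneg_left h2 hH
  refine hb.trans (le_of_eq ?_)
  rw [intervalIntegral.integral_mul_const, integral_pow]
  have e : ((n - 2 : ℕ) : ℝ) + 1 = n - 1 := by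
    rw [Nat.cast_sub hn]; push_cast; ring
  rw [e]
  have hne : n - 2 + 1 ≠ 0 := by omega
  rw [one_pow, zero_pow hne, sub_zero, one_div, div_eq_mul_inv, div_eq_mul_inv, mul_inv]
  ring

/-- Means of order `n` turn the decay `(1 + s)^{-n-2}` into `(1 + s)^{-n-1}`. -/
theorem abs_mean_le_pow {n : ℕ} {h : ℝ → ℝ} {H : ℝ}
    (hle : ∀ s, 0 ≤ s → (1 + s) ^ (n + 2) * |h s| ≤ H) {t : ℝ} (ht : 0 ≤ t) :
    (1 + t) ^ (n + 1) * |mean n h t| ≤ H := by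
  have hH : 0 ≤ H := le_trans (by positivity) (hle 0 le_rfl)
  have hk : ContinuousOn (fun s : ℝ => H / (1 + s) ^ (n + 2)) (Set.Ici 0) := by
    refine continuousOn_const.div (by fun_prop) fun s hs => ?_
    have : 0 < 1 + s := by have : 0 ≤ s := hs
                           linarith
    positivity
  have h1 := abs_mean_le (n := n) hk (fun s hs => by
    rw [le_div_iff₀ (by positivity), mul_comm]; exact hle s hs) ht
  have hcont : ContinuousOn (fun τ : ℝ => H / (1 + t) ^ n * (1 / (1 + t * τ) ^ 2)) (Set.Icc 0 1) := by
    refine continuousOn_const.mul (continuousOn_const.div (by fun_prop) fun τ hτ => ?_)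
    have := mul_nonneg ht hτ.1
    positivity
  have h2 : mean n (fun s => H / (1 + s) ^ (n + 2)) t ≤
      ∫ τ in (0 : ℝ)..1, H / (1 + t) ^ n * (1 / (1 + t * τ) ^ 2) := by
    refine intervalIntegral.integral_mono_on zero_le_one (mean_integrand_intervalIntegrable hk ht)
      (ContinuousOn.intervalIntegrable (by rwa [Set.uIcc_of_le zero_le_one])) fun τ hτ => ?_
    have hp : 0 < 1 + t * τ := by have := mul_nonneg ht hτ.1; positivity
    simp only
    rw [pow_add, ← mul_div_assoc, div_mul_div_comm, mul_one,
      div_le_div_iff₀ (by positivity) (by positivity)]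
    -- All n factors τ are spent on n powers of the weight; the two powers left over integrate
    -- explicitly to 1/(1 + t).
    have h3 : (τ * (1 + t)) ^ n ≤ (1 + t * τ) ^ n :=
      pow_le_pow_left₀ (mul_nonneg hτ.1 (by linarith)) (by nlinarith [hτ.2]) n
    calc τ ^ n * H * ((1 + t) ^ n * (1 + t * τ) ^ 2)
        = (τ * (1 + t)) ^ n * (H * (1 + t * τ) ^ 2) := by rw [mul_pow]; ring
      _ ≤ (1 + t * τ) ^ n * (H * (1 + t * τ) ^ 2) :=
        mul_le_mul_of_nonneg_right h3 (by positivity)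
      _ = _ := by ring
  have h3 : ∫ τ in (0 : ℝ)..1, 1 / (1 + t * τ) ^ 2 = 1 / (1 + t) := by
    have := intervalIntegral.integral_eq_sub_of_hasDerivAt_of_le (a := 0) (b := 1)
      (f := fun τ => τ / (1 + t * τ)) (f' := fun τ => 1 / (1 + t * τ) ^ 2) zero_le_one
      (continuousOn_id.div (by fun_prop) fun τ hτ => by
        have := mul_nonneg ht hτ.1; positivity)
      (fun τ hτ => by
        have hp : 0 < 1 + t * τ := by have := mul_nonneg ht hτ.1.le; positivity
        have h2 : HasDerivAt (fun τ : ℝ => 1 + t * τ) t τ := by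
          simpa using ((hasDerivAt_id τ).const_mul t).const_add 1
        refine ((hasDerivAt_id τ).div h2 hp.ne').congr_deriv ?_
        simp only [id]; congr 1; ring)
      (ContinuousOn.intervalIntegrable (by
        rw [Set.uIcc_of_le zero_le_one]
        refine continuousOn_const.div (by fun_prop) fun τ hτ => ?_
        have := mul_nonneg ht hτ.1; positivity))
    simpa using this
  rw [intervalIntegral.integral_const_mul, h3] at h2
  have h4 := h1.trans h2
  calc (1 + t) ^ (n + 1) * |mean n h t|
      ≤ (1 + t) ^ (n + 1) * (H / (1 + t) ^ n * (1 / (1 + t))) :=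
        mul_le_mul_of_nonneg_left h4 (by positivity)
    _ = H := by field_simp; ring

/-! ### The Green operator -/

/-- `G_n b (s) = (1/4n) (s^{-n} ∫_0^s u^n b(u) du + ∫_s^∞ b(u) du)`, the decaying solution `α` of
`-4 (s α'' + (n + 1) α') = b`. -/
def green (n : ℕ) (b : ℝ → ℝ) (s : ℝ) : ℝ :=
  1 / (4 * n) * (s * mean n b s + ∫ u in Set.Ioi s, b u)

theorem continuousOn_tail {b : ℝ → ℝ} (hi : IntegrableOn b (Set.Ioi 0)) :
    ContinuousOn (fun s => ∫ u in Set.Ioi s, b u) (Set.Ici 0) := by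
  have h1 : ContinuousOn (fun s => (∫ u in Set.Ioi 0, b u) - ∫ u in (0 : ℝ)..s, b u) (Set.Ici 0) := by
    refine continuousOn_const.sub fun s hs => ?_
    have := intervalIntegral.continuousOn_primitive_interval' (μ := volume) (f := b) (a := 0)
      (b₁ := 0) (b₂ := s + 1) ((intervalIntegrable_iff_integrableOn_Ioc_of_le
        (by have : (0 : ℝ) ≤ s := hs
            linarith)).2 (hi.mono_set Set.Ioc_subset_Ioi_self)) Set.left_mem_uIcc
    rw [Set.uIcc_of_le (by have : (0 : ℝ) ≤ s := hs
                           linarith)] at this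
    refine (this s ⟨hs, by linarith⟩).mono_of_mem_nhdsWithin ?_
    refine mem_nhdsWithin.2 ⟨Set.Iio (s + 1), isOpen_Iio, by simp, fun u hu => ⟨hu.2, hu.1.le⟩⟩
  refine h1.congr fun s hs => ?_
  have := intervalIntegral.integral_interval_add_Ioi hi
    (hi.mono_set (Set.Ioi_subset_Ioi (show (0 : ℝ) ≤ s from hs)))
  simp only
  linarith

theorem continuousOn_green {n : ℕ} {b : ℝ → ℝ} (hb : ContinuousOn b (Set.Ici 0))
    (hi : IntegrableOn b (Set.Ioi 0)) : ContinuousOn (green n b) (Set.Ici 0) :=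
  continuousOn_const.mul ((continuousOn_id.mul (continuousOn_mean hb)).add (continuousOn_tail hi))

/-- The contributions ±b of the two integrals cancel, leaving a single mean. Regularity of G_n b up
to s = 0 thus reduces to regularity of means. -/
theorem green_hasDeriv {n : ℕ} (hn : n ≠ 0) {b : ℝ → ℝ} (hb : ContinuousOn b (Set.Ici 0))
    (hi : IntegrableOn b (Set.Ioi 0)) {s : ℝ} (hs : 0 ≤ s) :
    HasDerivWithinAt (green n b) (-(1 / 4) * mean n b s) (Set.Ici 0) s := by
  have pos : ∀ s, 0 < s → HasDerivAt (green n b) (-(1 / 4) * mean n b s) s := by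
    intro s hs
    have h1 := (hasDerivAt_id s).mul (hasDerivAt_mean (n := n) hb hs)
    have hint : IntervalIntegrable b volume 0 s :=
      (hb.mono (by rw [Set.uIcc_of_le hs.le]; exact fun u hu => hu.1)).intervalIntegrable
    have h2 := (intervalIntegral.integral_hasDerivAt_right hint
      ((hb.mono Set.Ioi_subset_Ici_self).stronglyMeasurableAtFilter isOpen_Ioi s hs)
      (hb.continuousAt (Ici_mem_nhds hs))).const_sub (∫ u in Set.Ioi 0, b u)
    have h3 : HasDerivAt (fun s => ∫ u in Set.Ioi s, b u) (-b s) s := by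
      refine h2.congr_of_eventuallyEq ?_
      filter_upwards [Ioi_mem_nhds hs] with u hu
      have := intervalIntegral.integral_interval_add_Ioi hi
        (hi.mono_set (Set.Ioi_subset_Ioi (le_of_lt (show (0 : ℝ) < u from hu))))
      linarith
    refine ((h1.add h3).const_mul (1 / (4 * n : ℝ))).congr_deriv ?_
    have : (n : ℝ) ≠ 0 := by exact_mod_cast hn
    simp only [id]
    field_simp
    ring
  rcases hs.eq_or_lt with rfl | hs
  · refine hasDerivWithinAt_Ici_of_tendsto_deriv (s := Set.Ioi 0)
      (fun t ht => (pos t ht).differentiableAt.differentiableWithinAt)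
      (((continuousOn_green hb hi) 0 (le_refl (0 : ℝ))).mono Set.Ioi_subset_Ici_self)
      self_mem_nhdsWithin ?_
    have := (((continuousOn_mean (n := n) hb) 0 (le_refl (0 : ℝ))).mono
      Set.Ioi_subset_Ici_self).const_mul (-(1 / 4))
    refine Filter.Tendsto.congr' ?_ this
    filter_upwards [self_mem_nhdsWithin] with t ht using (pos t ht).deriv.symm
  · exact (pos s hs).hasDerivWithinAt

theorem integrableOn_div_sq {δ : ℝ} (hδ : 0 < δ) (H : ℝ) {s : ℝ} (hs : 0 ≤ s) :
    IntegrableOn (fun u : ℝ => H / (u + δ) ^ 2) (Set.Ioi s) ∧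
      ∫ u in Set.Ioi s, H / (u + δ) ^ 2 = H / (s + δ) := by
  have hd : ∀ x ∈ Set.Ici s, HasDerivAt (fun u : ℝ => -(1 / (u + δ))) (1 / (x + δ) ^ 2) x := by
    intro x hx
    have hp : x + δ ≠ 0 := by have : s ≤ x := hx
                              linarith
    have := ((hasDerivAt_id x).add_const δ).inv hp
    simp only [id] at this
    refine (this.neg.congr_deriv (by ring)).congr_of_eventuallyEq
      (Filter.Eventually.of_forall fun u => by simp [one_div])
  have ht : Filter.Tendsto (fun u : ℝ => -(1 / (u + δ))) Filter.atTop (nhds 0) := by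
    have : Filter.Tendsto (fun u : ℝ => u + δ) Filter.atTop Filter.atTop :=
      Filter.tendsto_atTop_add_const_right _ _ Filter.tendsto_id
    simpa [one_div] using (tendsto_inv_atTop_zero.comp this).neg
  have hint : IntegrableOn (fun u : ℝ => 1 / (u + δ) ^ 2) (Set.Ioi s) :=
    integrableOn_Ioi_deriv_of_nonneg' hd (fun x _ => by positivity) ht
  have hval := integral_Ioi_of_hasDerivAt_of_tendsto' hd hint ht
  have e : (fun u : ℝ => H / (u + δ) ^ 2) = fun u => H * (1 / (u + δ) ^ 2) := by
    funext u; rw [mul_one_div]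
  rw [e]
  refine ⟨hint.const_mul H, ?_⟩
  rw [integral_const_mul, hval]
  simp only [sub_neg_eq_add, zero_add, mul_one_div]

theorem integrableOn_of_le_div_sq {b : ℝ → ℝ} (hb : ContinuousOn b (Set.Ici 0)) {δ H : ℝ} (hδ : 0 < δ)
    (hle : ∀ s, 0 ≤ s → |b s| ≤ H / (s + δ) ^ 2) : IntegrableOn b (Set.Ioi 0) := by
  refine (integrableOn_div_sq hδ H le_rfl).1.mono'
    ((hb.mono Set.Ioi_subset_Ici_self).aestronglyMeasurable measurableSet_Ioi) ?_
  filter_upwards [ae_restrict_mem measurableSet_Ioi] with u hu using hle u (le_of_lt hu)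

/-- The two integrals contribute 1/(n - 1) and 1, and (1/4n)(1/(n - 1) + 1) = 1/(4(n - 1)), which is
at most 1/4 from n = 2 on. This constant decides the contraction. -/
theorem abs_green_le {n : ℕ} (hn : 2 ≤ n) {b : ℝ → ℝ} {H δ : ℝ}
    (hδ : 0 < δ) (hle : ∀ s, 0 ≤ s → |b s| ≤ H / (s + δ) ^ 2) {s : ℝ} (hs : 0 ≤ s) :
    (s + δ) * |green n b s| ≤ H / 4 := by
  have hH : 0 ≤ H := by
    have := (abs_nonneg _).trans (hle 0 le_rfl)
    by_contra hneg
    have : H / (0 + δ) ^ 2 < 0 := div_neg_of_neg_of_pos (not_le.1 hneg) (by positivity)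
    linarith
  have h1 := abs_mean_le_sq hn hδ hle hs
  have h2 : |∫ u in Set.Ioi s, b u| ≤ H / (s + δ) := by
    rw [← (integrableOn_div_sq hδ H hs).2, ← Real.norm_eq_abs]
    refine norm_integral_le_of_norm_le (integrableOn_div_sq hδ H hs).1 ?_
    filter_upwards [ae_restrict_mem measurableSet_Ioi] with u hu using hle u (hs.trans (le_of_lt hu))
  have hn2 : (2 : ℝ) ≤ n := by exact_mod_cast hn
  have hp : 0 < s + δ := by linarith
  have h3 : |s * mean n b s| ≤ (s + δ) * (H / ((n - 1) * (s + δ) ^ 2)) := by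
    rw [abs_mul, abs_of_nonneg hs]
    exact mul_le_mul (by linarith) h1 (abs_nonneg _) hp.le
  have e3 : (s + δ) * (H / ((n - 1) * (s + δ) ^ 2)) = H / ((n - 1) * (s + δ)) := by
    have : (n : ℝ) - 1 ≠ 0 := by linarith
    field_simp
  rw [e3] at h3
  rw [green, abs_mul, abs_of_nonneg (by positivity)]
  have h4 := (abs_add_le (s * mean n b s) (∫ u in Set.Ioi s, b u)).trans (add_le_add h3 h2)
  have h5 : (s + δ) * (1 / (4 * n) * |s * mean n b s + ∫ u in Set.Ioi s, b u|)
      ≤ (s + δ) * (1 / (4 * n) * (H / ((n - 1) * (s + δ)) + H / (s + δ))) := by gcongr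
  refine h5.trans ?_
  have e5 : (s + δ) * (1 / (4 * n) * (H / ((n - 1) * (s + δ)) + H / (s + δ)))
      = H / 4 * (1 / (n - 1)) := by
    have : (n : ℝ) - 1 ≠ 0 := by linarith
    field_simp
    ring
  rw [e5]
  refine mul_le_of_le_one_right (by linarith) ?_
  rw [div_le_one (by linarith)]
  linarith

/-- The decay s⁻ⁿ of the coefficient makes the stream function Re(ζzⁿ)α fall off like |x|⁻ⁿ, as that
of an n-fold multipole should. -/
theorem abs_green_le_pow {n : ℕ} (hn : n ≠ 0) {b : ℝ → ℝ} {H : ℝ}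
    (hle : ∀ s, 0 ≤ s → (1 + s) ^ (n + 2) * |b s| ≤ H) {s : ℝ} (hs : 0 ≤ s) :
    (1 + s) ^ n * |green n b s| ≤ H := by
  have hH : 0 ≤ H := le_trans (by positivity) (hle 0 le_rfl)
  have h1 := abs_mean_le_pow hle hs
  have h2 : |∫ u in Set.Ioi s, b u| ≤ H / (1 + s) ^ n / (s + 1) := by
    rw [← (integrableOn_div_sq one_pos (H / (1 + s) ^ n) hs).2, ← Real.norm_eq_abs]
    refine norm_integral_le_of_norm_le (integrableOn_div_sq one_pos _ hs).1 ?_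
    filter_upwards [ae_restrict_mem measurableSet_Ioi] with u hu
    have hu' : s ≤ u := le_of_lt hu
    have hu0 : 0 ≤ u := hs.trans hu'
    rw [Real.norm_eq_abs, div_div, le_div_iff₀ (by positivity)]
    refine le_trans ?_ (hle u hu0)
    rw [mul_comm, pow_add, add_comm u 1]
    gcongr
  have hn1 : (1 : ℝ) ≤ n := by exact_mod_cast Nat.one_le_iff_ne_zero.2 hn
  have h3 : (1 + s) ^ n * |s * mean n b s| ≤ H := by
    rw [abs_mul, abs_of_nonneg hs]
    refine le_trans ?_ h1
    rw [pow_succ, mul_assoc]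
    gcongr
    linarith
  have h4 : (1 + s) ^ n * |∫ u in Set.Ioi s, b u| ≤ H := by
    refine (mul_le_mul_of_nonneg_left h2 (by positivity)).trans ?_
    have e : (1 + s) ^ n * (H / (1 + s) ^ n / (s + 1)) = H / (s + 1) := by field_simp
    rw [e]
    exact div_le_self hH (by linarith)
  rw [green, abs_mul, abs_of_nonneg (by positivity)]
  have h5 := mul_le_mul_of_nonneg_left (abs_add_le (s * mean n b s) (∫ u in Set.Ioi s, b u))
    (by positivity : (0 : ℝ) ≤ (1 + s) ^ n)
  have h6 : 1 / (4 * (n : ℝ)) ≤ 1 / 4 := by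
    refine one_div_le_one_div_of_le (by norm_num) (by linarith)
  have h7 : (1 + s) ^ n * (1 / (4 * n) * |s * mean n b s + ∫ u in Set.Ioi s, b u|)
      ≤ 1 / 4 * ((1 + s) ^ n * |s * mean n b s + ∫ u in Set.Ioi s, b u|) := by
    rw [← mul_assoc, mul_comm ((1 + s) ^ n) (1 / (4 * (n : ℝ))), mul_assoc]
    exact mul_le_mul_of_nonneg_right h6 (by positivity)
  linarith

end VortexPair

namespace VortexPair

/-! ### Classes of radial coefficients -/

/-- At most polynomial growth on `[0, ∞)`. -/
def PolyBdd (h : ℝ → ℝ) : Prop := ∃ (C : ℝ) (k : ℕ), ∀ s, 0 ≤ s → |h s| ≤ C * (1 + s) ^ k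

/-- Decay on `[0, ∞)` faster than every power. -/
def Rapid (h : ℝ → ℝ) : Prop := ∀ k : ℕ, ∃ C : ℝ, ∀ s, 0 ≤ s → (1 + s) ^ k * |h s| ≤ C

/-- Square integrability of `x ↦ h(|x|²)` against every polynomial multiple of the weight. -/
def WeightedSq (q h : ℝ → ℝ) : Prop :=
  ∀ k : ℕ, Integrable (fun x : Plane => (1 + ‖x‖ ^ 2) ^ k * (h (‖x‖ ^ 2) ^ 2 * weight q x))

theorem PolyBdd.congr {f g : ℝ → ℝ} (hg : PolyBdd g) (h : ∀ s, 0 ≤ s → f s = g s) : PolyBdd f := by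
  obtain ⟨C, k, hC⟩ := hg
  exact ⟨C, k, fun s hs => by rw [h s hs]; exact hC s hs⟩

theorem Rapid.congr {f g : ℝ → ℝ} (hg : Rapid g) (h : ∀ s, 0 ≤ s → f s = g s) : Rapid f := fun k => by
  obtain ⟨C, hC⟩ := hg k
  exact ⟨C, fun s hs => by rw [h s hs]; exact hC s hs⟩

theorem WeightedSq.congr {q f g : ℝ → ℝ} (hg : WeightedSq q g) (h : ∀ s, 0 ≤ s → f s = g s) :
    WeightedSq q f := fun k => (hg k).congr (Filter.Eventually.of_forall fun x => by
      simp only [h _ (sq_nonneg ‖x‖)])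

theorem PolyBdd.const (c : ℝ) : PolyBdd fun _ => c := ⟨|c|, 0, fun s _ => by simp⟩

theorem PolyBdd.add {f g : ℝ → ℝ} (hf : PolyBdd f) (hg : PolyBdd g) :
    PolyBdd fun s => f s + g s := by
  obtain ⟨C, k, hC⟩ := hf
  obtain ⟨D, l, hD⟩ := hg
  refine ⟨|C| + |D|, k + l, fun s hs => ?_⟩
  have h1 : (1 : ℝ) ≤ 1 + s := by linarith
  have e1 : (1 + s) ^ k ≤ (1 + s) ^ (k + l) := pow_le_pow_right₀ h1 (Nat.le_add_right k l)
  have e2 : (1 + s) ^ l ≤ (1 + s) ^ (k + l) := pow_le_pow_right₀ h1 (Nat.le_add_left l k)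
  calc |f s + g s| ≤ |f s| + |g s| := abs_add_le _ _
    _ ≤ |C| * (1 + s) ^ k + |D| * (1 + s) ^ l :=
      add_le_add ((hC s hs).trans (by gcongr; exact le_abs_self C))
        ((hD s hs).trans (by gcongr; exact le_abs_self D))
    _ ≤ |C| * (1 + s) ^ (k + l) + |D| * (1 + s) ^ (k + l) := by gcongr
    _ = _ := by ring

theorem PolyBdd.mul {f g : ℝ → ℝ} (hf : PolyBdd f) (hg : PolyBdd g) :
    PolyBdd fun s => f s * g s := by
  obtain ⟨C, k, hC⟩ := hf
  obtain ⟨D, l, hD⟩ := hg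
  refine ⟨C * D, k + l, fun s hs => ?_⟩
  rw [abs_mul, pow_add, mul_mul_mul_comm]
  exact mul_le_mul (hC s hs) (hD s hs) (abs_nonneg _) ((abs_nonneg _).trans (hC s hs))

theorem Rapid.add {f g : ℝ → ℝ} (hf : Rapid f) (hg : Rapid g) : Rapid fun s => f s + g s := fun k => by
  obtain ⟨C, hC⟩ := hf k
  obtain ⟨D, hD⟩ := hg k
  refine ⟨C + D, fun s hs => ?_⟩
  have := mul_le_mul_of_nonneg_left (abs_add_le (f s) (g s)) (by positivity : 0 ≤ (1 + s) ^ k)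
  linarith [hC s hs, hD s hs]

theorem Rapid.mul {f g : ℝ → ℝ} (hf : PolyBdd f) (hg : Rapid g) : Rapid fun s => f s * g s := fun k => by
  obtain ⟨C, l, hC⟩ := hf
  obtain ⟨D, hD⟩ := hg (k + l)
  refine ⟨|C| * D, fun s hs => ?_⟩
  rw [abs_mul]
  calc (1 + s) ^ k * (|f s| * |g s|) ≤ (1 + s) ^ k * (|C| * (1 + s) ^ l * |g s|) := by
        gcongr; exact (hC s hs).trans (by gcongr; exact le_abs_self C)
    _ = |C| * ((1 + s) ^ (k + l) * |g s|) := by ring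
    _ ≤ |C| * D := mul_le_mul_of_nonneg_left (hD s hs) (abs_nonneg _)

theorem Rapid.bound {f : ℝ → ℝ} (hf : Rapid f) : ∃ C, ∀ s, 0 ≤ s → |f s| ≤ C := by
  obtain ⟨C, hC⟩ := hf 0
  exact ⟨C, fun s hs => by simpa using hC s hs⟩

theorem polyBdd_of_decay {f : ℝ → ℝ} {k : ℕ} {C : ℝ} (h : ∀ s, 0 ≤ s → (1 + s) ^ k * |f s| ≤ C) :
    PolyBdd f := ⟨C, 0, fun s hs => by
  rw [pow_zero, mul_one]
  refine le_trans ?_ (h s hs)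
  exact le_mul_of_one_le_left (abs_nonneg _) (one_le_pow₀ (by linarith))⟩

theorem continuous_comp_normSq {h : ℝ → ℝ} (hh : ContinuousOn h (Set.Ici 0)) :
    Continuous fun x : Plane => h (‖x‖ ^ 2) :=
  hh.comp_continuous (by fun_prop) fun x => sq_nonneg ‖x‖

/-- The profile is positive on the weight: `q` is differentiable with continuous negative
derivative. -/
structure WeightOK (q : ℝ → ℝ) : Prop where
  cont : ContinuousOn (dq q) (Set.Ici 0)
  neg : ∀ r, 0 ≤ r → dq q r < 0

theorem WeightOK.pos {q : ℝ → ℝ} (h : WeightOK q) (x : Plane) : 0 < weight q x :=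
  div_pos_of_neg_of_neg (by norm_num) (h.neg _ (sq_nonneg _))

theorem WeightOK.continuous {q : ℝ → ℝ} (h : WeightOK q) : Continuous (weight q) :=
  continuous_const.div (continuous_comp_normSq h.cont) fun _ => (h.neg _ (sq_nonneg _)).ne

theorem continuous_weightedSq {q h : ℝ → ℝ} (hq : WeightOK q) (hh : ContinuousOn h (Set.Ici 0))
    (k : ℕ) : Continuous fun x : Plane => (1 + ‖x‖ ^ 2) ^ k * (h (‖x‖ ^ 2) ^ 2 * weight q x) :=
  ((continuous_const.add (continuous_norm.pow 2)).pow k).mul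
    (((continuous_comp_normSq hh).pow 2).mul hq.continuous)

theorem WeightedSq.of_le {q f g : ℝ → ℝ} {C : ℝ} {l : ℕ} (hq : WeightOK q) (hg : WeightedSq q g)
    (hf : ContinuousOn f (Set.Ici 0)) (hle : ∀ s, 0 ≤ s → f s ^ 2 ≤ C * (1 + s) ^ l * g s ^ 2) :
    WeightedSq q f := fun k => by
  refine ((hg (k + l)).const_mul C).mono' ?_ (Filter.Eventually.of_forall fun x => ?_)
  · exact (continuous_weightedSq hq hf k).aestronglyMeasurable
  · have hw := hq.pos x
    have h1 := hle _ (sq_nonneg ‖x‖)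
    rw [Real.norm_of_nonneg (by positivity)]
    calc (1 + ‖x‖ ^ 2) ^ k * (f (‖x‖ ^ 2) ^ 2 * weight q x)
        ≤ (1 + ‖x‖ ^ 2) ^ k * ((C * (1 + ‖x‖ ^ 2) ^ l * g (‖x‖ ^ 2) ^ 2) * weight q x) := by gcongr
      _ = _ := by ring

theorem WeightedSq.mul {q f g : ℝ → ℝ} (hq : WeightOK q) (hf : PolyBdd f)
    (hfc : ContinuousOn f (Set.Ici 0)) (hg : WeightedSq q g) (hgc : ContinuousOn g (Set.Ici 0)) :
    WeightedSq q fun s => f s * g s := by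
  obtain ⟨C, l, hC⟩ := hf
  refine WeightedSq.of_le (C := C ^ 2) (l := l * 2) hq hg (hfc.mul hgc) fun s hs => ?_
  rw [mul_pow]
  refine mul_le_mul_of_nonneg_right ?_ (sq_nonneg _)
  rw [← sq_abs, pow_mul, ← mul_pow]
  exact pow_le_pow_left₀ (abs_nonneg _) (hC s hs) 2

theorem WeightedSq.add {q f g : ℝ → ℝ} (hq : WeightOK q) (hf : WeightedSq q f) (hg : WeightedSq q g)
    (hfc : ContinuousOn f (Set.Ici 0)) (hgc : ContinuousOn g (Set.Ici 0)) :
    WeightedSq q fun s => f s + g s := fun k => by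
  refine (((hf k).const_mul 2).add ((hg k).const_mul 2)).mono' ?_
    (Filter.Eventually.of_forall fun x => ?_)
  · exact (continuous_weightedSq hq (hfc.add hgc) k).aestronglyMeasurable
  · have hw := hq.pos x
    rw [Real.norm_of_nonneg (by positivity)]
    have h1 : (f (‖x‖ ^ 2) + g (‖x‖ ^ 2)) ^ 2 ≤ 2 * f (‖x‖ ^ 2) ^ 2 + 2 * g (‖x‖ ^ 2) ^ 2 := by
      nlinarith [sq_nonneg (f (‖x‖ ^ 2) - g (‖x‖ ^ 2))]
    calc (1 + ‖x‖ ^ 2) ^ k * ((f (‖x‖ ^ 2) + g (‖x‖ ^ 2)) ^ 2 * weight q x)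
        ≤ (1 + ‖x‖ ^ 2) ^ k * ((2 * f (‖x‖ ^ 2) ^ 2 + 2 * g (‖x‖ ^ 2) ^ 2) * weight q x) := by gcongr
      _ = _ := by simp only [Pi.add_apply]; ring

/-- Smooth coefficients of polynomial growth, with their first derivative. -/
structure Sym (h : ℝ → ℝ) : Prop where
  smooth : SmoothHalf h
  bdd : PolyBdd h
  bdd' : PolyBdd (dq h)

/-- Smooth coefficients which, together with their first derivative, decrease rapidly, also in the
weighted sense. -/
structure Adm (q h : ℝ → ℝ) : Prop where
  smooth : SmoothHalf h
  rapid : Rapid h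
  rapid' : Rapid (dq h)
  wsq : WeightedSq q h
  wsq' : WeightedSq q (dq h)

theorem smoothHalf_const (c : ℝ) : SmoothHalf fun _ => c := contDiffOn_const

theorem SmoothHalf.add {f g : ℝ → ℝ} (hf : SmoothHalf f) (hg : SmoothHalf g) :
    SmoothHalf fun s => f s + g s := ContDiffOn.add hf hg

theorem SmoothHalf.mul {f g : ℝ → ℝ} (hf : SmoothHalf f) (hg : SmoothHalf g) :
    SmoothHalf fun s => f s * g s := ContDiffOn.mul hf hg

theorem dq_const (c : ℝ) {s : ℝ} (hs : 0 ≤ s) : dq (fun _ => c) s = 0 :=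
  dq_eq (hasDerivWithinAt_const s _ c) hs

theorem dq_add {f g : ℝ → ℝ} (hf : SmoothHalf f) (hg : SmoothHalf g) {s : ℝ} (hs : 0 ≤ s) :
    dq (fun s => f s + g s) s = dq f s + dq g s := dq_eq ((hf.hasDeriv hs).add (hg.hasDeriv hs)) hs

theorem dq_mul {f g : ℝ → ℝ} (hf : SmoothHalf f) (hg : SmoothHalf g) {s : ℝ} (hs : 0 ≤ s) :
    dq (fun s => f s * g s) s = dq f s * g s + f s * dq g s :=
  dq_eq ((hf.hasDeriv hs).mul (hg.hasDeriv hs)) hs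

theorem Sym.const (c : ℝ) : Sym fun _ => c :=
  ⟨smoothHalf_const c, .const c, (PolyBdd.const 0).congr fun _ hs => dq_const c hs⟩

theorem Sym.add {f g : ℝ → ℝ} (hf : Sym f) (hg : Sym g) : Sym fun s => f s + g s :=
  ⟨hf.smooth.add hg.smooth, hf.bdd.add hg.bdd,
    (hf.bdd'.add hg.bdd').congr fun _ hs => dq_add hf.smooth hg.smooth hs⟩

theorem Sym.mul {f g : ℝ → ℝ} (hf : Sym f) (hg : Sym g) : Sym fun s => f s * g s :=
  ⟨hf.smooth.mul hg.smooth, hf.bdd.mul hg.bdd,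
    ((hf.bdd'.mul hg.bdd).add (hf.bdd.mul hg.bdd')).congr fun _ hs => dq_mul hf.smooth hg.smooth hs⟩

theorem Sym.congr {f g : ℝ → ℝ} (hg : Sym g) (h : ∀ s, 0 ≤ s → f s = g s) : Sym f :=
  ⟨hg.smooth.congr h, hg.bdd.congr h, hg.bdd'.congr fun _ hs => dq_congr h hs⟩

theorem Adm.congr {q f g : ℝ → ℝ} (hg : Adm q g) (h : ∀ s, 0 ≤ s → f s = g s) : Adm q f :=
  ⟨hg.smooth.congr h, hg.rapid.congr h, hg.rapid'.congr fun _ hs => dq_congr h hs,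
    hg.wsq.congr h, hg.wsq'.congr fun _ hs => dq_congr h hs⟩

theorem Adm.add {q f g : ℝ → ℝ} (hq : WeightOK q) (hf : Adm q f) (hg : Adm q g) :
    Adm q fun s => f s + g s :=
  ⟨hf.smooth.add hg.smooth, hf.rapid.add hg.rapid,
    (hf.rapid'.add hg.rapid').congr fun _ hs => dq_add hf.smooth hg.smooth hs,
    hf.wsq.add hq hg.wsq hf.smooth.continuousOn hg.smooth.continuousOn,
    (hf.wsq'.add hq hg.wsq' hf.smooth.dq.continuousOn hg.smooth.dq.continuousOn).congr
      fun _ hs => dq_add hf.smooth hg.smooth hs⟩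

/-- The product rule needs only polynomial growth of the first factor and its derivative. Every
profile coefficient is assembled from derivatives of q with such multipliers. -/
theorem Adm.mul {q f g : ℝ → ℝ} (hq : WeightOK q) (hf : Sym f) (hg : Adm q g) :
    Adm q fun s => f s * g s := by
  have c1 := hf.smooth.continuousOn
  have c1' := hf.smooth.dq.continuousOn
  have c2 := hg.smooth.continuousOn
  have c2' := hg.smooth.dq.continuousOn
  exact ⟨hf.smooth.mul hg.smooth, .mul hf.bdd hg.rapid,
    ((Rapid.mul hf.bdd' hg.rapid).add (Rapid.mul hf.bdd hg.rapid')).congr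
      fun _ hs => dq_mul hf.smooth hg.smooth hs,
    .mul hq hf.bdd c1 hg.wsq c2,
    ((WeightedSq.mul hq hf.bdd' c1' hg.wsq c2).add hq (WeightedSq.mul hq hf.bdd c1 hg.wsq' c2')
      (c1'.mul c2) (c1.mul c2')).congr fun _ hs => dq_mul hf.smooth hg.smooth hs⟩

theorem Adm.const_mul {q g : ℝ → ℝ} (hq : WeightOK q) (c : ℝ) (hg : Adm q g) :
    Adm q fun s => c * g s := Adm.mul hq (Sym.const c) hg

/-- Weighted square integrability from pointwise bounds. -/
theorem weightedSq_of_bound {q h : ℝ → ℝ} (hq : WeightOK q) (hh : ContinuousOn h (Set.Ici 0))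
    (hb : ∀ k : ℕ, ∃ C : ℝ, ∀ r : ℝ, 0 < r → r ^ k * h r ^ 2 / |dq q r| ≤ C) : WeightedSq q h := by
  intro k
  obtain ⟨C, hC⟩ := hb 0
  obtain ⟨D, hD⟩ := hb (k + 2)
  -- Two extra powers of 1 + |x|² buy integrability in the plane, which is why the bounds with
  -- exponents 0 and k + 2 are used.
  have hint : Integrable (fun x : Plane => (1 + ‖x‖ ^ 2) ^ (-(4 : ℝ) / 2)) :=
    integrable_rpow_neg_one_add_norm_sq (by simp; norm_num)
  refine (hint.const_mul (2 ^ (k + 1) * (C + D))).mono' ?_ ?_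
  · exact (continuous_weightedSq hq hh k).aestronglyMeasurable
  · have h0 : ∀ᵐ x : Plane, x ≠ 0 := Measure.ae_ne volume 0
    filter_upwards [h0] with x hx
    have hw := hq.pos x
    set s := ‖x‖ ^ 2 with hs
    have hs0 : 0 < s := by have := norm_pos_iff.2 hx; positivity
    have e : weight q x = 1 / |dq q s| := by
      rw [weight, ← hs, abs_of_neg (hq.neg s hs0.le), div_neg, neg_div]
    rw [Real.norm_of_nonneg (by positivity)]
    have e2 : (1 + s) ^ (-(4 : ℝ) / 2) = 1 / (1 + s) ^ 2 := by
      rw [show (-(4 : ℝ) / 2) = -((2 : ℕ) : ℝ) by norm_num, Real.rpow_neg (by positivity),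
        Real.rpow_natCast, one_div]
    rw [e2, mul_one_div, le_div_iff₀ (by positivity), e]
    have h1 := hC s hs0
    have h2 := hD s hs0
    have h3 : (1 + s) ^ (k + 2) ≤ 2 ^ (k + 1) * (1 ^ (k + 2) + s ^ (k + 2)) :=
      add_pow_le (by norm_num) hs0.le (k + 2)
    have h4 : 0 ≤ h s ^ 2 / |dq q s| := by positivity
    calc (1 + s) ^ k * (h s ^ 2 * (1 / |dq q s|)) * (1 + s) ^ 2
        = (1 + s) ^ (k + 2) * (h s ^ 2 / |dq q s|) := by ring
      _ ≤ (2 ^ (k + 1) * (1 ^ (k + 2) + s ^ (k + 2))) * (h s ^ 2 / |dq q s|) := by gcongr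
      _ = 2 ^ (k + 1) * (s ^ 0 * h s ^ 2 / |dq q s| + s ^ (k + 2) * h s ^ 2 / |dq q s|) := by ring
      _ ≤ _ := by gcongr

/-- Integrability on the plane of a function of `|x|²`. -/
theorem integrable_comp_normSq {F : ℝ → ℝ} (hF : IntegrableOn F (Set.Ioi 0)) :
    Integrable fun x : Plane => F (‖x‖ ^ 2) := by
  have h1 := (integrableOn_Ioi_comp_rpow_iff F (p := 2) two_ne_zero).2 hF
  refine (integrable_fun_norm_addHaar (volume : Measure Plane) (f := fun y => F (y ^ 2))).2 ?_
  refine IntegrableOn.congr_fun (h1.const_mul (1 / 2)) (fun y _ => ?_) measurableSet_Ioi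
  have e : (2 : ℝ) - 1 = 1 := by norm_num
  simp only [finrank_euclideanSpace, Fintype.card_fin, smul_eq_mul, e, Real.rpow_one, Real.rpow_two]
  simp
  ring

end VortexPair

namespace VortexPair

/-! ### Consequences of the assumptions on the profile -/

namespace AdmissibleProfile

variable {q : ℝ → ℝ}

theorem smoothHalf (hq : AdmissibleProfile q) : SmoothHalf q := hq.smooth

theorem weightOK (hq : AdmissibleProfile q) : WeightOK q :=
  ⟨hq.smoothHalf.dq.continuousOn, hq.decreasing⟩

theorem smooth_iter (hq : AdmissibleProfile q) (n : ℕ) :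
    SmoothHalf (iteratedDerivWithin n q (Set.Ici 0)) := by
  induction n with
  | zero => rw [iteratedDerivWithin_zero]; exact hq.smoothHalf
  | succ n ih => rw [iteratedDerivWithin_succ]; exact ih.dq

theorem iter_zero : iteratedDerivWithin 0 q (Set.Ici 0) = q := iteratedDerivWithin_zero
theorem iter_one : iteratedDerivWithin 1 q (Set.Ici 0) = dq q := by
  rw [iteratedDerivWithin_succ, iter_zero]; rfl
theorem iter_two : iteratedDerivWithin 2 q (Set.Ici 0) = dq (dq q) := by
  rw [iteratedDerivWithin_succ, iter_one]; rfl
theorem iter_three : iteratedDerivWithin 3 q (Set.Ici 0) = dq (dq (dq q)) := by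
  rw [iteratedDerivWithin_succ, iter_two]; rfl

theorem rapid_iter (hq : AdmissibleProfile q) (n : ℕ) :
    Rapid (iteratedDerivWithin n q (Set.Ici 0)) := by
  intro k
  obtain ⟨C, hC⟩ := hq.rapid 0 n
  obtain ⟨D, hD⟩ := hq.rapid k n
  refine ⟨2 ^ (k - 1) * (C + D), fun s hs => ?_⟩
  have h1 := hC s hs
  have h2 := hD s hs
  have h3 : (1 + s) ^ k ≤ 2 ^ (k - 1) * (1 ^ k + s ^ k) := add_pow_le (by norm_num) hs k
  set a := |iteratedDerivWithin n q (Set.Ici 0) s|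
  have ha : 0 ≤ a := abs_nonneg _
  calc (1 + s) ^ k * a ≤ 2 ^ (k - 1) * (1 ^ k + s ^ k) * a := mul_le_mul_of_nonneg_right h3 ha
    _ = 2 ^ (k - 1) * (s ^ 0 * a + s ^ k * a) := by ring
    _ ≤ _ := by gcongr

theorem rapid_q (hq : AdmissibleProfile q) : Rapid q := by
  have := hq.rapid_iter 0; rwa [iter_zero] at this
theorem rapid_dq (hq : AdmissibleProfile q) : Rapid (dq q) := by
  have := hq.rapid_iter 1; rwa [iter_one] at this
theorem rapid_ddq (hq : AdmissibleProfile q) : Rapid (dq (dq q)) := by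
  have := hq.rapid_iter 2; rwa [iter_two] at this
theorem rapid_dddq (hq : AdmissibleProfile q) : Rapid (dq (dq (dq q))) := by
  have := hq.rapid_iter 3; rwa [iter_three] at this

theorem strictAntiOn (hq : AdmissibleProfile q) : StrictAntiOn q (Set.Ici 0) := by
  refine strictAntiOn_of_deriv_neg (convex_Ici 0) hq.smoothHalf.continuousOn fun x hx => ?_
  rw [interior_Ici] at hx
  rw [(hasDerivAt_of_within (hq.smoothHalf.hasDeriv (le_of_lt hx)) hx).deriv]
  exact hq.decreasing x (le_of_lt hx)

/-- A strictly decreasing function that tends to 0 is positive: otherwise q(s + 1) < 0 and q stays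
below this value from there on, against rapid decay. -/
theorem q_pos (hq : AdmissibleProfile q) {s : ℝ} (hs : 0 ≤ s) : 0 < q s := by
  have hlt : q (s + 1) < q s := hq.strictAntiOn hs (show (0 : ℝ) ≤ s + 1 by linarith) (by linarith)
  by_contra hneg
  have h1 : q (s + 1) < 0 := by linarith
  obtain ⟨C, hC⟩ := hq.rapid_q 1
  have h2 : ∀ t, s + 1 ≤ t → q t ≤ q (s + 1) := fun t ht =>
    hq.strictAntiOn.antitoneOn (show (0 : ℝ) ≤ s + 1 by linarith) (show (0 : ℝ) ≤ t by linarith) ht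
  have h3 := hC (max (s + 1) (C / -q (s + 1))) (by have := le_max_left (s + 1) (C / -q (s + 1)); linarith)
  have h4 := h2 _ (le_max_left (s + 1) (C / -q (s + 1)))
  set T := max (s + 1) (C / -q (s + 1))
  have h5 : C / -q (s + 1) ≤ T := le_max_right _ _
  have h6 : s + 1 ≤ T := le_max_left _ _
  have h7 : -q (s + 1) ≤ |q T| := by have := neg_le_abs (q T); linarith
  rw [div_le_iff₀ (by linarith)] at h5
  have h8 : (1 + T) * -q (s + 1) ≤ (1 + T) ^ 1 * |q T| := by
    rw [pow_one]; exact mul_le_mul_of_nonneg_left h7 (by linarith)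
  nlinarith

end AdmissibleProfile

/-! ### Angular velocity of the profile and the potential of the radial equation. -/

/-- `m(s) = Q(s) / s`, extended by `q(0)` at `s = 0`; the angular velocity of `v_*` is
`m(|x|²) / 2π`. -/
def angMean (q : ℝ → ℝ) : ℝ → ℝ := mean 0 q

/-- `ν = 1 / m`. -/
def invMean (q : ℝ → ℝ) (s : ℝ) : ℝ := (angMean q s)⁻¹

/-- The potential `V = -4 q' / m`. -/
def potential (q : ℝ → ℝ) (s : ℝ) : ℝ := invMean q s * (-4 * dq q s)

theorem mul_angMean {q : ℝ → ℝ} {s : ℝ} (hs : 0 < s) : s * angMean q s = primitiveQ q s := by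
  have := mul_pow_mean (n := 0) (h := q) hs
  simpa [primitiveQ, angMean] using this

namespace AdmissibleProfile

variable {q : ℝ → ℝ}

theorem intervalIntegrable (hq : AdmissibleProfile q) {a b : ℝ} (ha : 0 ≤ a) (hab : a ≤ b) :
    IntervalIntegrable q volume a b :=
  (hq.smoothHalf.continuousOn.mono (by
    rw [Set.uIcc_of_le hab]; exact fun u hu => ha.trans hu.1)).intervalIntegrable

/-- On [0, 1] the mean of q dominates q(1); beyond, s m(s) = Q(s) ≥ Q(1) since q > 0. Hence 1/m
grows at most linearly and may serve as a multiplier. -/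
theorem angMean_lower (hq : AdmissibleProfile q) {s : ℝ} (hs : 0 ≤ s) :
    q 1 ≤ (1 + s) * angMean q s := by
  have anti := hq.strictAntiOn.antitoneOn
  have base : ∀ t : ℝ, 0 ≤ t → t ≤ 1 → q 1 ≤ angMean q t := by
    intro t ht ht1
    have h1 : ∫ τ in (0 : ℝ)..1, q 1 ≤ ∫ τ in (0 : ℝ)..1, τ ^ 0 * q (t * τ) := by
      refine intervalIntegral.integral_mono_on zero_le_one (by simp)
        (mean_integrand_intervalIntegrable hq.smoothHalf.continuousOn ht) fun τ hτ => ?_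
      rw [pow_zero, one_mul]
      exact anti (mul_nonneg ht hτ.1) (show (0 : ℝ) ≤ 1 by norm_num)
        (mul_le_one₀ ht1 hτ.1 hτ.2)
    simpa [angMean, mean] using h1
  rcases le_total s 1 with h | h
  · have h1 := base s hs h
    have h2 := hq.q_pos (zero_le_one)
    nlinarith
  · have h0 : 0 < s := by linarith
    have h1 := base 1 zero_le_one le_rfl
    have e1 := mul_angMean (q := q) one_pos
    rw [one_mul] at e1
    have e := mul_angMean (q := q) h0
    have h2 : primitiveQ q 1 ≤ primitiveQ q s := by
      rw [primitiveQ, primitiveQ, ← intervalIntegral.integral_add_adjacent_intervals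
        (hq.intervalIntegrable le_rfl zero_le_one) (hq.intervalIntegrable zero_le_one h)]
      have : 0 ≤ ∫ u in (1 : ℝ)..s, q u := intervalIntegral.integral_nonneg h
        fun u hu => (hq.q_pos (by linarith [hu.1])).le
      linarith
    have h3 : 0 ≤ angMean q s := by
      have := hq.q_pos zero_le_one
      have : 0 ≤ s * angMean q s := by linarith
      exact nonneg_of_mul_nonneg_right this h0
    linarith

theorem angMean_pos (hq : AdmissibleProfile q) {s : ℝ} (hs : 0 ≤ s) : 0 < angMean q s := by
  have h1 := hq.angMean_lower hs
  have h2 := hq.q_pos zero_le_one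
  have h3 : 0 < (1 + s) * angMean q s := by linarith
  exact pos_of_mul_pos_right h3 (by linarith)

theorem smooth_angMean (hq : AdmissibleProfile q) : SmoothHalf (angMean q) := hq.smoothHalf.mean 0

theorem dq_angMean (hq : AdmissibleProfile q) {s : ℝ} (hs : 0 ≤ s) :
    dq (angMean q) s = mean 1 (dq q) s := hq.smoothHalf.dq_mean 0 hs

theorem ddq_angMean (hq : AdmissibleProfile q) {s : ℝ} (hs : 0 ≤ s) :
    dq (dq (angMean q)) s = mean 2 (dq (dq q)) s := by
  rw [dq_congr (fun s hs => hq.dq_angMean hs) hs, hq.smoothHalf.dq.dq_mean 1 hs]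

theorem angMean_decay (hq : AdmissibleProfile q) :
    ∃ C, ∀ s, 0 ≤ s → (1 + s) * |angMean q s| ≤ C := by
  obtain ⟨C, hC⟩ := hq.rapid_q 2
  exact ⟨C, fun s hs => by simpa [angMean] using abs_mean_le_pow (n := 0) hC hs⟩

theorem dq_angMean_decay (hq : AdmissibleProfile q) :
    ∃ C, ∀ s, 0 ≤ s → (1 + s) ^ 2 * |dq (angMean q) s| ≤ C := by
  obtain ⟨C, hC⟩ := hq.rapid_dq 3
  exact ⟨C, fun s hs => by rw [hq.dq_angMean hs]; exact abs_mean_le_pow (n := 1) hC hs⟩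

theorem sym_angMean (hq : AdmissibleProfile q) : Sym (angMean q) := by
  obtain ⟨C, hC⟩ := hq.angMean_decay
  obtain ⟨D, hD⟩ := hq.dq_angMean_decay
  exact ⟨hq.smooth_angMean, polyBdd_of_decay (k := 1) (fun s hs => by simpa using hC s hs),
    polyBdd_of_decay hD⟩

theorem sym_dq_angMean (hq : AdmissibleProfile q) : Sym (dq (angMean q)) := by
  obtain ⟨C, hC⟩ := hq.rapid_ddq.bound
  exact ⟨hq.smooth_angMean.dq, hq.sym_angMean.bdd', C, 0, fun s hs => by
    rw [hq.ddq_angMean hs, pow_zero, mul_one]; exact abs_mean_le_const hC hs⟩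

theorem invMean_pos (hq : AdmissibleProfile q) {s : ℝ} (hs : 0 ≤ s) : 0 < invMean q s :=
  inv_pos.2 (hq.angMean_pos hs)

theorem invMean_mul (hq : AdmissibleProfile q) {s : ℝ} (hs : 0 ≤ s) :
    invMean q s * angMean q s = 1 := inv_mul_cancel₀ (hq.angMean_pos hs).ne'

theorem smooth_invMean (hq : AdmissibleProfile q) : SmoothHalf (invMean q) :=
  ContDiffOn.inv hq.smooth_angMean fun _ hs => (hq.angMean_pos hs).ne'

theorem dq_invMean (hq : AdmissibleProfile q) {s : ℝ} (hs : 0 ≤ s) :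
    dq (invMean q) s = -1 * (invMean q s * invMean q s * dq (angMean q) s) := by
  refine (dq_eq ((hq.smooth_angMean.hasDeriv hs).inv (hq.angMean_pos hs).ne') hs).trans ?_
  rw [invMean]; field_simp

theorem bdd_invMean (hq : AdmissibleProfile q) : PolyBdd (invMean q) := by
  refine ⟨(q 1)⁻¹, 1, fun s hs => ?_⟩
  have h1 := hq.angMean_lower hs
  have h2 := hq.q_pos zero_le_one
  have h3 := hq.angMean_pos hs
  rw [abs_of_pos (hq.invMean_pos hs), invMean, pow_one, inv_mul_eq_div, le_div_iff₀ h2,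
    inv_mul_le_iff₀ h3]
  linarith

theorem sym_invMean (hq : AdmissibleProfile q) : Sym (invMean q) :=
  ⟨hq.smooth_invMean, hq.bdd_invMean,
    ((PolyBdd.const (-1)).mul ((hq.bdd_invMean.mul hq.bdd_invMean).mul hq.sym_angMean.bdd')).congr
      fun _ hs => hq.dq_invMean hs⟩

theorem sym_dq_invMean (hq : AdmissibleProfile q) : Sym (dq (invMean q)) :=
  ((Sym.const (-1)).mul ((hq.sym_invMean.mul hq.sym_invMean).mul hq.sym_dq_angMean)).congr
    fun _ hs => hq.dq_invMean hs

theorem wsq_q (hq : AdmissibleProfile q) : WeightedSq q q :=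
  weightedSq_of_bound hq.weightOK hq.smoothHalf.continuousOn hq.decay

/-- Here q'²/|q'| = |q'|, so the rapid decay of q' is enough. -/
theorem wsq_dq (hq : AdmissibleProfile q) : WeightedSq q (dq q) := by
  refine weightedSq_of_bound hq.weightOK hq.smoothHalf.dq.continuousOn fun k => ?_
  obtain ⟨C, hC⟩ := hq.rapid k 1
  refine ⟨C, fun r hr => ?_⟩
  have h1 := hC r hr.le
  rw [iter_one] at h1
  have h2 : 0 < |dq q r| := abs_pos.2 (hq.decreasing r hr.le).ne
  rw [div_le_iff₀ h2, ← sq_abs (dq q r)]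
  calc r ^ k * |dq q r| ^ 2 = r ^ k * |dq q r| * |dq q r| := by ring
    _ ≤ C * |dq q r| := mul_le_mul_of_nonneg_right h1 h2.le

theorem wsq_ddq (hq : AdmissibleProfile q) : WeightedSq q (dq (dq q)) :=
  weightedSq_of_bound hq.weightOK hq.smoothHalf.dq.dq.continuousOn hq.decay_second

/-- No assumption controls q''' against the weight. On (0, 1] continuity suffices, and on (1, ∞) the
interpolation estimate applies, using q² ≤ C|q'|. -/
theorem wsq_dddq (hq : AdmissibleProfile q) : WeightedSq q (dq (dq (dq q))) := by
  intro k
  have hcont : ContinuousOn (fun s => (1 + s) ^ k * (dq (dq (dq q)) s ^ 2 * (-1 / dq q s)))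
      (Set.Ici 0) :=
    ((continuousOn_const.add continuousOn_id).pow k).mul
      ((hq.smoothHalf.dq.dq.dq.continuousOn.pow 2).mul
        (continuousOn_const.div hq.smoothHalf.dq.continuousOn fun s hs => (hq.decreasing s hs).ne))
  have key : IntegrableOn (fun s => (1 + s) ^ k * (dq (dq (dq q)) s ^ 2 * (-1 / dq q s)))
      (Set.Ioi 0) := by
    rw [← Set.Ioc_union_Ioi_eq_Ioi (zero_le_one (α := ℝ))]
    refine IntegrableOn.union ?_ ?_
    · exact ((hcont.mono Set.Icc_subset_Ici_self).integrableOn_compact isCompact_Icc).mono_set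
        Set.Ioc_subset_Icc_self
    · have h3 := integrableOn_third_deriv_sq_div (h := fun i => iteratedDerivWithin i q (Set.Ici 0))
        (fun i x hx => by
          simp only [iteratedDerivWithin_succ]
          exact hasDerivAt_of_within ((hq.smooth_iter i).hasDeriv hx.le) hx)
        (fun i k => by
          obtain ⟨C, hC⟩ := hq.rapid k i
          exact ⟨C, fun x hx => hC x hx.le⟩)
        (fun x hx => by simp only [iter_zero]; exact hq.q_pos hx.le)
        (fun x hx => by simp only [iter_one]; exact hq.decreasing x hx.le)
        (by
          obtain ⟨C, hC⟩ := hq.decay 0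
          refine ⟨C, fun x hx => ?_⟩
          have h1 := hC x hx
          have h2 := hq.decreasing x hx.le
          simp only [iter_zero, iter_one]
          rwa [pow_zero, one_mul, abs_of_neg h2, div_le_iff₀ (by linarith)] at h1) k
      simp only [iter_one, iter_three] at h3
      refine (h3.const_mul (2 ^ k)).mono'
        ((hcont.mono ((Set.Ioi_subset_Ioi zero_le_one).trans
          Set.Ioi_subset_Ici_self)).aestronglyMeasurable measurableSet_Ioi) ?_
      filter_upwards [ae_restrict_mem measurableSet_Ioi] with s hs
      have hs1 : (1 : ℝ) < s := hs
      have hd := hq.decreasing s (by linarith)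
      have e : dq (dq (dq q)) s ^ 2 * (-1 / dq q s) = dq (dq (dq q)) s ^ 2 / (-dq q s) := by
        rw [div_neg, mul_div_assoc', mul_neg_one, neg_div]
      have hn : 0 ≤ dq (dq (dq q)) s ^ 2 / (-dq q s) := div_nonneg (sq_nonneg _) (by linarith)
      rw [e, Real.norm_of_nonneg (by positivity), ← mul_assoc, ← mul_pow]
      gcongr
      linarith
  exact integrable_comp_normSq key

theorem adm_dq (hq : AdmissibleProfile q) : Adm q (dq q) :=
  ⟨hq.smoothHalf.dq, hq.rapid_dq, hq.rapid_ddq, hq.wsq_dq, hq.wsq_ddq⟩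

theorem adm_ddq (hq : AdmissibleProfile q) : Adm q (dq (dq q)) :=
  ⟨hq.smoothHalf.dq.dq, hq.rapid_ddq, hq.rapid_dddq, hq.wsq_ddq, hq.wsq_dddq⟩

theorem adm_q (hq : AdmissibleProfile q) : Adm q q :=
  ⟨hq.smoothHalf, hq.rapid_q, hq.rapid_dq, hq.wsq_q, hq.wsq_dq⟩

theorem adm_potential (hq : AdmissibleProfile q) : Adm q (potential q) :=
  Adm.mul hq.weightOK hq.sym_invMean (hq.adm_dq.const_mul hq.weightOK (-4))

theorem dq_potential (hq : AdmissibleProfile q) {s : ℝ} (hs : 0 ≤ s) :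
    dq (potential q) s = dq (invMean q) s * (-4 * dq q s) + invMean q s * (-4 * dq (dq q) s) := by
  have h1 : SmoothHalf fun s => -4 * dq q s := (smoothHalf_const (-4)).mul hq.smoothHalf.dq
  have h2 := dq_mul hq.smooth_invMean h1 hs
  rw [dq_mul (smoothHalf_const (-4)) hq.smoothHalf.dq hs, dq_const _ hs] at h2
  refine h2.trans (by ring)

/-- The fourth-order forcing contains the derivative of the second-order coefficient, hence V'. The
gradient of a mode with such a coefficient involves V'', and with it q'''. -/
theorem adm_dq_potential (hq : AdmissibleProfile q) : Adm q (dq (potential q)) :=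
  ((Adm.mul hq.weightOK hq.sym_dq_invMean (hq.adm_dq.const_mul hq.weightOK (-4))).add hq.weightOK
    (Adm.mul hq.weightOK hq.sym_invMean (hq.adm_ddq.const_mul hq.weightOK (-4)))).congr
    fun _ hs => hq.dq_potential hs

theorem potential_pos (hq : AdmissibleProfile q) {s : ℝ} (hs : 0 ≤ s) : 0 < potential q s :=
  mul_pos (hq.invMean_pos hs) (by linarith [hq.decreasing s hs])

/-- The stability condition: the potential is strictly below the Hardy constant of the second
angular harmonic. -/
theorem exists_potential_bound (hq : AdmissibleProfile q) :
    ∃ c δ : ℝ, 0 ≤ c ∧ c < 1 ∧ 0 < δ ∧ ∀ s, 0 ≤ s → (s + δ) * potential q s ≤ 4 * c := by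
  obtain ⟨c, hc1, hc⟩ := hq.stable
  have hV : ∀ s, 0 ≤ s → s * potential q s ≤ 4 * c := by
    have pos : ∀ s, 0 < s → s * potential q s ≤ 4 * c := by
      intro s hs
      have h1 := hc s hs
      rw [← mul_angMean hs] at h1
      have e : s * potential q s = 4 * (-(s ^ 2 * dq q s) / (s * angMean q s)) := by
        have := (hq.angMean_pos hs.le).ne'
        rw [potential, invMean]; field_simp
      rw [e]; linarith
    intro s hs
    rcases hs.eq_or_lt with rfl | hs
    · rw [zero_mul]
      have := pos 1 one_pos
      have := hq.potential_pos zero_le_one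
      linarith
    · exact pos s hs
  have hc0 : 0 ≤ c := by have := hV 0 le_rfl; linarith
  obtain ⟨B, hB⟩ := hq.adm_potential.rapid.bound
  have hB0 : 0 < B := (hq.potential_pos le_rfl).trans_le ((le_abs_self _).trans (hB 0 le_rfl))
  -- The shift δ must be positive to keep the weight regular at s = 0. Since V ≤ B, this δ adds at
  -- most 2(1 - c), half of the gap between 4c and 4.
  refine ⟨(1 + c) / 2, 2 * (1 - c) / B, by linarith, by linarith,
    div_pos (by linarith) hB0, fun s hs => ?_⟩
  have h1 := hV s hs
  have h2 : 2 * (1 - c) / B * potential q s ≤ 2 * (1 - c) / B * B :=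
    mul_le_mul_of_nonneg_left ((le_abs_self _).trans (hB s hs))
      (div_nonneg (by linarith) hB0.le)
  rw [div_mul_cancel₀ _ hB0.ne'] at h2
  rw [add_mul]
  linarith

end AdmissibleProfile
end VortexPair

namespace VortexPair

/-! ### Solving the radial equation -/

theorem mean_sub {n : ℕ} {b c : ℝ → ℝ} (hb : ContinuousOn b (Set.Ici 0))
    (hc : ContinuousOn c (Set.Ici 0)) {s : ℝ} (hs : 0 ≤ s) :
    mean n (fun u => b u - c u) s = mean n b s - mean n c s := by
  rw [mean, mean, mean, ← intervalIntegral.integral_sub (mean_integrand_intervalIntegrable hb hs)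
    (mean_integrand_intervalIntegrable hc hs)]
  simp only [mul_sub]

theorem green_sub {n : ℕ} {b c : ℝ → ℝ} (hb : ContinuousOn b (Set.Ici 0))
    (hc : ContinuousOn c (Set.Ici 0)) (hbi : IntegrableOn b (Set.Ioi 0))
    (hci : IntegrableOn c (Set.Ioi 0)) {s : ℝ} (hs : 0 ≤ s) :
    green n (fun u => b u - c u) s = green n b s - green n c s := by
  rw [green, green, green, mean_sub hb hc hs,
    integral_sub (hbi.mono_set (Set.Ioi_subset_Ioi hs)) (hci.mono_set (Set.Ioi_subset_Ioi hs))]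
  ring

theorem Rapid.integrableOn {b : ℝ → ℝ} (hb : ContinuousOn b (Set.Ici 0)) (hr : Rapid b) :
    IntegrableOn b (Set.Ioi 0) := by
  obtain ⟨C, hC⟩ := hr 2
  refine integrableOn_of_le_div_sq hb one_pos (H := C) fun s hs => ?_
  rw [le_div_iff₀ (by positivity), mul_comm, add_comm s 1]
  exact hC s hs

/-- The integral equation `α = G_n (V α + φ)` has a continuous solution. -/
theorem exists_fixed_point {q : ℝ → ℝ} (hq : AdmissibleProfile q) {n : ℕ} (hn : 2 ≤ n) {φ : ℝ → ℝ}
    (hφ : ContinuousOn φ (Set.Ici 0)) (hφr : Rapid φ) :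
    ∃ α : ℝ → ℝ, ContinuousOn α (Set.Ici 0) ∧ (∃ C, ∀ s, 0 ≤ s → |α s| ≤ C) ∧
      ∀ s, 0 ≤ s → α s = green n (fun u => potential q u * α u + φ u) s := by
  obtain ⟨c, δ, hc0, hc1, hδ, hV⟩ := hq.exists_potential_bound
  have hVc : ContinuousOn (potential q) (Set.Ici 0) := hq.adm_potential.smooth.continuousOn
  obtain ⟨F, hF⟩ : ∃ F, ∀ s, 0 ≤ s → |φ s| ≤ F / (s + δ) ^ 2 := by
    obtain ⟨C, hC⟩ := hφr 2
    refine ⟨C * (1 + δ) ^ 2, fun s hs => ?_⟩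
    rw [le_div_iff₀ (by positivity)]
    have h1 : s + δ ≤ (1 + s) * (1 + δ) := by nlinarith
    calc |φ s| * (s + δ) ^ 2 ≤ |φ s| * ((1 + s) * (1 + δ)) ^ 2 := by gcongr
      _ = (1 + s) ^ 2 * |φ s| * (1 + δ) ^ 2 := by ring
      _ ≤ _ := by gcongr; exact hC s hs
  -- The unknown is β = (s + δ)α, in the sup norm. Then |Vα| ≤ 4cM/(s + δ)², exactly the input decay
  -- of the Green estimate.
  let W : (ℝ → ℝ) → ℝ → ℝ := fun β u => potential q u * (β u / (u + δ))
  have hne : ∀ s : ℝ, s ∈ Set.Ici (0 : ℝ) → s + δ ≠ 0 := fun s hs => by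
    have : 0 ≤ s := hs
    positivity
  have Wc : ∀ β : ℝ → ℝ, Continuous β → ContinuousOn (W β) (Set.Ici 0) := fun β hβ =>
    hVc.mul (hβ.continuousOn.div (by fun_prop) hne)
  have Wle : ∀ (β : ℝ → ℝ) (M : ℝ), (∀ s, |β s| ≤ M) → ∀ s, 0 ≤ s →
      |W β s| ≤ 4 * c * M / (s + δ) ^ 2 := by
    intro β M hM s hs
    have hp : 0 < s + δ := by positivity
    have hM0 : 0 ≤ M := (abs_nonneg _).trans (hM 0)
    simp only [W]
    rw [abs_mul, abs_div, abs_of_pos hp, abs_of_pos (hq.potential_pos hs), ← mul_div_assoc,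
      div_le_div_iff₀ hp (by positivity)]
    calc potential q s * |β s| * (s + δ) ^ 2
        = ((s + δ) * potential q s) * |β s| * (s + δ) := by ring
      _ ≤ (4 * c) * M * (s + δ) := by
        exact mul_le_mul_of_nonneg_right
          (mul_le_mul (hV s hs) (hM s) (abs_nonneg _) (by positivity)) hp.le
  let b : (ℝ → ℝ) → ℝ → ℝ := fun β u => W β u + φ u
  have bc : ∀ β : ℝ → ℝ, Continuous β → ContinuousOn (b β) (Set.Ici 0) := fun β hβ =>
    (Wc β hβ).add hφ
  have ble : ∀ (β : ℝ → ℝ) (M : ℝ), (∀ s, |β s| ≤ M) → ∀ s, 0 ≤ s →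
      |b β s| ≤ (4 * c * M + F) / (s + δ) ^ 2 := fun β M hM s hs => by
    rw [add_div]
    exact (abs_add_le _ _).trans (add_le_add (Wle β M hM s hs) (hF s hs))
  have bi : ∀ (β : ℝ → ℝ) (M : ℝ), Continuous β → (∀ s, |β s| ≤ M) → IntegrableOn (b β) (Set.Ioi 0) :=
    fun β M hβ hM => integrableOn_of_le_div_sq (bc β hβ) hδ (ble β M hM)
  -- Evaluating at |s| extends everything to the whole line, so that the complete space of bounded
  -- continuous functions on ℝ can be used; only s ≥ 0 is read off at the end.
  let T : BoundedContinuousFunction ℝ ℝ → BoundedContinuousFunction ℝ ℝ := fun β =>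
    BoundedContinuousFunction.ofNormedAddCommGroup (fun s => (|s| + δ) * green n (b β) |s|)
      ((continuous_abs.add continuous_const).mul (continuous_comp_abs
        (continuousOn_green (bc β β.continuous) (bi β ‖β‖ β.continuous β.norm_coe_le_norm))))
      ((4 * c * ‖β‖ + F) / 4) (fun s => by
        have hp : 0 < |s| + δ := by positivity
        rw [norm_mul, Real.norm_eq_abs, Real.norm_eq_abs, abs_of_pos hp]
        exact abs_green_le hn hδ (ble β ‖β‖ β.norm_coe_le_norm) (abs_nonneg s))
  have hT : ContractingWith ⟨c, hc0⟩ T := by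
    refine ⟨by exact_mod_cast hc1, LipschitzWith.of_dist_le_mul fun β γ => ?_⟩
    refine (BoundedContinuousFunction.dist_le (mul_nonneg hc0 dist_nonneg)).2 fun s => ?_
    have hp : 0 < |s| + δ := by positivity
    have e : T β s - T γ s = (|s| + δ) * green n (fun u => b β u - b γ u) |s| := by
      rw [green_sub (bc β β.continuous) (bc γ γ.continuous)
        (bi β ‖β‖ β.continuous β.norm_coe_le_norm) (bi γ ‖γ‖ γ.continuous γ.norm_coe_le_norm)
        (abs_nonneg s), mul_sub]
      rfl
    have e2 : (fun u => b β u - b γ u) = W (fun u => β u - γ u) := by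
      funext u; simp only [b, W]; ring
    rw [Real.dist_eq, e, e2, abs_mul, abs_of_pos hp]
    have h1 := Wle (fun u => β u - γ u) (dist β γ) (fun s => by
      rw [← Real.dist_eq]; exact BoundedContinuousFunction.dist_coe_le_dist s)
    refine (abs_green_le hn hδ h1 (abs_nonneg s)).trans (le_of_eq ?_)
    change 4 * c * dist β γ / 4 = c * dist β γ
    ring
  let β := hT.fixedPoint T
  have hβ : T β = β := hT.fixedPoint_isFixedPt
  refine ⟨fun s => β s / (s + δ), β.continuous.continuousOn.div (by fun_prop) hne,
    ⟨‖β‖ / δ, fun s hs => ?_⟩, fun s hs => ?_⟩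
  · have hp : 0 < s + δ := by positivity
    rw [abs_div, abs_of_pos hp]
    exact div_le_div₀ (norm_nonneg _) (β.norm_coe_le_norm s) hδ (by linarith)
  · have hp : 0 < s + δ := by positivity
    have h1 : β s = (|s| + δ) * green n (b β) |s| := by
      conv_lhs => rw [← hβ]
      rfl
    rw [abs_of_nonneg hs] at h1
    simp only
    rw [h1, mul_div_cancel_left₀ _ hp.ne']

/-- Data of a solution of the radial equation: `b = V α + φ` and `α = G_n b`, with regularity and
decay. -/
structure RadialSolution (q : ℝ → ℝ) (n : ℕ) (φ α b : ℝ → ℝ) : Prop where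
  eq : ∀ s, 0 ≤ s → b s = potential q s * α s + φ s
  green_eq : ∀ s, 0 ≤ s → α s = green n b s
  smooth : SmoothHalf α
  adm : Adm q b
  decay₀ : ∃ C, ∀ s, 0 ≤ s → (1 + s) ^ n * |α s| ≤ C
  decay₁ : ∃ C, ∀ s, 0 ≤ s → (1 + s) ^ (n + 1) * |dq α s| ≤ C
  decay₂ : ∃ C, ∀ s, 0 ≤ s → (1 + s) ^ (n + 2) * |dq (dq α) s| ≤ C
  ode : ∀ s, 0 ≤ s → 4 * (s * dq (dq α) s + (n + 1) * dq α s) = -b s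

theorem RadialSolution.sym {q : ℝ → ℝ} {n : ℕ} {φ α b : ℝ → ℝ} (h : RadialSolution q n φ α b) :
    Sym α := by
  obtain ⟨C, hC⟩ := h.decay₀
  obtain ⟨D, hD⟩ := h.decay₁
  exact ⟨h.smooth, polyBdd_of_decay hC, polyBdd_of_decay hD⟩

theorem RadialSolution.sym_dq {q : ℝ → ℝ} {n : ℕ} {φ α b : ℝ → ℝ} (h : RadialSolution q n φ α b) :
    Sym (dq α) := by
  obtain ⟨C, hC⟩ := h.decay₁
  obtain ⟨D, hD⟩ := h.decay₂
  exact ⟨h.smooth.dq, polyBdd_of_decay hC, polyBdd_of_decay hD⟩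

/-- Bootstrap: α' = -(1/4) M_n(Vα + φ) gains one derivative at each round. Boundedness of α already
makes b decay rapidly, and the estimates for means and for G_n then yield the multipole decay of α,
α' and α''. -/
theorem exists_radialSolution {q : ℝ → ℝ} (hq : AdmissibleProfile q) {n : ℕ} (hn : 2 ≤ n)
    {φ : ℝ → ℝ} (hφ : Adm q φ) :
    ∃ α : ℝ → ℝ, RadialSolution q n φ α (fun s => potential q s * α s + φ s) := by
  obtain ⟨α, hαc, ⟨A, hA⟩, hα⟩ := exists_fixed_point hq hn hφ.smooth.continuousOn hφ.rapid
  set b : ℝ → ℝ := fun s => potential q s * α s + φ s with hb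
  have hn0 : n ≠ 0 := by omega
  have hV := hq.adm_potential
  have bc : ContinuousOn b (Set.Ici 0) :=
    (hV.smooth.continuousOn.mul hαc).add hφ.smooth.continuousOn
  have αb : PolyBdd α := ⟨A, 0, fun s hs => by simpa using hA s hs⟩
  have br : Rapid b := ((Rapid.mul αb hV.rapid).congr fun s _ => by ring).add hφ.rapid
  have bi := br.integrableOn bc
  have hd : ∀ s, 0 ≤ s → HasDerivWithinAt α (-(1 / 4) * mean n b s) (Set.Ici 0) s := fun s hs =>
    (green_hasDeriv hn0 bc bi hs).congr hα (hα s hs)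
  have hsm : ∀ k : ℕ, ContDiffOn ℝ k α (Set.Ici 0) := by
    intro k
    induction k with
    | zero => exact contDiffOn_zero.2 hαc
    | succ k ih =>
      have hbk : ContDiffOn ℝ k b (Set.Ici 0) :=
        ((contDiffOn_infty.1 hV.smooth k).mul ih).add (contDiffOn_infty.1 hφ.smooth k)
      exact contDiffOn_succ_of_hasDeriv hd (contDiffOn_const.mul (contDiffOn_mean k n hbk))
  have αs : SmoothHalf α := contDiffOn_infty.2 hsm
  have bs : SmoothHalf b := (hV.smooth.mul αs).add hφ.smooth
  have dα : ∀ s, 0 ≤ s → dq α s = -(1 / 4) * mean n b s := fun s hs => dq_eq (hd s hs) hs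
  have ddα : ∀ s, 0 ≤ s → dq (dq α) s = -(1 / 4) * mean (n + 1) (dq b) s := fun s hs => by
    rw [dq_congr dα hs]
    exact dq_eq ((mean_hasDeriv bs.one hs).const_mul _) hs
  have a4 : |(-(1 / 4) : ℝ)| ≤ 1 := by rw [abs_le]; norm_num
  obtain ⟨C₁, hC₁⟩ := br (n + 2)
  have D1 : ∀ s, 0 ≤ s → (1 + s) ^ (n + 1) * |dq α s| ≤ C₁ := fun s hs => by
    refine le_trans ?_ (abs_mean_le_pow hC₁ hs)
    rw [dα s hs, abs_mul]
    gcongr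
    exact mul_le_of_le_one_left (abs_nonneg _) a4
  have symα : Sym α := ⟨αs, αb, polyBdd_of_decay D1⟩
  have adm : Adm q b :=
    ((Adm.mul hq.weightOK symα hV).congr fun s _ => by ring).add hq.weightOK hφ
  obtain ⟨C₂, hC₂⟩ := adm.rapid' (n + 1 + 2)
  refine ⟨α, fun s _ => rfl, hα, αs, adm, ⟨C₁, fun s hs => ?_⟩, ⟨C₁, D1⟩, ⟨C₂, fun s hs => ?_⟩,
    fun s hs => ?_⟩
  · rw [hα s hs]; exact abs_green_le_pow hn0 hC₁ hs
  · refine le_trans ?_ (abs_mean_le_pow hC₂ hs)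
    rw [ddα s hs, abs_mul]
    gcongr
    exact mul_le_of_le_one_left (abs_nonneg _) a4
  · rw [dα s hs, ddα s hs]
    -- At s = 0 the second-order term drops out and the mean is known explicitly; elsewhere the
    -- equation is the integration by parts identity for means.
    rcases hs.eq_or_lt with rfl | hs
    · rw [zero_mul, zero_add, mean_zero_arg (n := n) (h := b)]
      have : (n : ℝ) + 1 ≠ 0 := by positivity
      generalize ht : b 0 = t
      field_simp
      rw [← ht]
    · have := mean_succ_dq (n := n) bs.one hs
      linear_combination -this

end VortexPair

namespace VortexPair

/-! ### The plane and the complex line -/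

/-- The identification `x ↦ x₁ + i x₂`. -/
def zc : Plane ≃ₗᵢ[ℝ] ℂ := Complex.orthonormalBasisOneI.repr.symm

theorem zc_apply (x : Plane) : zc x = ⟨x 0, x 1⟩ := by
  rw [zc, Complex.orthonormalBasisOneI_repr_symm_apply]
  apply Complex.ext <;> simp

@[simp] theorem zc_re (x : Plane) : (zc x).re = x 0 := by rw [zc_apply]
@[simp] theorem zc_im (x : Plane) : (zc x).im = x 1 := by rw [zc_apply]

theorem zc_symm_apply (w : ℂ) : zc.symm w = !₂[w.re, w.im] := by
  rw [LinearIsometryEquiv.symm_apply_eq]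
  apply Complex.ext <;> simp

theorem normSq_eq (x : Plane) : ‖x‖ ^ 2 = x 0 ^ 2 + x 1 ^ 2 := by
  rw [EuclideanSpace.norm_sq_eq]; simp [Fin.sum_univ_two]

theorem abs_coord_le (x : Plane) (i : Fin 2) : |x i| ≤ ‖x‖ := by
  have := PiLp.norm_apply_le x i
  simpa using this

theorem norm_le_abs_add (x : Plane) : ‖x‖ ≤ |x 0| + |x 1| := by
  refine (le_abs_self _).trans (abs_le_of_sq_le_sq ?_ (by positivity))
  rw [normSq_eq]
  nlinarith [sq_abs (x 0), sq_abs (x 1), mul_nonneg (abs_nonneg (x 0)) (abs_nonneg (x 1))]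

@[simp] theorem perp_zero_coord (x : Plane) : perp x 0 = -x 1 := by simp [perp]
@[simp] theorem perp_one_coord (x : Plane) : perp x 1 = x 0 := by simp [perp]

/-- Rotation by a right angle as an isometry. -/
def perpIso : Plane ≃ₗᵢ[ℝ] Plane :=
  (zc.trans (rotation (⟨Complex.I, by simp [Submonoid.unitSphere]⟩ : Circle))).trans zc.symm

theorem plane_ext {x y : Plane} (h0 : x 0 = y 0) (h1 : x 1 = y 1) : x = y := by
  ext i; fin_cases i
  · exact h0
  · exact h1

theorem perpIso_apply (x : Plane) : perpIso x = perp x := by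
  have : perpIso x = zc.symm (Complex.I * zc x) := rfl
  rw [this, zc_symm_apply, zc_apply]
  apply plane_ext <;> simp

/-- Rotation by a right angle as a continuous linear map. -/
def perpL : Plane →L[ℝ] Plane := perpIso.toContinuousLinearEquiv.toContinuousLinearMap

@[simp] theorem perpL_apply (x : Plane) : perpL x = perp x := perpIso_apply x

theorem norm_perp (x : Plane) : ‖perp x‖ = ‖x‖ := by
  rw [← perpIso_apply]; exact perpIso.norm_map x

theorem zc_perp (x : Plane) : zc (perp x) = Complex.I * zc x := by
  apply Complex.ext <;> simp

/-- The unit vector of polar angle `φ`. -/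
def unitVec (φ : ℝ) : Plane := !₂[Real.cos φ, Real.sin φ]

@[simp] theorem unitVec_zero (φ : ℝ) : unitVec φ 0 = Real.cos φ := by simp [unitVec]
@[simp] theorem unitVec_one (φ : ℝ) : unitVec φ 1 = Real.sin φ := by simp [unitVec]

theorem norm_unitVec (φ : ℝ) : ‖unitVec φ‖ = 1 := by
  have h : ‖unitVec φ‖ ^ 2 = 1 := by
    rw [normSq_eq]; simp
  nlinarith [norm_nonneg (unitVec φ)]

theorem hasDerivAt_unitVec (φ : ℝ) : HasDerivAt unitVec (perp (unitVec φ)) φ := by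
  have h : HasDerivAt (fun φ : ℝ => Complex.exp (φ * Complex.I))
      (Complex.exp (φ * Complex.I) * (1 * Complex.I)) φ := by
    have h1 : HasDerivAt (fun φ : ℝ => (φ : ℂ) * Complex.I) (1 * Complex.I) φ :=
      (Complex.ofRealCLM.hasDerivAt (x := φ)).mul_const Complex.I
    exact h1.cexp
  have h2 := zc.symm.toContinuousLinearEquiv.toContinuousLinearMap.hasFDerivAt.comp_hasDerivAt φ h
  refine (h2.congr_deriv ?_).congr_of_eventuallyEq (Filter.Eventually.of_forall fun t => ?_)
  · change zc.symm _ = _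
    rw [zc_symm_apply]
    apply plane_ext <;> simp [Complex.exp_ofReal_mul_I_re, Complex.exp_ofReal_mul_I_im]
  · change _ = zc.symm _
    rw [zc_symm_apply]
    apply plane_ext <;> simp [Complex.exp_ofReal_mul_I_re, Complex.exp_ofReal_mul_I_im]

theorem continuous_unitVec : Continuous unitVec :=
  continuous_iff_continuousAt.2 fun φ => (hasDerivAt_unitVec φ).continuousAt

theorem integral_polar {E : Type*} [NormedAddCommGroup E] [NormedSpace ℝ E] (F : Plane → E) :
    ∫ x, F x = ∫ p : ℝ × ℝ in Set.Ioi 0 ×ˢ Set.Ioo (-Real.pi) Real.pi,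
      p.1 • F (p.1 • unitVec p.2) := by
  have h1 := zc.symm.measurePreserving.integral_comp
    zc.symm.toHomeomorph.measurableEmbedding F
  rw [← h1, ← Complex.integral_comp_polarCoord_symm]
  refine integral_congr_ae (Filter.Eventually.of_forall fun p => ?_)
  have : zc.symm (Complex.polarCoord.symm p) = p.1 • unitVec p.2 := by
    rw [zc_symm_apply, Complex.polarCoord_symm_apply]
    apply plane_ext <;> simp [-Complex.ofReal_cos, -Complex.ofReal_sin]
  simp only [this]

/-- A decaying field is the Biot-Savart velocity of its curl if it is divergence free. -/
theorem biotSavart_eq_of_curl {u : Plane → Plane} {u' : Plane → Plane →L[ℝ] Plane} {ω : Plane → ℝ}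
    (hu : ∀ x, HasFDerivAt u (u' x) x) (hc : Continuous u')
    (hb : ∃ C, ∀ x, (1 + ‖x‖) * ‖u x‖ ≤ C) (hb' : ∃ C, ∀ x, (1 + ‖x‖) ^ 2 * ‖u' x‖ ≤ C)
    (hdiv : ∀ x, u' x !₂[1, 0] 0 + u' x !₂[0, 1] 1 = 0)
    (hcurl : ∀ x, u' x !₂[1, 0] 1 - u' x !₂[0, 1] 0 = ω x) (x : Plane) :
    biotSavart ω x = u x := by
  obtain ⟨C, hC⟩ := hb
  obtain ⟨D, hD⟩ := hb'
  have hD0 : 0 ≤ D := le_trans (by positivity) (hD 0)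
  have hpi := Real.pi_pos
  let e := unitVec
  let P : ℝ × ℝ → Plane := fun p => x + p.1 • e p.2
  have Pc : Continuous P :=
    continuous_const.add (continuous_fst.smul (continuous_unitVec.comp continuous_snd))
  -- In polar coordinates (ρ, φ) about x, the Jacobian cancels the singularity and leaves -ω e^⊥ for
  -- the unit vector e. Here A is the radial derivative of u and B is ρ⁻¹ times the rotated angular
  -- derivative. For divergence-free u with curl ω one has -ω e^⊥ = -A + B, so A integrates to
  -- boundary values and B to zero by periodicity.
  let A : ℝ × ℝ → Plane := fun p => u' (P p) (e p.2)
  let B : ℝ × ℝ → Plane := fun p => perpL (u' (P p) (perp (e p.2)))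
  have hA : Continuous A := (hc.comp Pc).clm_apply (continuous_unitVec.comp continuous_snd)
  have hB : Continuous B := perpL.continuous.comp ((hc.comp Pc).clm_apply
    ((perpL.continuous.comp (continuous_unitVec.comp continuous_snd)).congr fun p => by simp [e]))
  -- decay along rays
  have far : ∀ p : ℝ × ℝ, 0 ≤ p.1 → 1 + p.1 ≤ (1 + ‖P p‖) * (1 + ‖x‖) := by
    intro p hp
    have h1 : ‖p.1 • e p.2‖ ≤ ‖P p‖ + ‖x‖ := by
      have : p.1 • e p.2 = P p - x := by simp [P]
      rw [this]; exact norm_sub_le _ _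
    rw [norm_smul, norm_unitVec, Real.norm_of_nonneg hp, mul_one] at h1
    nlinarith [norm_nonneg (P p), norm_nonneg x, mul_nonneg (norm_nonneg (P p)) (norm_nonneg x)]
  have bd : ∀ p : ℝ × ℝ, 0 ≤ p.1 → ‖u' (P p)‖ ≤ D * (1 + ‖x‖) ^ 2 / (p.1 + 1) ^ 2 := by
    intro p hp
    rw [le_div_iff₀ (by positivity)]
    have h1 := far p hp
    have h2 := hD (P p)
    calc ‖u' (P p)‖ * (p.1 + 1) ^ 2 ≤ ‖u' (P p)‖ * ((1 + ‖P p‖) * (1 + ‖x‖)) ^ 2 := by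
          gcongr; linarith
      _ = (1 + ‖P p‖) ^ 2 * ‖u' (P p)‖ * (1 + ‖x‖) ^ 2 := by ring
      _ ≤ _ := by gcongr
  set K := D * (1 + ‖x‖) ^ 2
  set μ := (volume : Measure ℝ).restrict (Set.Ioi 0)
  set ν := (volume : Measure ℝ).restrict (Set.Ioo (-Real.pi) Real.pi)
  have hprod : (volume : Measure (ℝ × ℝ)).restrict (Set.Ioi 0 ×ˢ Set.Ioo (-Real.pi) Real.pi)
      = μ.prod ν := by
    rw [Measure.prod_restrict]; rfl
  have hdom : Integrable (fun p : ℝ × ℝ => K / (p.1 + 1) ^ 2 * 1) (μ.prod ν) := by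
    have h1 : Integrable (fun t : ℝ => K / (t + 1) ^ 2) μ := (integrableOn_div_sq one_pos K le_rfl).1
    have h2 : Integrable (fun _ : ℝ => (1 : ℝ)) ν := integrable_const _
    exact h1.mul_prod h2
  have hae : ∀ᵐ p : ℝ × ℝ ∂(μ.prod ν), 0 ≤ p.1 := by
    rw [← hprod]
    filter_upwards [ae_restrict_mem (measurableSet_Ioi.prod measurableSet_Ioo)] with p hp
    exact le_of_lt hp.1
  have iA : Integrable A (μ.prod ν) := by
    refine hdom.mono' hA.aestronglyMeasurable ?_
    filter_upwards [hae] with p hp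
    rw [mul_one]
    refine ((u' (P p)).le_opNorm _).trans ?_
    rw [norm_unitVec, mul_one]; exact bd p hp
  have iB : Integrable B (μ.prod ν) := by
    refine hdom.mono' hB.aestronglyMeasurable ?_
    filter_upwards [hae] with p hp
    rw [mul_one]
    simp only [B, perpL_apply, norm_perp]
    refine ((u' (P p)).le_opNorm _).trans ?_
    rw [norm_perp, norm_unitVec, mul_one]; exact bd p hp
  -- the integrand in polar coordinates
  have hint : biotSavart ω x = (1 / (2 * Real.pi)) • ∫ p, (-A p + B p) ∂(μ.prod ν) := by
    rw [biotSavart, ← integral_add_left_eq_self _ x, integral_polar, hprod]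
    congr 1
    refine integral_congr_ae ?_
    rw [← hprod]
    filter_upwards [ae_restrict_mem (measurableSet_Ioi.prod measurableSet_Ioo)] with p hp
    have hp0 : 0 < p.1 := hp.1
    have e1 : x - (x + p.1 • unitVec p.2) = -(p.1 • unitVec p.2) := by abel
    have e2 : ‖x - (x + p.1 • unitVec p.2)‖ = p.1 := by
      rw [e1, norm_neg, norm_smul, norm_unitVec, mul_one, Real.norm_of_nonneg hp0.le]
    rw [e2, e1]
    have hdv := hdiv (P p)
    have hcl := hcurl (P p)
    have hP : x + p.1 • unitVec p.2 = P p := rfl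
    rw [hP]
    set L := u' (P p)
    have dec : ∀ v : Plane, L v = v 0 • L !₂[1, 0] + v 1 • L !₂[0, 1] := by
      intro v
      rw [← map_smul, ← map_smul, ← map_add]
      congr 1
      apply plane_ext <;> simp
    have hA' : A p = Real.cos p.2 • L !₂[1, 0] + Real.sin p.2 • L !₂[0, 1] := by
      have := dec (unitVec p.2); simpa using this
    have hB' : L (perp (e p.2)) = -Real.sin p.2 • L !₂[1, 0] + Real.cos p.2 • L !₂[0, 1] := by
      have := dec (perp (unitVec p.2)); simpa using this
    have hB'' : B p = perp (-Real.sin p.2 • L !₂[1, 0] + Real.cos p.2 • L !₂[0, 1]) := by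
      simp only [B, perpL_apply]; rw [← hB']
    rw [hA', hB'', ← hcl]
    set a := L !₂[1, 0]
    set b := L !₂[0, 1]
    have hd' : b 1 = -a 0 := by linarith
    apply plane_ext
    · simp [hd']; field_simp; ring
    · simp [hd']; field_simp; ring
  -- radial part
  have intA : ∫ p, A p ∂(μ.prod ν) = -((2 * Real.pi) • u x) := by
    rw [integral_prod_symm _ iA]
    have : ∀ φ : ℝ, ∫ ρ, A (ρ, φ) ∂μ = -u x := by
      intro φ
      have hder : ∀ ρ ∈ Set.Ici (0 : ℝ), HasDerivAt (fun ρ : ℝ => u (x + ρ • e φ)) (A (ρ, φ)) ρ := by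
        intro ρ _
        have h1 : HasDerivAt (fun ρ : ℝ => x + ρ • e φ) (e φ) ρ := by
          simpa using ((hasDerivAt_id ρ).smul_const (e φ)).const_add x
        exact (hu (x + ρ • e φ)).comp_hasDerivAt ρ h1
      have hi : IntegrableOn (fun ρ => A (ρ, φ)) (Set.Ioi 0) := by
        refine (integrableOn_div_sq one_pos K le_rfl).1.mono'
          (hA.comp (by fun_prop : Continuous fun ρ : ℝ => (ρ, φ))).aestronglyMeasurable ?_
        filter_upwards [ae_restrict_mem measurableSet_Ioi] with ρ hρ
        refine ((u' (P (ρ, φ))).le_opNorm _).trans ?_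
        rw [norm_unitVec, mul_one]; exact bd (ρ, φ) (le_of_lt hρ)
      have htend : Filter.Tendsto (fun ρ : ℝ => u (x + ρ • e φ)) Filter.atTop (nhds 0) := by
        have h0 : Filter.Tendsto (fun ρ : ℝ => C * (1 + ‖x‖) * (ρ + 1)⁻¹) Filter.atTop (nhds 0) := by
          have : Filter.Tendsto (fun ρ : ℝ => ρ + 1) Filter.atTop Filter.atTop :=
            Filter.tendsto_atTop_add_const_right _ _ Filter.tendsto_id
          simpa using (tendsto_inv_atTop_zero.comp this).const_mul (C * (1 + ‖x‖))
        refine squeeze_zero_norm' ?_ h0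
        filter_upwards [Filter.eventually_ge_atTop (0 : ℝ)] with ρ hρ
        have h1 := far (ρ, φ) hρ
        have h2 := hC (P (ρ, φ))
        change ‖u (P (ρ, φ))‖ ≤ _
        rw [← div_eq_mul_inv, le_div_iff₀ (by positivity)]
        calc ‖u (P (ρ, φ))‖ * (ρ + 1) ≤ ‖u (P (ρ, φ))‖ * ((1 + ‖P (ρ, φ)‖) * (1 + ‖x‖)) := by
              gcongr; simpa [add_comm] using h1
          _ = (1 + ‖P (ρ, φ)‖) * ‖u (P (ρ, φ))‖ * (1 + ‖x‖) := by ring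
          _ ≤ _ := by gcongr
      have := integral_Ioi_of_hasDerivAt_of_tendsto' hder hi htend
      simpa using this
    simp only [this]
    rw [integral_const]
    simp only [ν, smul_neg, measureReal_restrict_apply_univ, Real.volume_real_Ioo_of_le (show -Real.pi ≤ Real.pi by linarith)]
    congr 2; ring
  -- angular part
  have intB : ∫ p, B p ∂(μ.prod ν) = 0 := by
    rw [integral_prod _ iB]
    have : ∀ᵐ ρ ∂μ, ∫ φ, B (ρ, φ) ∂ν = 0 := by
      filter_upwards [ae_restrict_mem measurableSet_Ioi] with ρ hρ
      have hρ0 : (0 : ℝ) < ρ := hρ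
      have hder : ∀ φ : ℝ, HasDerivAt (fun φ : ℝ => ρ⁻¹ • perpL (u (x + ρ • e φ))) (B (ρ, φ)) φ := by
        intro φ
        have h1 : HasDerivAt (fun φ : ℝ => x + ρ • e φ) (ρ • perp (e φ)) φ :=
          ((hasDerivAt_unitVec φ).const_smul ρ).const_add x
        have h2 := (hu (x + ρ • e φ)).comp_hasDerivAt φ h1
        have h3 := (perpL.hasFDerivAt.comp_hasDerivAt φ h2).const_smul ρ⁻¹
        refine h3.congr_deriv ?_
        rw [map_smul, map_smul, smul_smul, inv_mul_cancel₀ hρ0.ne', one_smul]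
      have h4 := intervalIntegral.integral_eq_sub_of_hasDerivAt (a := -Real.pi) (b := Real.pi)
        (fun φ _ => hder φ)
        ((hB.comp (by fun_prop : Continuous fun φ : ℝ => (ρ, φ))).intervalIntegrable _ _)
      have h5 : e (-Real.pi) = e Real.pi := by
        apply plane_ext <;> simp [e]
      rw [h5, sub_self, intervalIntegral.integral_of_le (by linarith), integral_Ioc_eq_integral_Ioo] at h4
      exact h4
    rw [integral_congr_ae this, integral_zero]
  have hsum : ∫ p, (-A p + B p) ∂(μ.prod ν) = (∫ p, -A p ∂(μ.prod ν)) + ∫ p, B p ∂(μ.prod ν) :=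
    integral_add iA.neg iB
  rw [hint, hsum, intB, integral_neg, intA, neg_neg, add_zero, smul_smul,
    one_div_mul_cancel (by positivity), one_smul]

/-! ### Integrability of the kernel -/

theorem integrableOn_inv_norm_ball : IntegrableOn (fun y : Plane => ‖y‖⁻¹) (Metric.ball 0 1) := by
  refine integrableOn_ball_of_norm_le_rpow (C := 1) (α := 1) (by simp) (by simp)
    (Filter.Eventually.of_forall fun y => ?_) (by fun_prop : Measurable fun y : Plane => ‖y‖⁻¹).aestronglyMeasurable
  rw [Real.rpow_neg_one, one_mul, norm_inv, norm_norm]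

/-- The part of `1/|y|` near the origin. -/
def nearKernel : Plane → ℝ := (Metric.ball 0 1).indicator fun y => ‖y‖⁻¹

theorem integrable_nearKernel : Integrable nearKernel :=
  (integrable_indicator_iff measurableSet_ball).2 integrableOn_inv_norm_ball

theorem nearKernel_nonneg (y : Plane) : 0 ≤ nearKernel y :=
  Set.indicator_nonneg (fun y _ => inv_nonneg.2 (norm_nonneg y)) y

/-- The kernel is split into an integrable part and a bounded part, so only the L¹ and L^∞ norms of
the density enter the estimates. -/
theorem inv_norm_le (y : Plane) : ‖y‖⁻¹ ≤ nearKernel y + 1 := by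
  by_cases hy : y ∈ Metric.ball (0 : Plane) 1
  · rw [nearKernel, Set.indicator_of_mem hy]; linarith
  · rw [nearKernel, Set.indicator_of_notMem hy, zero_add]
    rw [mem_ball_zero_iff, not_lt] at hy
    exact inv_le_one_of_one_le₀ hy

theorem integrable_nearKernel_sub (x : Plane) : Integrable fun y => nearKernel (x - y) :=
  integrable_nearKernel.comp_sub_left x

theorem integral_nearKernel_sub (x : Plane) : ∫ y, nearKernel (x - y) = ∫ y, nearKernel y :=
  integral_sub_left_eq_self nearKernel volume x

theorem integrable_mul_inv_norm {f : Plane → ℝ} {M : ℝ} (hf : Integrable f) (hM : ∀ y, |f y| ≤ M)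
    (x : Plane) : Integrable fun y => f y * ‖x - y‖⁻¹ := by
  refine (((integrable_nearKernel_sub x).const_mul M).add hf.abs).mono' ?_
    (Filter.Eventually.of_forall fun y => ?_)
  · exact hf.aestronglyMeasurable.mul
      (by fun_prop : Measurable fun y : Plane => ‖x - y‖⁻¹).aestronglyMeasurable
  · have h1 := inv_norm_le (x - y)
    have h2 := nearKernel_nonneg (x - y)
    simp only [Pi.add_apply]
    rw [norm_mul, norm_inv, norm_norm, Real.norm_eq_abs]
    calc |f y| * ‖x - y‖⁻¹ ≤ |f y| * (nearKernel (x - y) + 1) := by gcongr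
      _ = |f y| * nearKernel (x - y) + |f y| := by ring
      _ ≤ _ := by gcongr; exact hM y

theorem integral_mul_inv_norm_le {f : Plane → ℝ} {M : ℝ} (hf : Integrable f) (hM : ∀ y, |f y| ≤ M)
    (x : Plane) : ∫ y, |f y| * ‖x - y‖⁻¹ ≤ M * (∫ y, nearKernel y) + ∫ y, |f y| := by
  have h0 : Integrable fun y => M * nearKernel (x - y) := (integrable_nearKernel_sub x).const_mul M
  have h1 : ∫ y, |f y| * ‖x - y‖⁻¹ ≤ ∫ y, (M * nearKernel (x - y) + |f y|) := by
    refine integral_mono (integrable_mul_inv_norm hf.abs (fun y => by rw [abs_abs]; exact hM y) x)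
      (h0.add hf.abs) fun y => ?_
    have h1 := inv_norm_le (x - y)
    have h2 := nearKernel_nonneg (x - y)
    simp only
    calc |f y| * ‖x - y‖⁻¹ ≤ |f y| * (nearKernel (x - y) + 1) := by gcongr
      _ = |f y| * nearKernel (x - y) + |f y| := by ring
      _ ≤ _ := by gcongr; exact hM y
  rw [integral_add h0 hf.abs, integral_const_mul, integral_nearKernel_sub] at h1
  linarith

end VortexPair

namespace VortexPair

/-! ### Angular modes -/

/-- `Re(ζ z^n) h(|x|²)`. -/
def mode (n : ℕ) (ζ : ℂ) (h : ℝ → ℝ) (x : Plane) : ℝ := (ζ * zc x ^ n).re * h (‖x‖ ^ 2)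

/-- The linear form `v ↦ Re(c v)`. -/
def reForm (c : ℂ) : Plane →L[ℝ] ℝ :=
  Complex.reCLM.comp ((c • ContinuousLinearMap.id ℝ ℂ).comp
    zc.toContinuousLinearEquiv.toContinuousLinearMap)

@[simp] theorem reForm_apply (c : ℂ) (v : Plane) : reForm c v = (c * zc v).re := rfl

theorem norm_reForm_le (c : ℂ) : ‖reForm c‖ ≤ ‖c‖ := by
  refine ContinuousLinearMap.opNorm_le_bound _ (norm_nonneg _) fun v => ?_
  rw [reForm_apply, Real.norm_eq_abs]
  refine (Complex.abs_re_le_norm _).trans ?_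
  rw [norm_mul, LinearIsometryEquiv.norm_map]

/-- The scalar product of the plane as a linear form. -/
def dotForm (x : Plane) : Plane →L[ℝ] ℝ := innerSL ℝ x

@[simp] theorem dotForm_apply (x v : Plane) : dotForm x v = x 0 * v 0 + x 1 * v 1 := by
  rw [dotForm, innerSL_apply_apply, PiLp.inner_apply]
  simp [Fin.sum_univ_two]; ring

theorem norm_dotForm (x : Plane) : ‖dotForm x‖ = ‖x‖ := innerSL_apply_norm ℝ x

/-- The differential of a mode; `k` stands for the derivative of `h`. -/
def modeDeriv (n : ℕ) (ζ : ℂ) (h k : ℝ → ℝ) (x : Plane) : Plane →L[ℝ] ℝ :=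
  h (‖x‖ ^ 2) • reForm (ζ * (n * zc x ^ (n - 1)))
    + (2 * (ζ * zc x ^ n).re * k (‖x‖ ^ 2)) • dotForm x

theorem modeDeriv_apply (n : ℕ) (ζ : ℂ) (h k : ℝ → ℝ) (x v : Plane) :
    modeDeriv n ζ h k x v = h (‖x‖ ^ 2) * (ζ * (n * zc x ^ (n - 1)) * zc v).re
      + 2 * (ζ * zc x ^ n).re * k (‖x‖ ^ 2) * (x 0 * v 0 + x 1 * v 1) := by
  simp [modeDeriv]

theorem hasFDerivAt_rePow (n : ℕ) (ζ : ℂ) (x : Plane) :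
    HasFDerivAt (fun x : Plane => (ζ * zc x ^ n).re) (reForm (ζ * (n * zc x ^ (n - 1)))) x := by
  have h1 : HasFDerivAt (fun x : Plane => zc x)
      (zc.toContinuousLinearEquiv.toContinuousLinearMap : Plane →L[ℝ] ℂ) x :=
    zc.toContinuousLinearEquiv.toContinuousLinearMap.hasFDerivAt
  have h2 : HasDerivAt (fun w : ℂ => ζ * w ^ n) (ζ * (n * zc x ^ (n - 1))) (zc x) :=
    (hasDerivAt_pow n (zc x)).const_mul ζ
  have h3 := Complex.reCLM.hasFDerivAt.comp x ((h2.hasFDerivAt.restrictScalars ℝ).comp x h1)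
  refine h3.congr_fderiv ?_
  ext v
  simp [mul_comm]

theorem hasFDerivAt_normSq (x : Plane) :
    HasFDerivAt (fun x : Plane => ‖x‖ ^ 2) ((2 : ℝ) • dotForm x) x :=
  (hasStrictFDerivAt_norm_sq x).hasFDerivAt.congr_fderiv (by
    rw [← Nat.cast_smul_eq_nsmul ℝ 2]; rfl)

theorem hasFDerivAt_comp_normSq {h : ℝ → ℝ} {a : ℝ} {x : Plane}
    (hh : HasDerivWithinAt h a (Set.Ici 0) (‖x‖ ^ 2)) :
    HasFDerivAt (fun x : Plane => h (‖x‖ ^ 2)) ((2 * a) • dotForm x) x := by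
  have := (hh.hasFDerivWithinAt.comp x (hasFDerivAt_normSq x).hasFDerivWithinAt
    (s := Set.univ) fun y _ => sq_nonneg ‖y‖)
  rw [hasFDerivWithinAt_univ] at this
  refine this.congr_fderiv ?_
  ext v
  simp; ring

theorem hasFDerivAt_mode {n : ℕ} {ζ : ℂ} {h k : ℝ → ℝ} {x : Plane}
    (hh : HasDerivWithinAt h (k (‖x‖ ^ 2)) (Set.Ici 0) (‖x‖ ^ 2)) :
    HasFDerivAt (mode n ζ h) (modeDeriv n ζ h k x) x := by
  refine ((hasFDerivAt_rePow n ζ x).mul (hasFDerivAt_comp_normSq hh)).congr_fderiv ?_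
  ext v
  rw [modeDeriv_apply]
  simp; ring

theorem contDiff_rePow (n : ℕ) (ζ : ℂ) :
    ContDiff ℝ (⊤ : ℕ∞) fun x : Plane => (ζ * zc x ^ n).re := by
  have h1 : ContDiff ℝ (⊤ : ℕ∞) fun x : Plane => zc x :=
    zc.toContinuousLinearEquiv.toContinuousLinearMap.contDiff
  exact Complex.reCLM.contDiff.comp (contDiff_const.mul (h1.pow n))

theorem contDiff_comp_normSq {h : ℝ → ℝ} (hh : SmoothHalf h) :
    ContDiff ℝ (⊤ : ℕ∞) fun x : Plane => h (‖x‖ ^ 2) := by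
  rw [← contDiffOn_univ]
  exact ContDiffOn.comp hh (contDiff_norm_sq ℝ).contDiffOn fun x _ => sq_nonneg ‖x‖

theorem contDiff_mode (n : ℕ) (ζ : ℂ) {h : ℝ → ℝ} (hh : SmoothHalf h) :
    ContDiff ℝ (⊤ : ℕ∞) (mode n ζ h) := (contDiff_rePow n ζ).mul (contDiff_comp_normSq hh)

theorem SmoothHalf.hasFDerivAt_mode {h : ℝ → ℝ} (hh : SmoothHalf h) (n : ℕ) (ζ : ℂ) (x : Plane) :
    HasFDerivAt (mode n ζ h) (modeDeriv n ζ h (VortexPair.dq h) x) x :=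
  VortexPair.hasFDerivAt_mode (hh.hasDeriv (sq_nonneg _))

theorem norm_rePow_le (n : ℕ) (ζ : ℂ) (x : Plane) : |(ζ * zc x ^ n).re| ≤ ‖ζ‖ * ‖x‖ ^ n := by
  refine (Complex.abs_re_le_norm _).trans ?_
  rw [norm_mul, norm_pow, LinearIsometryEquiv.norm_map]

theorem abs_mode_le (n : ℕ) (ζ : ℂ) (h : ℝ → ℝ) (x : Plane) :
    |mode n ζ h x| ≤ ‖ζ‖ * (‖x‖ ^ n * |h (‖x‖ ^ 2)|) := by
  rw [mode, abs_mul, ← mul_assoc]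
  gcongr
  exact norm_rePow_le n ζ x

theorem norm_modeDeriv_le (n : ℕ) (ζ : ℂ) (h k : ℝ → ℝ) (x : Plane) :
    ‖modeDeriv n ζ h k x‖ ≤ ‖ζ‖ * n * (‖x‖ ^ (n - 1) * |h (‖x‖ ^ 2)|)
      + 2 * ‖ζ‖ * (‖x‖ ^ (n + 1) * |k (‖x‖ ^ 2)|) := by
  refine (norm_add_le _ _).trans (add_le_add ?_ ?_)
  · rw [norm_smul, Real.norm_eq_abs]
    have := norm_reForm_le (ζ * (n * zc x ^ (n - 1)))
    rw [norm_mul, norm_mul, norm_pow, LinearIsometryEquiv.norm_map, Complex.norm_natCast] at this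
    calc |h (‖x‖ ^ 2)| * ‖reForm (ζ * (n * zc x ^ (n - 1)))‖
        ≤ |h (‖x‖ ^ 2)| * (‖ζ‖ * (n * ‖x‖ ^ (n - 1))) := by gcongr
      _ = _ := by ring
  · rw [norm_smul, norm_dotForm, Real.norm_eq_abs, abs_mul, abs_mul, abs_two]
    calc 2 * |(ζ * zc x ^ n).re| * |k (‖x‖ ^ 2)| * ‖x‖
        ≤ 2 * (‖ζ‖ * ‖x‖ ^ n) * |k (‖x‖ ^ 2)| * ‖x‖ := by
          gcongr; exact norm_rePow_le n ζ x
      _ = _ := by ring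

/-! ### Velocity fields of modes -/

/-- The vector with given coordinates, as a sum. -/
def vec (a b : ℝ) : Plane := a • !₂[1, 0] + b • !₂[0, 1]

@[simp] theorem vec_zero (a b : ℝ) : vec a b 0 = a := by simp [vec]
@[simp] theorem vec_one (a b : ℝ) : vec a b 1 = b := by simp [vec]

/-- The differential of a vector field with given components. -/
def vecDeriv (f' g' : Plane →L[ℝ] ℝ) : Plane →L[ℝ] Plane :=
  f'.smulRight !₂[1, 0] + g'.smulRight !₂[0, 1]

theorem vecDeriv_apply (f' g' : Plane →L[ℝ] ℝ) (v : Plane) :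
    vecDeriv f' g' v = vec (f' v) (g' v) := rfl

theorem hasFDerivAt_vec {f g : Plane → ℝ} {f' g' : Plane →L[ℝ] ℝ} {x : Plane}
    (hf : HasFDerivAt f f' x) (hg : HasFDerivAt g g' x) :
    HasFDerivAt (fun x => vec (f x) (g x)) (vecDeriv f' g') x :=
  (hf.smul_const _).add (hg.smul_const _)

theorem continuous_vec {f g : Plane → ℝ} (hf : Continuous f) (hg : Continuous g) :
    Continuous fun x => vec (f x) (g x) :=
  (hf.smul continuous_const).add (hg.smul continuous_const)

theorem norm_vec_le (a b : ℝ) : ‖vec a b‖ ≤ |a| + |b| := by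
  have := norm_le_abs_add (vec a b)
  simpa using this

theorem norm_vecDeriv_le (f' g' : Plane →L[ℝ] ℝ) : ‖vecDeriv f' g'‖ ≤ ‖f'‖ + ‖g'‖ := by
  refine ContinuousLinearMap.opNorm_le_bound _ (by positivity) fun v => ?_
  rw [vecDeriv_apply, add_mul]
  exact (norm_vec_le _ _).trans (add_le_add (f'.le_opNorm v) (g'.le_opNorm v))

/-- The coordinates as linear forms. -/
def coordForm (i : Fin 2) : Plane →L[ℝ] ℝ := EuclideanSpace.proj i

@[simp] theorem coordForm_apply (i : Fin 2) (v : Plane) : coordForm i v = v i := rfl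

/-- The velocity field `-∇^⊥(Re(ζ z^n) α(|x|²))`; `β` stands for `α'`. -/
def modeVel (n : ℕ) (ζ : ℂ) (α β : ℝ → ℝ) (x : Plane) : Plane :=
  vec (mode (n - 1) (ζ * n * Complex.I) α x + x 1 * mode n (2 * ζ) β x)
    (-(mode (n - 1) (ζ * n) α x + x 0 * mode n (2 * ζ) β x))

/-- As s = |x|², each power of 1 + s pays for two powers of 1 + |x|. -/
theorem pow_mul_decay {k a j : ℕ} {h : ℝ → ℝ} {C : ℝ}
    (hC : ∀ s, 0 ≤ s → (1 + s) ^ k * |h s| ≤ C) (ha : a + j ≤ 2 * k) (x : Plane) :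
    (1 + ‖x‖) ^ j * (‖x‖ ^ a * |h (‖x‖ ^ 2)|) ≤ 2 ^ k * C := by
  have hn := norm_nonneg x
  have h1 := hC _ (sq_nonneg ‖x‖)
  have h2 : (1 + ‖x‖) ^ 2 ≤ 2 * (1 + ‖x‖ ^ 2) := by nlinarith [sq_nonneg (‖x‖ - 1)]
  calc (1 + ‖x‖) ^ j * (‖x‖ ^ a * |h (‖x‖ ^ 2)|)
      ≤ (1 + ‖x‖) ^ j * ((1 + ‖x‖) ^ a * |h (‖x‖ ^ 2)|) := by gcongr; linarith
    _ = (1 + ‖x‖) ^ (a + j) * |h (‖x‖ ^ 2)| := by ring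
    _ ≤ (1 + ‖x‖) ^ (2 * k) * |h (‖x‖ ^ 2)| := by gcongr; linarith
    _ ≤ (2 * (1 + ‖x‖ ^ 2)) ^ k * |h (‖x‖ ^ 2)| := by rw [pow_mul]; gcongr
    _ = 2 ^ k * ((1 + ‖x‖ ^ 2) ^ k * |h (‖x‖ ^ 2)|) := by rw [mul_pow]; ring
    _ ≤ _ := by gcongr

/-- Polynomially weighted boundedness of a field on the plane. -/
def DecayBy {E : Type*} [Norm E] (j : ℕ) (f : Plane → E) : Prop :=
  ∃ C, ∀ x, (1 + ‖x‖) ^ j * ‖f x‖ ≤ C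

theorem DecayBy.mono {E F : Type*} [Norm E] [Norm F] {j : ℕ} {f : Plane → E} {g : Plane → F}
    (hg : DecayBy j g) (h : ∀ x, ‖f x‖ ≤ ‖g x‖) : DecayBy j f := by
  obtain ⟨C, hC⟩ := hg
  exact ⟨C, fun x => (mul_le_mul_of_nonneg_left (h x) (by positivity)).trans (hC x)⟩

theorem DecayBy.add {j : ℕ} {f g : Plane → ℝ} (hf : DecayBy j f) (hg : DecayBy j g) :
    DecayBy j fun x => f x + g x := by
  obtain ⟨C, hC⟩ := hf
  obtain ⟨D, hD⟩ := hg
  refine ⟨C + D, fun x => ?_⟩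
  have := mul_le_mul_of_nonneg_left (norm_add_le (f x) (g x)) (by positivity : 0 ≤ (1 + ‖x‖) ^ j)
  linarith [hC x, hD x]

theorem DecayBy.const_mul {j : ℕ} {f : Plane → ℝ} (c : ℝ) (hf : DecayBy j f) :
    DecayBy j fun x => c * f x := by
  obtain ⟨C, hC⟩ := hf
  refine ⟨|c| * C, fun x => ?_⟩
  rw [norm_mul, Real.norm_eq_abs c]
  calc (1 + ‖x‖) ^ j * (|c| * ‖f x‖) = |c| * ((1 + ‖x‖) ^ j * ‖f x‖) := by ring
    _ ≤ _ := by gcongr; exact hC x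

theorem decayBy_pow_mul {k a j : ℕ} {h : ℝ → ℝ} (hd : ∃ C, ∀ s, 0 ≤ s → (1 + s) ^ k * |h s| ≤ C)
    (ha : a + j ≤ 2 * k) : DecayBy j fun x : Plane => ‖x‖ ^ a * |h (‖x‖ ^ 2)| := by
  obtain ⟨C, hC⟩ := hd
  exact ⟨2 ^ k * C, fun x => by
    rw [Real.norm_of_nonneg (by positivity)]; exact pow_mul_decay hC ha x⟩

theorem DecayBy.of_le {E : Type*} [Norm E] {j : ℕ} {f : Plane → E} {g : Plane → ℝ}
    (hg : DecayBy j g) (h : ∀ x, ‖f x‖ ≤ g x) : DecayBy j f :=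
  hg.mono fun x => (h x).trans (le_abs_self _)

theorem norm_coordForm_le (i : Fin 2) : ‖coordForm i‖ ≤ 1 :=
  ContinuousLinearMap.opNorm_le_bound _ zero_le_one fun v => by
    rw [one_mul]; exact abs_coord_le v i

/-- The differential of `x_i mode`. -/
def coordModeDeriv (i : Fin 2) (n : ℕ) (ζ : ℂ) (h k : ℝ → ℝ) (x : Plane) : Plane →L[ℝ] ℝ :=
  x i • modeDeriv n ζ h k x + mode n ζ h x • coordForm i

theorem hasFDerivAt_coordMode {i : Fin 2} {n : ℕ} {ζ : ℂ} {h k : ℝ → ℝ} {x : Plane}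
    (hh : HasDerivWithinAt h (k (‖x‖ ^ 2)) (Set.Ici 0) (‖x‖ ^ 2)) :
    HasFDerivAt (fun x => x i * mode n ζ h x) (coordModeDeriv i n ζ h k x) x :=
  (coordForm i).hasFDerivAt.mul (hasFDerivAt_mode hh)

theorem norm_coordModeDeriv_le (i : Fin 2) (n : ℕ) (ζ : ℂ) (h k : ℝ → ℝ) (x : Plane) :
    ‖coordModeDeriv i n ζ h k x‖ ≤ ‖ζ‖ * (n + 1) * (‖x‖ ^ n * |h (‖x‖ ^ 2)|)
      + 2 * ‖ζ‖ * (‖x‖ ^ (n + 2) * |k (‖x‖ ^ 2)|) := by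
  have e : (n : ℝ) * (‖x‖ * ‖x‖ ^ (n - 1)) = n * ‖x‖ ^ n := by
    cases n with
    | zero => simp
    | succ n => rw [Nat.add_sub_cancel, pow_succ' ‖x‖ n]
  refine (norm_add_le _ _).trans ?_
  rw [norm_smul, norm_smul, Real.norm_eq_abs, Real.norm_eq_abs]
  calc |x i| * ‖modeDeriv n ζ h k x‖ + |mode n ζ h x| * ‖coordForm i‖
      ≤ ‖x‖ * (‖ζ‖ * n * (‖x‖ ^ (n - 1) * |h (‖x‖ ^ 2)|)
        + 2 * ‖ζ‖ * (‖x‖ ^ (n + 1) * |k (‖x‖ ^ 2)|)) + ‖ζ‖ * (‖x‖ ^ n * |h (‖x‖ ^ 2)|) * 1 :=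
        add_le_add (mul_le_mul (abs_coord_le x i) (norm_modeDeriv_le n ζ h k x) (norm_nonneg _)
          (norm_nonneg _)) (mul_le_mul (abs_mode_le n ζ h x) (norm_coordForm_le i) (norm_nonneg _)
          (by positivity))
    _ = ‖ζ‖ * |h (‖x‖ ^ 2)| * (n * (‖x‖ * ‖x‖ ^ (n - 1))) + ‖ζ‖ * (‖x‖ ^ n * |h (‖x‖ ^ 2)|)
        + 2 * ‖ζ‖ * (‖x‖ ^ (n + 2) * |k (‖x‖ ^ 2)|) := by ring
    _ = _ := by rw [e]; ring

theorem continuous_mode {n : ℕ} {ζ : ℂ} {h : ℝ → ℝ} (hh : ContinuousOn h (Set.Ici 0)) :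
    Continuous (mode n ζ h) := (contDiff_rePow n ζ).continuous.mul (continuous_comp_normSq hh)

theorem continuous_modeDeriv {n : ℕ} {ζ : ℂ} {h k : ℝ → ℝ} (hh : ContinuousOn h (Set.Ici 0))
    (hk : ContinuousOn k (Set.Ici 0)) : Continuous (modeDeriv n ζ h k) := by
  have h1 : Continuous fun c : ℂ => reForm c := by
    have h2 : Continuous fun c : ℂ => (c • ContinuousLinearMap.id ℝ ℂ : ℂ →L[ℝ] ℂ) := by fun_prop
    exact continuous_const.clm_comp (h2.clm_comp continuous_const)
  have h3 : Continuous fun x : Plane => dotForm x := (innerSL ℝ).continuous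
  have h4 : Continuous fun x : Plane => zc x := zc.continuous
  exact ((continuous_comp_normSq hh).smul (h1.comp (continuous_const.mul
    (continuous_const.mul (h4.pow _))))).add
    (((continuous_const.mul (contDiff_rePow n ζ).continuous).mul (continuous_comp_normSq hk)).smul h3)

theorem continuous_modeVel {n : ℕ} {ζ : ℂ} {α β : ℝ → ℝ} (hα : ContinuousOn α (Set.Ici 0))
    (hβ : ContinuousOn β (Set.Ici 0)) : Continuous (modeVel n ζ α β) :=
  continuous_vec ((continuous_mode hα).add ((coordForm 1).continuous.mul (continuous_mode hβ)))
    ((continuous_mode hα).add ((coordForm 0).continuous.mul (continuous_mode hβ))).neg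

theorem zc_e0 : zc !₂[1, 0] = 1 := by apply Complex.ext <;> simp
theorem zc_e1 : zc !₂[0, 1] = Complex.I := by apply Complex.ext <;> simp

/-- The Biot-Savart velocity of a mode whose coefficient is given by the Green operator. -/
theorem biotSavart_mode {q : ℝ → ℝ} {n : ℕ} (hn : 2 ≤ n) {φ α b : ℝ → ℝ}
    (hs : RadialSolution q n φ α b) (ζ : ℂ) (x : Plane) :
    biotSavart (mode n ζ b) x = modeVel n ζ α (dq α) x := by
  have s0 := hs.smooth
  have s1 := s0.dq
  have s2 := s1.dq
  set β := dq α
  set γ := dq β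
  let f' : Plane → Plane →L[ℝ] ℝ := fun x =>
    modeDeriv (n - 1) (ζ * n * Complex.I) α β x + coordModeDeriv 1 n (2 * ζ) β γ x
  let g' : Plane → Plane →L[ℝ] ℝ := fun x =>
    -(modeDeriv (n - 1) (ζ * n) α β x + coordModeDeriv 0 n (2 * ζ) β γ x)
  have cf : Continuous f' :=
    (continuous_modeDeriv s0.continuousOn s1.continuousOn).add
      (((coordForm 1).continuous.smul (continuous_modeDeriv s1.continuousOn s2.continuousOn)).add
        ((continuous_mode s1.continuousOn).smul continuous_const))
  have cg : Continuous g' :=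
    ((continuous_modeDeriv s0.continuousOn s1.continuousOn).add
      (((coordForm 0).continuous.smul (continuous_modeDeriv s1.continuousOn s2.continuousOn)).add
        ((continuous_mode s1.continuousOn).smul continuous_const))).neg
  have hder : ∀ x, HasFDerivAt (modeVel n ζ α β) (vecDeriv (f' x) (g' x)) x := fun x =>
    hasFDerivAt_vec
      ((s0.hasFDerivAt_mode _ _ x).add (hasFDerivAt_coordMode (s1.hasDeriv (sq_nonneg _))))
      ((s0.hasFDerivAt_mode _ _ x).add (hasFDerivAt_coordMode (s1.hasDeriv (sq_nonneg _)))).neg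
  have cv : Continuous fun x => vecDeriv (f' x) (g' x) := by
    have hL : ∀ e : Plane, Continuous fun f : Plane →L[ℝ] ℝ => f.smulRight e := fun e =>
      (ContinuousLinearMap.smulRightL ℝ Plane Plane |>.flip e).continuous
    exact ((hL _).comp cf).add ((hL _).comp cg)
  have d0 := fun a j (h : a + j ≤ 2 * n) => decayBy_pow_mul (a := a) (j := j) hs.decay₀ h
  have d1 := fun a j (h : a + j ≤ 2 * (n + 1)) => decayBy_pow_mul (a := a) (j := j) hs.decay₁ h
  have d2 := fun a j (h : a + j ≤ 2 * (n + 2)) => decayBy_pow_mul (a := a) (j := j) hs.decay₂ h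
  have bmode : ∀ (ζ' : ℂ), DecayBy 1 (mode (n - 1) ζ' α) := fun ζ' =>
    ((d0 (n - 1) 1 (by omega)).const_mul ‖ζ'‖).of_le fun x => abs_mode_le _ _ _ x
  have bcoord : ∀ i : Fin 2, DecayBy 1 fun x : Plane => x i * mode n (2 * ζ) β x := fun i =>
    ((d1 (n + 1) 1 (by omega)).const_mul ‖2 * ζ‖).of_le fun x => by
      rw [norm_mul]
      calc ‖x i‖ * ‖mode n (2 * ζ) β x‖ ≤ ‖x‖ * (‖2 * ζ‖ * (‖x‖ ^ n * |β (‖x‖ ^ 2)|)) :=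
            mul_le_mul (abs_coord_le x i) (abs_mode_le _ _ _ x) (norm_nonneg _) (norm_nonneg _)
        _ = _ := by ring
  have bder : ∀ ζ' : ℂ, DecayBy 2 (modeDeriv (n - 1) ζ' α β) := fun ζ' =>
    (((d0 (n - 1 - 1) 2 (by omega)).const_mul (‖ζ'‖ * (n - 1 : ℕ))).add
      ((d1 (n - 1 + 1) 2 (by omega)).const_mul (2 * ‖ζ'‖))).of_le fun x => norm_modeDeriv_le _ _ _ _ x
  have bcder : ∀ i : Fin 2, DecayBy 2 (coordModeDeriv i n (2 * ζ) β γ) := fun i =>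
    (((d1 n 2 (by omega)).const_mul (‖2 * ζ‖ * (n + 1))).add
      ((d2 (n + 2) 2 (by omega)).const_mul (2 * ‖2 * ζ‖))).of_le
      fun x => norm_coordModeDeriv_le _ _ _ _ _ x
  have norm' : ∀ {E : Type} [NormedAddCommGroup E] {j : ℕ} {f : Plane → E}, DecayBy j f →
      DecayBy j fun x => ‖f x‖ := fun h => h.mono fun x => by rw [norm_norm]
  -- The candidate is a rotated gradient, so its divergence vanishes. Its curl is minus the
  -- Laplacian of the stream function, which the radial equation identifies with the vorticity.
  refine biotSavart_eq_of_curl (u' := fun x => vecDeriv (f' x) (g' x)) hder cv ?_ ?_ ?_ ?_ x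
  · have : DecayBy 1 (modeVel n ζ α β) :=
      (((norm' (bmode (ζ * n * Complex.I))).add (norm' (bcoord 1))).add
        ((norm' (bmode (ζ * n))).add (norm' (bcoord 0)))).of_le fun x => by
        refine (norm_vec_le _ _).trans ?_
        rw [abs_neg]
        exact add_le_add (abs_add_le _ _) (abs_add_le _ _)
    simpa [DecayBy] using this
  · exact (((norm' (bder (ζ * n * Complex.I))).add (norm' (bcder 1))).add
        ((norm' (bder (ζ * n))).add (norm' (bcder 0)))).of_le fun x => by
      refine (norm_vecDeriv_le _ _).trans ?_
      simp only [f', g', norm_neg]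
      exact add_le_add (norm_add_le _ _) (norm_add_le _ _)
  · intro x
    simp only [vecDeriv_apply, vec_zero, vec_one, f', g', coordModeDeriv,
      add_apply, neg_apply, smul_apply,
      modeDeriv_apply, coordForm_apply, zc_e0, zc_e1, smul_eq_mul]
    simp
    ring
  · intro x
    have hode := hs.ode _ (sq_nonneg ‖x‖)
    -- Euler's identity for the homogeneous polynomial zⁿ; the bound on n excludes the truncated
    -- exponent n - 1 at n = 0.
    have hpow : (n : ℂ) * zc x ^ (n - 1) * zc x = n * zc x ^ n := by
      rw [mul_assoc, ← pow_succ, Nat.sub_add_cancel (by omega)]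
    have hre := congrArg Complex.re (congrArg (fun w => ζ * w) hpow)
    rw [normSq_eq] at hode
    simp only [vecDeriv_apply, vec_zero, vec_one, f', g', coordModeDeriv, mode,
      add_apply, neg_apply, smul_apply,
      modeDeriv_apply, coordForm_apply, zc_e0, zc_e1, smul_eq_mul, normSq_eq]
    simp at hre ⊢
    linear_combination (-4 * β (x 0 ^ 2 + x 1 ^ 2)) * hre
      - (ζ.re * (zc x ^ n).re - ζ.im * (zc x ^ n).im) * hode

end VortexPair

namespace VortexPair

/-! ### The velocity field of the radial profile -/

theorem fderiv_wStar {q : ℝ → ℝ} (hq : AdmissibleProfile q) (x : Plane) :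
    HasFDerivAt (wStar q) ((2 * dq q (‖x‖ ^ 2) / Real.pi) • dotForm x) x := by
  have := (hasFDerivAt_comp_normSq (hq.smoothHalf.hasDeriv (sq_nonneg ‖x‖))).mul_const Real.pi⁻¹
  refine this.congr_fderiv ?_
  rw [smul_smul]
  congr 1
  ring

/-- The curl of (m/2π)x^⊥ is (m + sm')/π = (sm)'/π = q/π, and this field is circular, hence
divergence free. -/
theorem vStar_eq {q : ℝ → ℝ} (hq : AdmissibleProfile q) (x : Plane) :
    vStar q x = (angMean q (‖x‖ ^ 2) / (2 * Real.pi)) • perp x := by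
  set m := angMean q
  have hm := hq.smooth_angMean
  let m' : Plane → Plane →L[ℝ] ℝ := fun x =>
    (2 * dq m (‖x‖ ^ 2) / (2 * Real.pi)) • dotForm x
  let u' : Plane → Plane →L[ℝ] Plane := fun x =>
    (m (‖x‖ ^ 2) / (2 * Real.pi)) • perpL + (m' x).smulRight (perp x)
  have hm' : ∀ x, HasFDerivAt (fun x : Plane => m (‖x‖ ^ 2) / (2 * Real.pi)) (m' x) x := fun x => by
    refine ((hasFDerivAt_comp_normSq (hm.hasDeriv (sq_nonneg ‖x‖))).mul_const
      (2 * Real.pi)⁻¹).congr_fderiv ?_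
    rw [smul_smul]
    congr 1
    ring
  have hp : (0 : ℝ) < 2 * Real.pi := by positivity
  have d0 : DecayBy 1 fun x : Plane => ‖x‖ ^ 1 * |m (‖x‖ ^ 2)| :=
    decayBy_pow_mul (k := 1) (by simpa using hq.angMean_decay) (by norm_num)
  have d0' : DecayBy 2 fun x : Plane => ‖x‖ ^ 0 * |m (‖x‖ ^ 2)| :=
    decayBy_pow_mul (k := 1) (by simpa using hq.angMean_decay) (by norm_num)
  have d1 : DecayBy 2 fun x : Plane => ‖x‖ ^ 2 * |dq m (‖x‖ ^ 2)| :=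
    decayBy_pow_mul (k := 2) hq.dq_angMean_decay (by norm_num)
  refine biotSavart_eq_of_curl (u := fun x => (m (‖x‖ ^ 2) / (2 * Real.pi)) • perp x) (u' := u')
    (fun x => ?_) ?_ ?_ ?_ (fun x => ?_) (fun x => ?_) x
  · have hL : (perpL : Plane → Plane) = perp := funext perpL_apply
    have := (hm' x).smul perpL.hasFDerivAt
    rw [hL] at this
    exact this
  · refine (((continuous_comp_normSq hm.continuousOn).div_const _).smul continuous_const).add ?_
    have hL : Continuous fun p : (Plane →L[ℝ] ℝ) × Plane => p.1.smulRight p.2 :=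
      (ContinuousLinearMap.smulRightL ℝ Plane Plane).continuous₂
    refine hL.comp (Continuous.prodMk ?_ ?_)
    · exact ((continuous_const.mul (continuous_comp_normSq hm.dq.continuousOn)).div_const _).smul
        (innerSL ℝ).continuous
    · have hL : (perpL : Plane → Plane) = perp := funext perpL_apply
      have := perpL.continuous
      rwa [hL] at this
  · have : DecayBy 1 fun x : Plane => (m (‖x‖ ^ 2) / (2 * Real.pi)) • perp x :=
      (d0.const_mul (2 * Real.pi)⁻¹).of_le fun x => by
        rw [norm_smul, norm_perp, norm_div, Real.norm_eq_abs, Real.norm_eq_abs, abs_of_pos hp,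
          pow_one]
        exact le_of_eq (by ring)
    simpa [DecayBy] using this
  · refine ((d0'.const_mul (2 * Real.pi)⁻¹).add (d1.const_mul (2 * (2 * Real.pi)⁻¹))).of_le
      fun x => (norm_add_le _ _).trans (add_le_add ?_ ?_)
    · have h1 : ‖perpL‖ ≤ 1 := ContinuousLinearMap.opNorm_le_bound _ zero_le_one fun v => by
        rw [perpL_apply, norm_perp, one_mul]
      rw [norm_smul, norm_div, Real.norm_eq_abs, Real.norm_eq_abs, abs_of_pos hp, pow_zero, one_mul]
      calc |m (‖x‖ ^ 2)| / (2 * Real.pi) * ‖perpL‖ ≤ |m (‖x‖ ^ 2)| / (2 * Real.pi) * 1 := by gcongr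
        _ = _ := by ring
    · rw [ContinuousLinearMap.norm_smulRight_apply, norm_perp, norm_smul, norm_dotForm, norm_div,
        norm_mul, Real.norm_eq_abs, Real.norm_eq_abs, Real.norm_eq_abs, abs_of_pos hp, abs_two]
      exact le_of_eq (by ring)
  · simp [u', m']
    ring
  · have h2 : ‖x‖ ^ 2 * dq m (‖x‖ ^ 2) = q (‖x‖ ^ 2) - m (‖x‖ ^ 2) := by
      rcases eq_or_lt_of_le (sq_nonneg ‖x‖) with h | h
      · rw [← h]; simp [m, angMean, mean]
      · rw [hq.dq_angMean h.le, mean_succ_dq (n := 0) hq.smoothHalf.one h]; simp [m, angMean]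
    simp [u', m', wStar]
    rw [normSq_eq] at h2 ⊢
    field_simp
    linear_combination 2 * h2

/-! ### Well-behaved vorticities -/

/-- Square integrability against every polynomial multiple of the weight. -/
def PlaneWsq (q : ℝ → ℝ) (f : Plane → ℝ) : Prop :=
  ∀ k : ℕ, Integrable fun x : Plane => (1 + ‖x‖) ^ k * (f x ^ 2 * weight q x)

theorem aestronglyMeasurable_planeWsq {q : ℝ → ℝ} (hq : WeightOK q) {f : Plane → ℝ}
    (hf : AEStronglyMeasurable f volume) (k : ℕ) :
    AEStronglyMeasurable (fun x : Plane => (1 + ‖x‖) ^ k * (f x ^ 2 * weight q x)) volume :=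
  (by fun_prop : Continuous fun x : Plane => (1 + ‖x‖) ^ k).aestronglyMeasurable.mul
    ((hf.pow 2).mul hq.continuous.aestronglyMeasurable)

theorem PlaneWsq.of_le {q : ℝ → ℝ} (hq : WeightOK q) {f g : Plane → ℝ} {c : ℝ} {l : ℕ}
    (hg : PlaneWsq q g) (hf : AEStronglyMeasurable f volume)
    (h : ∀ x, |f x| ≤ c * (1 + ‖x‖) ^ l * |g x|) : PlaneWsq q f := fun k => by
  refine ((hg (k + l * 2)).const_mul (c ^ 2)).mono' (aestronglyMeasurable_planeWsq hq hf k)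
    (Filter.Eventually.of_forall fun x => ?_)
  have hw := hq.pos x
  rw [Real.norm_of_nonneg (by positivity), ← sq_abs (f x), ← sq_abs (g x)]
  calc (1 + ‖x‖) ^ k * (|f x| ^ 2 * weight q x)
      ≤ (1 + ‖x‖) ^ k * ((c * (1 + ‖x‖) ^ l * |g x|) ^ 2 * weight q x) := by gcongr; exact h x
    _ = _ := by rw [pow_add, pow_mul]; ring

theorem PlaneWsq.add {q : ℝ → ℝ} (hq : WeightOK q) {f g : Plane → ℝ} (hf : PlaneWsq q f)
    (hg : PlaneWsq q g) (mf : AEStronglyMeasurable f volume) (mg : AEStronglyMeasurable g volume) :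
    PlaneWsq q fun x => f x + g x := fun k => by
  refine (((hf k).add (hg k)).const_mul 2).mono' (aestronglyMeasurable_planeWsq hq (mf.add mg) k)
    (Filter.Eventually.of_forall fun x => ?_)
  have hw := hq.pos x
  rw [Real.norm_of_nonneg (by positivity)]
  have h1 : (f x + g x) ^ 2 ≤ 2 * f x ^ 2 + 2 * g x ^ 2 := by nlinarith [sq_nonneg (f x - g x)]
  calc (1 + ‖x‖) ^ k * ((f x + g x) ^ 2 * weight q x)
      ≤ (1 + ‖x‖) ^ k * ((2 * f x ^ 2 + 2 * g x ^ 2) * weight q x) := by gcongr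
    _ = _ := by simp only [Pi.add_apply]; ring

theorem WeightedSq.planeWsq {q h : ℝ → ℝ} (hq : WeightOK q) (hh : WeightedSq q h) :
    PlaneWsq q fun x => h (‖x‖ ^ 2) := fun k => by
  have meas : AEStronglyMeasurable (fun x : Plane => h (‖x‖ ^ 2) ^ 2 * weight q x) volume := by
    simpa using (hh 0).aestronglyMeasurable
  refine ((hh k).const_mul (2 ^ k)).mono' ?_ (Filter.Eventually.of_forall fun x => ?_)
  · exact (by fun_prop : Continuous fun x : Plane => (1 + ‖x‖) ^ k).aestronglyMeasurable.mul meas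
  · have hw := hq.pos x
    simp only
    rw [Real.norm_of_nonneg (by positivity), ← mul_assoc (2 ^ k), ← mul_pow]
    have h2 : 1 + ‖x‖ ≤ 2 * (1 + ‖x‖ ^ 2) := by nlinarith [sq_nonneg (‖x‖ - 1)]
    gcongr

theorem DecayBy.integrable {E : Type*} [NormedAddCommGroup E] {f : Plane → E} (hf : DecayBy 3 f)
    (hc : AEStronglyMeasurable f volume) : Integrable f := by
  obtain ⟨C, hC⟩ := hf
  have h1 : Integrable fun x : Plane => (1 + ‖x‖) ^ (-(3 : ℝ)) :=
    integrable_one_add_norm (by simp; norm_num)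
  refine (h1.const_mul C).mono' hc (Filter.Eventually.of_forall fun x => ?_)
  have h2 : (1 + ‖x‖) ^ (-(3 : ℝ)) = ((1 + ‖x‖) ^ 3)⁻¹ := by
    rw [Real.rpow_neg (by positivity)]; norm_cast
  rw [h2, ← div_eq_mul_inv, le_div_iff₀ (by positivity), mul_comm]
  exact hC x

/-- Smooth vorticities which, together with their gradient, decrease rapidly, also with respect to
the weight, and have a continuous velocity field. -/
structure Nice (q : ℝ → ℝ) (ω : Plane → ℝ) : Prop where
  smooth : ContDiff ℝ (⊤ : ℕ∞) ω
  decay : ∀ k, DecayBy k ω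
  decay' : ∀ k, DecayBy k (fderiv ℝ ω)
  wsq : PlaneWsq q ω
  wsq' : PlaneWsq q fun x => ‖fderiv ℝ ω x‖
  vel : Continuous (biotSavart ω)

theorem norm_kernel (c : ℝ) (z : Plane) : ‖(c / ‖z‖ ^ 2) • perp z‖ = |c| * ‖z‖⁻¹ := by
  rw [norm_smul, norm_perp, norm_div, norm_pow, norm_norm, Real.norm_eq_abs]
  rcases eq_or_ne z 0 with rfl | hz
  · simp
  · have := norm_ne_zero_iff.2 hz
    field_simp

theorem measurable_perp : Measurable perp := by
  have : (perp : Plane → Plane) = fun x => perpL x := funext fun x => (perpL_apply x).symm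
  rw [this]; exact perpL.measurable

theorem aestronglyMeasurable_kernel {f : Plane → ℝ} (hf : AEStronglyMeasurable f volume) (x : Plane) :
    AEStronglyMeasurable (fun y => (f y / ‖x - y‖ ^ 2) • perp (x - y)) volume :=
  (hf.mul (by fun_prop : Measurable fun y : Plane => (‖x - y‖ ^ 2)⁻¹).aestronglyMeasurable).smul
    (measurable_perp.comp (measurable_const.sub measurable_id)).aestronglyMeasurable

theorem integrable_kernel {f : Plane → ℝ} {M : ℝ} (hf : Integrable f) (hM : ∀ y, |f y| ≤ M)
    (x : Plane) : Integrable fun y => (f y / ‖x - y‖ ^ 2) • perp (x - y) := by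
  refine (integrable_mul_inv_norm hf hM x).mono (aestronglyMeasurable_kernel hf.1 x)
    (Filter.Eventually.of_forall fun y => ?_)
  rw [norm_kernel, norm_mul, norm_inv, norm_norm, Real.norm_eq_abs]

theorem norm_biotSavart_le {f : Plane → ℝ} {M : ℝ} (hf : Integrable f) (hM : ∀ y, |f y| ≤ M)
    (x : Plane) :
    ‖biotSavart f x‖ ≤ 1 / (2 * Real.pi) * (M * (∫ y, nearKernel y) + ∫ y, |f y|) := by
  rw [biotSavart, norm_smul, Real.norm_of_nonneg (by positivity)]
  gcongr
  refine (norm_integral_le_integral_norm _).trans ?_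
  simp only [norm_kernel]
  exact integral_mul_inv_norm_le hf hM x

theorem biotSavart_add {f g : Plane → ℝ} {x : Plane}
    (hf : Integrable fun y => (f y / ‖x - y‖ ^ 2) • perp (x - y))
    (hg : Integrable fun y => (g y / ‖x - y‖ ^ 2) • perp (x - y)) :
    biotSavart (fun y => f y + g y) x = biotSavart f x + biotSavart g x := by
  simp only [biotSavart, add_div, add_smul]
  rw [integral_add hf hg, smul_add]

theorem biotSavart_const_mul (c : ℝ) (f : Plane → ℝ) (x : Plane) :
    biotSavart (fun y => c * f y) x = c • biotSavart f x := by
  simp only [biotSavart, mul_div_assoc, mul_smul]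
  rw [integral_smul, smul_comm]

namespace Nice

variable {q : ℝ → ℝ} {ω η : Plane → ℝ}

theorem differentiable (h : Nice q ω) : Differentiable ℝ ω := h.smooth.differentiable (by simp)

theorem continuous_fderiv (h : Nice q ω) : Continuous (fderiv ℝ ω) :=
  h.smooth.continuous_fderiv (by simp)

theorem integrable (h : Nice q ω) : Integrable ω :=
  (h.decay 3).integrable h.smooth.continuous.aestronglyMeasurable

theorem exists_bound (h : Nice q ω) : ∃ M, ∀ x, |ω x| ≤ M := by
  obtain ⟨C, hC⟩ := h.decay 0
  exact ⟨C, fun x => by simpa using hC x⟩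

theorem integrable_kernel (h : Nice q ω) (x : Plane) :
    Integrable fun y => (ω y / ‖x - y‖ ^ 2) • perp (x - y) := by
  obtain ⟨M, hM⟩ := h.exists_bound
  exact VortexPair.integrable_kernel h.integrable hM x

theorem exists_vel_bound (h : Nice q ω) : ∃ M, ∀ x, ‖biotSavart ω x‖ ≤ M := by
  obtain ⟨M, hM⟩ := h.exists_bound
  exact ⟨_, fun x => norm_biotSavart_le h.integrable hM x⟩

theorem fderiv_add (h : Nice q ω) (h' : Nice q η) :
    fderiv ℝ (fun x => ω x + η x) = fun x => fderiv ℝ ω x + fderiv ℝ η x :=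
  funext fun x => _root_.fderiv_add (h.differentiable x) (h'.differentiable x)

theorem vel_add (h : Nice q ω) (h' : Nice q η) (x : Plane) :
    biotSavart (fun y => ω y + η y) x = biotSavart ω x + biotSavart η x :=
  biotSavart_add (h.integrable_kernel x) (h'.integrable_kernel x)

theorem add (hq : WeightOK q) (h : Nice q ω) (h' : Nice q η) : Nice q fun x => ω x + η x where
  smooth := h.smooth.add h'.smooth
  decay k := (h.decay k).add (h'.decay k)
  decay' k := by
    rw [h.fderiv_add h']
    have e : ∀ {f : Plane → Plane →L[ℝ] ℝ}, DecayBy k f → DecayBy k fun x => ‖f x‖ :=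
      fun h => h.mono fun x => by rw [norm_norm]
    exact ((e (h.decay' k)).add (e (h'.decay' k))).of_le fun x => norm_add_le _ _
  wsq := h.wsq.add hq h'.wsq h.smooth.continuous.aestronglyMeasurable
    h'.smooth.continuous.aestronglyMeasurable
  wsq' := by
    rw [h.fderiv_add h']
    refine PlaneWsq.of_le (c := 1) (l := 0) hq (h.wsq'.add hq h'.wsq' h.continuous_fderiv.norm.aestronglyMeasurable
      h'.continuous_fderiv.norm.aestronglyMeasurable)
      (h.continuous_fderiv.add h'.continuous_fderiv).norm.aestronglyMeasurable fun x => ?_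
    rw [abs_norm, pow_zero, one_mul, one_mul]
    exact (norm_add_le _ _).trans (le_abs_self _)
  vel := by
    rw [show biotSavart (fun x => ω x + η x) = fun x => biotSavart ω x + biotSavart η x from
      funext (h.vel_add h')]
    exact h.vel.add h'.vel

theorem inX (h : Nice q ω) : InX q ω := by
  refine ⟨?_, by simpa using h.wsq 0⟩
  rw [memLp_two_iff_integrable_sq h.smooth.continuous.aestronglyMeasurable]
  obtain ⟨C, hC⟩ := h.decay 3
  obtain ⟨M, hM⟩ := h.exists_bound
  refine DecayBy.integrable ⟨C * M, fun x => ?_⟩ (h.smooth.continuous.pow 2).aestronglyMeasurable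
  rw [norm_pow, pow_two, ← mul_assoc]
  exact mul_le_mul (hC x) (hM x) (norm_nonneg _) ((by positivity : (0:ℝ) ≤ _).trans (hC x))

end Nice

theorem Adm.nice {q b : ℝ → ℝ} (hq : WeightOK q) (hb : Adm q b) (n : ℕ) (ζ : ℂ)
    (hc : Continuous (biotSavart (mode n ζ b))) : Nice q (mode n ζ b) := by
  have hfd : fderiv ℝ (mode n ζ b) = modeDeriv n ζ b (dq b) :=
    funext fun x => (hb.smooth.hasFDerivAt_mode n ζ x).fderiv
  have c0 := hb.smooth.continuousOn
  have c1 := hb.smooth.dq.continuousOn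
  have wpow : ∀ {h : ℝ → ℝ}, ContinuousOn h (Set.Ici 0) → WeightedSq q h → ∀ (c : ℝ) (a : ℕ),
      PlaneWsq q fun x => c * (‖x‖ ^ a * |h (‖x‖ ^ 2)|) := fun {h} hh hw c a => by
    refine PlaneWsq.of_le (c := |c|) (l := a) hq (hw.planeWsq hq)
      (continuous_const.mul ((continuous_norm.pow a).mul
        (continuous_comp_normSq hh).abs)).aestronglyMeasurable fun x => ?_
    rw [abs_mul, abs_mul, abs_abs, abs_of_nonneg (by positivity : 0 ≤ ‖x‖ ^ a), ← mul_assoc]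
    gcongr
    linarith
  refine ⟨contDiff_mode n ζ hb.smooth, fun k => ?_, fun k => ?_, ?_, ?_, hc⟩
  · exact ((decayBy_pow_mul (a := n) (j := k) (hb.rapid (n + k)) (by omega)).const_mul ‖ζ‖).of_le
      fun x => abs_mode_le n ζ b x
  · rw [hfd]
    exact (((decayBy_pow_mul (a := n - 1) (j := k) (hb.rapid (n + k)) (by omega)).const_mul
      (‖ζ‖ * n)).add ((decayBy_pow_mul (a := n + 1) (j := k) (hb.rapid' (n + 1 + k))
      (by omega)).const_mul (2 * ‖ζ‖))).of_le fun x => norm_modeDeriv_le n ζ b _ x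
  · refine PlaneWsq.of_le (c := 1) (l := 0) hq (wpow c0 hb.wsq ‖ζ‖ n)
      (continuous_mode c0).aestronglyMeasurable fun x => ?_
    rw [pow_zero, one_mul, one_mul]
    exact (abs_mode_le n ζ b x).trans (le_abs_self _)
  · rw [hfd]
    have m : ∀ {h : ℝ → ℝ} (_ : ContinuousOn h (Set.Ici 0)) (c : ℝ) (a : ℕ),
        AEStronglyMeasurable (fun x : Plane => c * (‖x‖ ^ a * |h (‖x‖ ^ 2)|)) volume :=
      fun hh c a => (continuous_const.mul ((continuous_norm.pow a).mul
        (continuous_comp_normSq hh).abs)).aestronglyMeasurable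
    refine PlaneWsq.of_le (c := 1) (l := 0) hq ((wpow c0 hb.wsq (‖ζ‖ * n) (n - 1)).add hq
      (wpow c1 hb.wsq' (2 * ‖ζ‖) (n + 1)) (m c0 _ _) (m c1 _ _))
      (continuous_modeDeriv c0 c1).norm.aestronglyMeasurable fun x => ?_
    rw [pow_zero, one_mul, one_mul, abs_norm]
    exact (norm_modeDeriv_le n ζ b _ x).trans (le_abs_self _)

theorem RadialSolution.nice {q : ℝ → ℝ} (hq : WeightOK q) {n : ℕ} (hn : 2 ≤ n) {φ α b : ℝ → ℝ}
    (hs : RadialSolution q n φ α b) (ζ : ℂ) : Nice q (mode n ζ b) :=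
  hs.adm.nice hq n ζ (by
    rw [show biotSavart (mode n ζ b) = modeVel n ζ α (dq α) from funext (biotSavart_mode hn hs ζ)]
    exact continuous_modeVel hs.smooth.continuousOn hs.smooth.dq.continuousOn)

theorem wStar_eq_mode (q : ℝ → ℝ) : wStar q = mode 0 1 fun s => Real.pi⁻¹ * q s := by
  funext x
  simp [wStar, mode]; ring

theorem continuous_vStar {q : ℝ → ℝ} (hq : AdmissibleProfile q) : Continuous (vStar q) := by
  rw [show vStar q = _ from funext (vStar_eq hq)]
  have : Continuous fun x : Plane => perpL x := perpL.continuous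
  simp only [perpL_apply] at this
  exact ((continuous_comp_normSq hq.smooth_angMean.continuousOn).div_const _).smul this

theorem nice_wStar {q : ℝ → ℝ} (hq : AdmissibleProfile q) : Nice q (wStar q) := by
  have h := continuous_vStar hq
  rw [vStar, wStar_eq_mode] at h
  rw [wStar_eq_mode]
  exact (hq.adm_q.const_mul hq.weightOK _).nice hq.weightOK 0 1 h

/-! ### The linearized operator on modes -/

/-- The pointwise equation `v_* · ∇ω + K[ω] · ∇w_* = f`. -/
def LambdaPt (q : ℝ → ℝ) (ω f : Plane → ℝ) : Prop :=
  ∀ x, fderiv ℝ ω x (vStar q x) + fderiv ℝ (wStar q) x (biotSavart ω x) = f x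

theorem LambdaPt.add {q : ℝ → ℝ} {ω η f g : Plane → ℝ} (hω : Nice q ω) (hη : Nice q η)
    (h : LambdaPt q ω f) (h' : LambdaPt q η g) :
    LambdaPt q (fun x => ω x + η x) fun x => f x + g x := fun x => by
  have h1 := h x
  have h2 := h' x
  rw [hω.fderiv_add hη, hω.vel_add hη, map_add]
  simp only [add_apply]
  rw [← h1, ← h2]
  ring

/-- Transport by v_* multiplies a mode by i n m/2π, and the nonlocal term is the same rotation
applied to the stream function with factor 2q'/π. The potential V is defined so that the two cancel
on the part Vα of b, leaving only φ. -/
theorem lambdaPt_mode {q : ℝ → ℝ} (hq : AdmissibleProfile q) {n : ℕ} (hn : 2 ≤ n) {φ α b : ℝ → ℝ}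
    (hs : RadialSolution q n φ α b) (ζ : ℂ) :
    LambdaPt q (mode n ζ b) (mode n (Complex.I * ζ)
      fun s => n / (2 * Real.pi) * (angMean q s * φ s)) := fun x => by
  have hpow : (n : ℂ) * zc x ^ (n - 1) * zc x = n * zc x ^ n := by
    rw [mul_assoc, ← pow_succ, Nat.sub_add_cancel (by omega)]
  have hre := congrArg Complex.re (congrArg (fun w => ζ * w) hpow)
  have him := congrArg Complex.im (congrArg (fun w => ζ * w) hpow)
  have hb := hs.eq (‖x‖ ^ 2) (sq_nonneg _)
  have hν := hq.invMean_mul (sq_nonneg ‖x‖)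
  rw [(hs.adm.smooth.hasFDerivAt_mode n ζ x).fderiv, (fderiv_wStar hq x).fderiv, vStar_eq hq,
    biotSavart_mode hn hs ζ, modeDeriv_apply]
  obtain ⟨c, hc⟩ : ∃ c, c = angMean q (‖x‖ ^ 2) / (2 * Real.pi) := ⟨_, rfl⟩
  have hc2 : n / (2 * Real.pi) * (angMean q (‖x‖ ^ 2) * φ (‖x‖ ^ 2)) = n * (c * φ (‖x‖ ^ 2)) := by
    rw [hc]; ring
  have hb' : c * b (‖x‖ ^ 2) = -(2 * dq q (‖x‖ ^ 2) / Real.pi * α (‖x‖ ^ 2))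
      + c * φ (‖x‖ ^ 2) := by
    rw [hb, hc, potential]
    field_simp
    linear_combination (-4 * dq q (‖x‖ ^ 2) * α (‖x‖ ^ 2)) * hν
  simp only [modeVel, mode] at hre him ⊢
  rw [hc2, ← hc]
  generalize 2 * dq q (‖x‖ ^ 2) / Real.pi = p at *
  simp at hre him ⊢
  linear_combination (-(c * b (‖x‖ ^ 2) + p * α (‖x‖ ^ 2))) * him
    - n * (ζ.re * (zc x ^ n).im + ζ.im * (zc x ^ n).re) * hb'

end VortexPair

namespace VortexPair

/-! ### The weighted space -/

theorem exists_inv_weight_bound {q : ℝ → ℝ} (hq : AdmissibleProfile q) :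
    ∃ C, ∀ x : Plane, 1 ≤ C * weight q x := by
  obtain ⟨C, hC⟩ := hq.rapid_dq.bound
  refine ⟨C, fun x => ?_⟩
  have h1 := hq.decreasing _ (sq_nonneg ‖x‖)
  have h2 := hC _ (sq_nonneg ‖x‖)
  rw [abs_of_neg h1] at h2
  rw [weight, ← mul_div_assoc, mul_neg_one, le_div_iff_of_neg h1]
  linarith

theorem integrable_inv_weight {q : ℝ → ℝ} (hq : AdmissibleProfile q) :
    Integrable fun x : Plane => (weight q x)⁻¹ := by
  have h := integrable_comp_normSq (hq.rapid_dq.integrableOn hq.smoothHalf.dq.continuousOn)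
  refine h.neg.congr (Filter.Eventually.of_forall fun x => ?_)
  simp [weight, div_neg]

theorem inX_of_integrable {q : ℝ → ℝ} (hq : AdmissibleProfile q) {f : Plane → ℝ}
    (hf : AEStronglyMeasurable f volume) (h : Integrable fun x => f x ^ 2 * weight q x) :
    InX q f := by
  refine ⟨(memLp_two_iff_integrable_sq hf).2 ?_, h⟩
  obtain ⟨C, hC⟩ := exists_inv_weight_bound hq
  refine (h.const_mul C).mono' (hf.pow 2) (Filter.Eventually.of_forall fun x => ?_)
  rw [Real.norm_of_nonneg (sq_nonneg _)]
  nlinarith [hC x, sq_nonneg (f x)]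

theorem PlaneWsq.inX {q : ℝ → ℝ} (hq : AdmissibleProfile q) {f : Plane → ℝ}
    (hf : AEStronglyMeasurable f volume) (h : PlaneWsq q f) : InX q f :=
  inX_of_integrable hq hf (by simpa using h 0)

theorem InX.integrable_mul {q : ℝ → ℝ} (hq : WeightOK q) {f g : Plane → ℝ} (hf : InX q f)
    (hg : InX q g) : Integrable fun x => f x * g x * weight q x := by
  refine (hf.2.add hg.2).mono' ((hf.1.1.mul hg.1.1).mul hq.continuous.aestronglyMeasurable)
    (Filter.Eventually.of_forall fun x => ?_)
  have hw := hq.pos x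
  rw [norm_mul, Real.norm_of_nonneg hw.le, Real.norm_eq_abs]
  simp only [Pi.add_apply]
  rw [← add_mul]
  gcongr
  rw [abs_le]
  constructor <;> nlinarith [sq_nonneg (f x + g x), sq_nonneg (f x - g x), sq_nonneg (f x), sq_nonneg (g x)]

/-- By the arithmetic-geometric mean inequality |f| ≤ f²p + 1/p, and 1/p = -q' is integrable over
the plane. Being in L¹ is what makes the Biot-Savart integral meaningful almost everywhere on X. -/
theorem InX.integrable {q : ℝ → ℝ} (hq : AdmissibleProfile q) {f : Plane → ℝ} (hf : InX q f) :
    Integrable f := by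
  refine (hf.2.add (integrable_inv_weight hq)).mono' hf.1.1 (Filter.Eventually.of_forall fun x => ?_)
  have hw := hq.weightOK.pos x
  simp only [Pi.add_apply]
  rw [Real.norm_eq_abs]
  have h1 : 0 < (weight q x)⁻¹ := inv_pos.2 hw
  have h2 : weight q x * (weight q x)⁻¹ = 1 := mul_inv_cancel₀ hw.ne'
  set a := weight q x
  set b := a⁻¹
  have h3 : f x ^ 2 * a + b = b * ((f x * a) ^ 2 + 1) := by
    linear_combination -(f x ^ 2 * a) * h2
  have h4 : |f x| = b * |f x * a| := by
    rw [abs_mul, abs_of_pos hw]; linear_combination -|f x| * h2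
  rw [h3, h4]
  gcongr
  nlinarith [sq_abs (f x * a), sq_nonneg (|f x * a| - 1), abs_nonneg (f x * a)]

theorem InX.sub {q : ℝ → ℝ} (hq : AdmissibleProfile q) {f g : Plane → ℝ} (hf : InX q f)
    (hg : InX q g) : InX q fun x => f x - g x := by
  refine inX_of_integrable hq (hf.1.1.sub hg.1.1) ?_
  refine ((hf.2.add hg.2).sub ((hf.integrable_mul hq.weightOK hg).const_mul 2)).congr
    (Filter.Eventually.of_forall fun x => ?_)
  simp only [Pi.sub_apply, Pi.add_apply]
  ring

theorem InX.congr {q : ℝ → ℝ} {f g : Plane → ℝ} (hf : InX q f) (h : f =ᵐ[volume] g) : InX q g :=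
  ⟨hf.1.ae_eq h, hf.2.congr (h.mono fun x hx => by simp only [hx])⟩

/-! ### Transport along the radial profile -/

theorem fderiv_vec (L : Plane →L[ℝ] ℝ) (a b : ℝ) :
    L (vec a b) = a * L !₂[1, 0] + b * L !₂[0, 1] := by
  rw [vec, map_add, map_smul, map_smul, smul_eq_mul, smul_eq_mul]

theorem vStar_eq_vec {q : ℝ → ℝ} (hq : AdmissibleProfile q) (x : Plane) :
    vStar q x = vec (-(angMean q (‖x‖ ^ 2) / (2 * Real.pi) * x 1))
      (angMean q (‖x‖ ^ 2) / (2 * Real.pi) * x 0) := by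
  rw [vStar_eq hq]
  apply plane_ext <;> simp [-Complex.ofReal_div]

theorem exists_vStar_bound {q : ℝ → ℝ} (hq : AdmissibleProfile q) : ∃ M, ∀ x, ‖vStar q x‖ ≤ M :=
  (nice_wStar hq).exists_vel_bound

/-- Integration by parts in each coordinate; the terms in which the angular velocity is
differentiated cancel because v_* is divergence free. -/
theorem hasWeakTransport_of_contDiff {q : ℝ → ℝ} (hq : AdmissibleProfile q) {ω : Plane → ℝ}
    (hω : ContDiff ℝ 1 ω) : HasWeakTransport (vStar q) ω fun x => fderiv ℝ ω x (vStar q x) := by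
  intro χ hχ hs
  have hχ1 : Differentiable ℝ χ := hχ.differentiable (by simp)
  have hω1 : Differentiable ℝ ω := hω.differentiable (by simp)
  have hm := hq.smooth_angMean
  let c : Plane → ℝ := fun x => angMean q (‖x‖ ^ 2) / (2 * Real.pi)
  let k : Plane → ℝ := fun x => 2 * dq (angMean q) (‖x‖ ^ 2) / (2 * Real.pi)
  have cc : Continuous c := (continuous_comp_normSq hm.continuousOn).div_const _
  have ck : Continuous k :=
    (continuous_const.mul (continuous_comp_normSq hm.dq.continuousOn)).div_const _
  have cω := hω.continuous
  have cω' : ∀ e : Plane, Continuous fun x => fderiv ℝ ω x e := fun e =>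
    (hω.continuous_fderiv (by simp)).clm_apply continuous_const
  have cχ' : ∀ e : Plane, Continuous fun x => fderiv ℝ χ x e := fun e =>
    (hχ.continuous_fderiv (by simp)).clm_apply continuous_const
  have hc : ∀ x, HasFDerivAt c (k x • dotForm x) x := fun x => by
    refine ((hasFDerivAt_comp_normSq (hm.hasDeriv (sq_nonneg ‖x‖))).mul_const
      (2 * Real.pi)⁻¹).congr_fderiv ?_
    rw [smul_smul]
    congr 1
    simp only [k]
    ring
  let g : Fin 2 → Plane → ℝ := fun j x => ω x * (c x * x j)
  let G : Fin 2 → Plane → Plane →L[ℝ] ℝ := fun j x =>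
    ω x • (c x • coordForm j + x j • (k x • dotForm x)) + (c x * x j) • fderiv ℝ ω x
  have hg : ∀ j x, HasFDerivAt (g j) (G j x) x := fun j x =>
    (hω1 x).hasFDerivAt.mul ((hc x).mul (coordForm j).hasFDerivAt)
  have cg : ∀ j, Continuous (g j) := fun j => cω.mul (cc.mul (coordForm j).continuous)
  have cG : ∀ j (e : Plane), Continuous fun x => G j x e := fun j e => by
    simp only [G, add_apply, smul_apply, smul_eq_mul, coordForm_apply, dotForm_apply]
    have c0 : ∀ i : Fin 2, Continuous fun x : Plane => x i := fun i => (coordForm i).continuous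
    exact (cω.mul ((cc.mul continuous_const).add ((c0 j).mul (ck.mul (((c0 0).mul
      continuous_const).add ((c0 1).mul continuous_const)))))).add ((cc.mul (c0 j)).mul (cω' e))
  have sχ' : ∀ e : Plane, HasCompactSupport fun x => fderiv ℝ χ x e := fun e => hs.fderiv_apply ℝ e
  have parts : ∀ j (e : Plane), ∫ x, g j x * fderiv ℝ χ x e = -∫ x, G j x e * χ x := fun j e => by
    have hfd : ∀ x, fderiv ℝ (g j) x = G j x := fun x => (hg j x).fderiv
    have := integral_mul_fderiv_eq_neg_fderiv_mul_of_integrable (μ := volume) (f := g j) (g := χ)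
      (v := e) ?_ ?_ ?_ (fun x _ => (hg j x).differentiableAt) (fun x _ => hχ1 x)
    · simpa only [hfd] using this
    · simp only [hfd]
      exact ((cG j e).mul hχ.continuous).integrable_of_hasCompactSupport hs.mul_left
    · exact ((cg j).mul (cχ' e)).integrable_of_hasCompactSupport (sχ' e).mul_left
    · exact ((cg j).mul hχ.continuous).integrable_of_hasCompactSupport hs.mul_left
  have i1 : ∀ j (e : Plane), Integrable fun x => g j x * fderiv ℝ χ x e := fun j e =>
    ((cg j).mul (cχ' e)).integrable_of_hasCompactSupport (sχ' e).mul_left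
  have i2 : ∀ j (e : Plane), Integrable fun x => G j x e * χ x := fun j e =>
    ((cG j e).mul hχ.continuous).integrable_of_hasCompactSupport hs.mul_left
  have e1 : ∀ x, ω x * fderiv ℝ χ x (vStar q x)
      = g 0 x * fderiv ℝ χ x !₂[0, 1] - g 1 x * fderiv ℝ χ x !₂[1, 0] := fun x => by
    rw [vStar_eq_vec hq, fderiv_vec]
    simp only [g, c]
    ring
  have e2 : ∀ x, fderiv ℝ ω x (vStar q x) * χ x
      = G 0 x !₂[0, 1] * χ x - G 1 x !₂[1, 0] * χ x := fun x => by
    rw [vStar_eq_vec hq, fderiv_vec]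
    simp [G, c]
    ring
  simp only [e1, e2]
  rw [integral_sub (i1 _ _) (i1 _ _), integral_sub (i2 _ _) (i2 _ _), parts, parts]
  ring

theorem Nice.inX_transport {q : ℝ → ℝ} (hq : AdmissibleProfile q) {ω : Plane → ℝ}
    (hω : Nice q ω) : InX q fun x => fderiv ℝ ω x (vStar q x) := by
  obtain ⟨M, hM⟩ := exists_vStar_bound hq
  have hm : AEStronglyMeasurable (fun x => fderiv ℝ ω x (vStar q x)) volume :=
    (hω.continuous_fderiv.clm_apply (continuous_vStar hq)).aestronglyMeasurable
  refine (hω.wsq'.of_le (c := M) (l := 0) hq.weightOK hm fun x => ?_).inX hq hm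
  rw [pow_zero, mul_one, abs_norm, mul_comm]
  exact ((fderiv ℝ ω x).le_opNorm _).trans (by gcongr; exact hM x)

theorem lambdaEq_of_lambdaPt {q : ℝ → ℝ} (hq : AdmissibleProfile q) {ω f : Plane → ℝ}
    (hω : Nice q ω) (h : LambdaPt q ω f) : LambdaEq q ω f := by
  exact ⟨hω.inX, _, hω.inX_transport hq, hasWeakTransport_of_contDiff hq (hω.smooth.of_le (by norm_cast)), Filter.Eventually.of_forall h⟩

/-- The transport term is formally skew-symmetric with respect to every radial weight. -/
theorem integral_transport_weight {q : ℝ → ℝ} (hq : AdmissibleProfile q) {η κ h : Plane → ℝ}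
    (hη : Nice q η) (hκ : InX q κ) (hh : InX q h) (hw : HasWeakTransport (vStar q) κ h) :
    ∫ x, κ x * fderiv ℝ η x (vStar q x) * weight q x = -∫ x, h x * η x * weight q x := by
  let p : ℝ → ℝ := fun s => -1 / dq q s
  have hp : SmoothHalf p := ContDiffOn.div contDiffOn_const hq.smoothHalf.dq
    fun s hs => (hq.decreasing s hs).ne
  -- The test functions are the cutoff times the weight times η. Cutoff and weight are functions of
  -- |x|², so differentiation along v_* touches only η, and dominated convergence removes the
  -- cutoff.
  let T : ℕ → ℝ → ℝ := fun R s => Real.smoothTransition (R - s)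
  have hT : ∀ R, SmoothHalf (T R) := fun R =>
    (Real.smoothTransition.contDiff.comp (contDiff_const.sub contDiff_id)).contDiffOn
  have hTp : ∀ R, SmoothHalf fun s => T R s * p s := fun R => (hT R).mul hp
  have T1 : ∀ R s, |T R s| ≤ 1 := fun R s => by
    rw [abs_of_nonneg (Real.smoothTransition.nonneg _)]; exact Real.smoothTransition.le_one _
  have Tlim : ∀ s, Filter.Tendsto (fun R => T R s) Filter.atTop (nhds 1) := fun s => by
    refine tendsto_const_nhds.congr' ?_
    obtain ⟨N, hN⟩ := exists_nat_ge (s + 1)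
    filter_upwards [Filter.eventually_ge_atTop N] with R hR
    have : (N : ℝ) ≤ R := by exact_mod_cast hR
    exact (Real.smoothTransition.one_of_one_le (by linarith)).symm
  have key : ∀ R : ℕ, ∫ x, T R (‖x‖ ^ 2) * (κ x * fderiv ℝ η x (vStar q x) * weight q x)
      = -∫ x, T R (‖x‖ ^ 2) * (h x * η x * weight q x) := fun R => by
    have := hw (fun x => T R (‖x‖ ^ 2) * p (‖x‖ ^ 2) * η x)
      ((contDiff_comp_normSq (hTp R)).mul hη.smooth) ?_
    · refine Eq.trans ?_ (this.trans ?_)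
      · refine integral_congr_ae (Filter.Eventually.of_forall fun x => ?_)
        have hd := ((hasFDerivAt_comp_normSq ((hTp R).hasDeriv (sq_nonneg ‖x‖))).mul
          (hη.differentiable x).hasFDerivAt).fderiv
        simp only
        refine Eq.trans ?_ (congrArg (fun L : Plane →L[ℝ] ℝ => κ x * L (vStar q x)) hd).symm
        have h0 : dotForm x (vStar q x) = 0 := by
          rw [vStar_eq_vec hq]; simp; ring
        simp only [add_apply, smul_apply, smul_eq_mul, h0]
        simp only [weight, p]
        ring
      · congr 1
        refine integral_congr_ae (Filter.Eventually.of_forall fun x => ?_)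
        simp only [weight, p]
        ring
    · refine HasCompactSupport.intro (isCompact_closedBall (0 : Plane) R) fun x hx => ?_
      rw [mem_closedBall_zero_iff, not_le] at hx
      have h0 : (0 : ℝ) ≤ R := Nat.cast_nonneg R
      have : T R (‖x‖ ^ 2) = 0 := Real.smoothTransition.zero_of_nonpos (by
        rcases Nat.eq_zero_or_pos R with h1 | h1
        · rw [h1]; simp
        · have : (1 : ℝ) ≤ R := by exact_mod_cast h1
          nlinarith)
      simp [this]
  have lim : ∀ F : Plane → ℝ, Integrable F → Filter.Tendsto
      (fun R : ℕ => ∫ x, T R (‖x‖ ^ 2) * F x) Filter.atTop (nhds (∫ x, F x)) := fun F hF => by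
    refine tendsto_integral_of_dominated_convergence (fun x => |F x|) (fun R => ?_) hF.abs
      (fun R => Filter.Eventually.of_forall fun x => ?_) (Filter.Eventually.of_forall fun x => ?_)
    · exact (continuous_comp_normSq (hT R).continuousOn).aestronglyMeasurable.mul hF.1
    · rw [norm_mul, Real.norm_eq_abs, Real.norm_eq_abs]
      exact mul_le_of_le_one_left (abs_nonneg _) (T1 _ _)
    · simpa using (Tlim (‖x‖ ^ 2)).mul_const (F x)
  have l1 := lim _ (hκ.integrable_mul hq.weightOK (hη.inX_transport hq))
  have l2 := lim _ (hh.integrable_mul hq.weightOK hη.inX)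
  simp only [key] at l1
  exact tendsto_nhds_unique l1 l2.neg

end VortexPair

namespace VortexPair

/-! ### Skew-symmetry of the Biot-Savart term -/

theorem dotForm_kernel (c : ℝ) (x y : Plane) :
    dotForm x ((c / ‖x - y‖ ^ 2) • perp (x - y)) = c * ((x 0 * y 1 - x 1 * y 0) / ‖x - y‖ ^ 2) := by
  rw [map_smul, dotForm_apply, perp_zero_coord, perp_one_coord]
  simp only [PiLp.sub_apply, smul_eq_mul]
  ring

/-- A kernel element is only known to be in L¹. Its convolution with the near part of the kernel
exists almost everywhere, and the far part is bounded. -/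
theorem ae_integrable_kernel {κ : Plane → ℝ} (hκ : Integrable κ) :
    ∀ᵐ x : Plane, Integrable fun y => (κ y / ‖x - y‖ ^ 2) • perp (x - y) := by
  filter_upwards [hκ.ae_convolution_exists (ContinuousLinearMap.mul ℝ ℝ) integrable_nearKernel]
    with x hx
  have h1 : Integrable fun y => κ y * nearKernel (x - y) := hx
  refine (h1.abs.add hκ.abs).mono' (aestronglyMeasurable_kernel hκ.1 x)
    (Filter.Eventually.of_forall fun y => ?_)
  rw [norm_kernel]
  simp only [Pi.add_apply]
  rw [abs_mul, abs_of_nonneg (nearKernel_nonneg _)]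
  calc |κ y| * ‖x - y‖⁻¹ ≤ |κ y| * (nearKernel (x - y) + 1) := by gcongr; exact inv_norm_le _
    _ = _ := by ring

theorem dotForm_biotSavart {κ : Plane → ℝ} {x : Plane}
    (h : Integrable fun y => (κ y / ‖x - y‖ ^ 2) • perp (x - y)) :
    2 * Real.pi * dotForm x (biotSavart κ x)
      = ∫ y, κ y * ((x 0 * y 1 - x 1 * y 0) / ‖x - y‖ ^ 2) := by
  rw [biotSavart, map_smul, ← ContinuousLinearMap.integral_comp_comm _ h]
  simp only [dotForm_kernel]
  rw [smul_eq_mul, ← mul_assoc, mul_one_div_cancel (by positivity), one_mul]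

/-- The kernel x·(x - y)^⊥/|x - y|² = (x₁y₂ - x₂y₁)/|x - y|² is antisymmetric, so exchanging the
integrals changes the sign. The decay of η makes the double integral absolutely convergent. -/
theorem integral_dotForm_skew {q : ℝ → ℝ} {η κ : Plane → ℝ} (hη : Nice q η) (hκ : Integrable κ) :
    ∫ x, η x * dotForm x (biotSavart κ x) = -∫ x, κ x * dotForm x (biotSavart η x) := by
  let k : Plane → Plane → ℝ := fun x y => (x 0 * y 1 - x 1 * y 0) / ‖x - y‖ ^ 2
  let F : Plane → Plane → ℝ := fun x y => η x * (κ y * k x y)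
  have k_le : ∀ x y, |k x y| ≤ ‖x‖ * (nearKernel (x - y) + 1) := fun x y => by
    have e : k x y = dotForm x ((1 / ‖x - y‖ ^ 2) • perp (x - y)) := by
      rw [dotForm_kernel, one_mul]
    rw [e]
    refine ((dotForm x).le_opNorm _).trans ?_
    rw [norm_dotForm, norm_kernel, abs_one, one_mul]
    gcongr
    exact inv_norm_le _
  have hf : Integrable fun x : Plane => |η x| * ‖x‖ := by
    obtain ⟨C, hC⟩ := hη.decay 4
    refine DecayBy.integrable ⟨C, fun x => ?_⟩
      (hη.smooth.continuous.abs.mul continuous_norm).aestronglyMeasurable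
    rw [Real.norm_of_nonneg (by positivity)]
    refine le_trans ?_ (hC x)
    rw [Real.norm_eq_abs]
    have := norm_nonneg x
    calc (1 + ‖x‖) ^ 3 * (|η x| * ‖x‖) ≤ (1 + ‖x‖) ^ 3 * (|η x| * (1 + ‖x‖)) := by gcongr; linarith
      _ = _ := by ring
  obtain ⟨M, hM⟩ : ∃ M, ∀ x, |η x| * ‖x‖ ≤ M := by
    obtain ⟨C, hC⟩ := hη.decay 1
    refine ⟨C, fun x => le_trans ?_ (hC x)⟩
    rw [Real.norm_eq_abs, pow_one, mul_comm]
    gcongr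
    linarith
  have hF : Integrable (Function.uncurry F) (volume.prod volume) := by
    have c1 := (hκ.abs.convolution_integrand (ContinuousLinearMap.mul ℝ ℝ) integrable_nearKernel)
    have c2 := hf.mul_prod hκ.abs
    refine ((c1.const_mul M).add c2).mono' ?_ (Filter.Eventually.of_forall fun p => ?_)
    · refine hη.smooth.continuous.aestronglyMeasurable.comp_fst.mul (hκ.1.comp_snd.mul ?_)
      have hcoord : ∀ i : Fin 2, Measurable fun x : Plane => x i := fun i =>
        (coordForm i).continuous.measurable
      exact ((((hcoord 0).comp measurable_fst).mul ((hcoord 1).comp measurable_snd)).sub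
        (((hcoord 1).comp measurable_fst).mul ((hcoord 0).comp measurable_snd))).div
        ((measurable_fst.sub measurable_snd).norm.pow_const 2) |>.aestronglyMeasurable
    · obtain ⟨x, y⟩ := p
      have h2 := nearKernel_nonneg (x - y)
      simp only [Function.uncurry, F, Pi.add_apply, ContinuousLinearMap.mul_apply']
      rw [norm_mul, norm_mul, Real.norm_eq_abs, Real.norm_eq_abs, Real.norm_eq_abs]
      calc |η x| * (|κ y| * |k x y|) ≤ |η x| * (|κ y| * (‖x‖ * (nearKernel (x - y) + 1))) := by
            gcongr; exact k_le x y
        _ = (|η x| * ‖x‖) * (|κ y| * nearKernel (x - y)) + |η x| * ‖x‖ * |κ y| := by ring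
        _ ≤ _ := by gcongr; exact hM x
  have hswap := integral_integral_swap hF
  have e1 : ∫ x, ∫ y, F x y = 2 * Real.pi * ∫ x, η x * dotForm x (biotSavart κ x) := by
    rw [← integral_const_mul]
    refine integral_congr_ae ?_
    filter_upwards [ae_integrable_kernel hκ] with x hx
    simp only [F]
    rw [integral_const_mul, ← dotForm_biotSavart hx]
    ring
  have e2 : ∫ y, ∫ x, F x y = -(2 * Real.pi * ∫ x, κ x * dotForm x (biotSavart η x)) := by
    rw [← integral_const_mul, ← integral_neg]
    refine integral_congr_ae (Filter.Eventually.of_forall fun y => ?_)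
    simp only
    have e3 : ∀ x, F x y = -κ y * (η x * ((y 0 * x 1 - y 1 * x 0) / ‖y - x‖ ^ 2)) := fun x => by
      simp only [F, k]
      rw [norm_sub_rev x y]
      ring
    simp only [e3]
    rw [integral_const_mul, ← dotForm_biotSavart (hη.integrable_kernel y)]
    ring
  rw [e1, e2] at hswap
  have hp : (2 * Real.pi) ≠ 0 := by positivity
  apply mul_left_cancel₀ hp
  rw [hswap]
  ring

/-- This is the point of the choice p = -1/q': the weight cancels q' in ∇w_*, leaving a multiple of
x. -/
theorem fderiv_wStar_mul_weight {q : ℝ → ℝ} (hq : AdmissibleProfile q) (x u : Plane) :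
    fderiv ℝ (wStar q) x u * weight q x = -(2 / Real.pi) * dotForm x u := by
  have h1 := (hq.decreasing _ (sq_nonneg ‖x‖)).ne
  rw [(fderiv_wStar hq x).fderiv, smul_apply, smul_eq_mul, weight]
  have := Real.pi_ne_zero
  field_simp

theorem Nice.inX_stretch {q : ℝ → ℝ} (hq : AdmissibleProfile q) {η : Plane → ℝ} (hη : Nice q η) :
    InX q fun x => fderiv ℝ (wStar q) x (biotSavart η x) := by
  obtain ⟨M, hM⟩ := hη.exists_vel_bound
  have hm : AEStronglyMeasurable (fun x => fderiv ℝ (wStar q) x (biotSavart η x)) volume :=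
    ((nice_wStar hq).continuous_fderiv.clm_apply hη.vel).aestronglyMeasurable
  refine ((nice_wStar hq).wsq'.of_le (c := M) (l := 0) hq.weightOK hm fun x => ?_).inX hq hm
  rw [pow_zero, mul_one, abs_norm, mul_comm]
  exact ((fderiv ℝ (wStar q) x).le_opNorm _).trans (by gcongr; exact hM x)

/-- The range of `Λ` is orthogonal to its kernel. -/
theorem perpKer_of_lambdaPt {q : ℝ → ℝ} (hq : AdmissibleProfile q) {η ω : Plane → ℝ}
    (hη : Nice q η) (h : LambdaPt q η ω) : PerpKer q ω := by
  rintro κ ⟨hκ, g, hg, hw, hae⟩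
  have i1 := hκ.integrable_mul hq.weightOK (hη.inX_transport hq)
  have i2 := hκ.integrable_mul hq.weightOK (hη.inX_stretch hq)
  have e1 : innerX q ω κ = (∫ x, κ x * fderiv ℝ η x (vStar q x) * weight q x)
      + ∫ x, κ x * fderiv ℝ (wStar q) x (biotSavart η x) * weight q x := by
    rw [innerX, ← integral_add i1 i2]
    refine integral_congr_ae (Filter.Eventually.of_forall fun x => ?_)
    simp only [← h x]
    ring
  have e2 : ∫ x, κ x * fderiv ℝ (wStar q) x (biotSavart η x) * weight q x
      = -(2 / Real.pi) * ∫ x, κ x * dotForm x (biotSavart η x) := by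
    rw [← integral_const_mul]
    refine integral_congr_ae (Filter.Eventually.of_forall fun x => ?_)
    simp only
    rw [mul_assoc, fderiv_wStar_mul_weight hq]
    ring
  -- Membership of κ in the kernel is used here: the weak transport term of κ is replaced by minus
  -- its nonlocal term.
  have e3 : ∫ x, g x * η x * weight q x
      = (2 / Real.pi) * ∫ x, η x * dotForm x (biotSavart κ x) := by
    rw [← integral_const_mul]
    refine integral_congr_ae ?_
    filter_upwards [hae] with x hx
    have h1 : g x = -fderiv ℝ (wStar q) x (biotSavart κ x) := by linarith
    rw [h1]
    linear_combination -η x * fderiv_wStar_mul_weight hq x (biotSavart κ x)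
  rw [e1, integral_transport_weight hq hη hκ hg hw, e2, e3,
    integral_dotForm_skew hη (hκ.integrable hq)]
  ring

/-! ### Uniqueness -/

theorem LambdaEq.sub {q : ℝ → ℝ} (hq : AdmissibleProfile q) {ω ω' f : Plane → ℝ}
    (h : LambdaEq q ω f) (h' : LambdaEq q ω' f) :
    LambdaEq q (fun x => ω x - ω' x) fun _ => 0 := by
  obtain ⟨hω, g, hg, hw, hae⟩ := h
  obtain ⟨hω', g', hg', hw', hae'⟩ := h'
  refine ⟨hω.sub hq hω', fun x => g x - g' x, hg.sub hq hg', fun χ hχ hs => ?_, ?_⟩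
  · obtain ⟨M, hM⟩ := hχ.continuous.norm.bounded_above_of_compact_support hs.norm
    have ct : Continuous fun x => fderiv ℝ χ x (vStar q x) :=
      (hχ.continuous_fderiv (by simp)).clm_apply (continuous_vStar hq)
    have st : HasCompactSupport fun x => fderiv ℝ χ x (vStar q x) := by
      refine (hs.fderiv ℝ).mono fun x hx => ?_
      rw [Function.mem_support] at hx ⊢
      exact fun h0 => hx (by rw [h0]; rfl)
    obtain ⟨N, hN⟩ := ct.norm.bounded_above_of_compact_support st.norm
    have i1 : ∀ {f : Plane → ℝ}, InX q f → Integrable fun x => f x * fderiv ℝ χ x (vStar q x) :=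
      fun {f} hf => (hf.integrable hq).mul_bdd (c := N) ct.aestronglyMeasurable
        (Filter.Eventually.of_forall fun x => by simpa using hN x)
    have i2 : ∀ {f : Plane → ℝ}, InX q f → Integrable fun x => f x * χ x :=
      fun {f} hf => (hf.integrable hq).mul_bdd (c := M) hχ.continuous.aestronglyMeasurable
        (Filter.Eventually.of_forall fun x => by simpa using hM x)
    simp only [sub_mul]
    rw [integral_sub (i1 hω) (i1 hω'), integral_sub (i2 hg) (i2 hg'), hw χ hχ hs, hw' χ hχ hs]
    ring
  · filter_upwards [hae, hae', ae_integrable_kernel (hω.integrable hq),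
      ae_integrable_kernel (hω'.integrable hq)] with x h1 h2 k1 k2
    have e : biotSavart (fun y => ω y - ω' y) x = biotSavart ω x - biotSavart ω' x := by
      simp only [biotSavart, sub_div, sub_smul]
      rw [integral_sub k1 k2, smul_sub]
    rw [e, map_sub]
    linarith

theorem biotSavart_congr {ω η : Plane → ℝ} (h : ω =ᵐ[volume] η) : biotSavart ω = biotSavart η :=
  funext fun x => congrArg _ (integral_congr_ae (h.mono fun y hy => by simp only [hy]))

theorem LambdaEq.congr {q : ℝ → ℝ} {ω η f : Plane → ℝ} (h : LambdaEq q ω f) (he : ω =ᵐ[volume] η) :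
    LambdaEq q η f := by
  obtain ⟨hω, g, hg, hw, hae⟩ := h
  refine ⟨hω.congr he, g, hg, fun χ hχ hs => ?_, by rwa [← biotSavart_congr he]⟩
  rw [← hw χ hχ hs]
  exact integral_congr_ae (he.mono fun x hx => by simp only [hx])

/-- A solution in the range of `Λ` is the only profile. -/
theorem isProfile_iff {q : ℝ → ℝ} (hq : AdmissibleProfile q) {η ω F : Plane → ℝ} (hω : Nice q ω)
    (hωF : LambdaPt q ω fun x => -F x) (hη : Nice q η) (hηω : LambdaPt q η ω) (κ : Plane → ℝ) :
    IsProfile q F κ ↔ κ =ᵐ[volume] ω := by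
  have h1 := lambdaEq_of_lambdaPt hq hω hωF
  have h2 := perpKer_of_lambdaPt hq hη hηω
  constructor
  · rintro ⟨hκ, hκp⟩
    -- The difference of two solutions lies in the kernel and both are orthogonal to the kernel, so
    -- the difference is orthogonal to itself.
    have hd := hκ.sub hq h1
    have e1 := hκp _ hd
    have e2 := h2 _ hd
    have i1 := hκ.1.integrable_mul hq.weightOK hd.1
    have i2 := hω.inX.integrable_mul hq.weightOK hd.1
    have e3 : ∫ x, (κ x - ω x) ^ 2 * weight q x = 0 := by
      rw [innerX] at e1 e2
      rw [← sub_self (0 : ℝ)]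
      nth_rewrite 1 [← e1]
      rw [← e2, ← integral_sub i1 i2]
      refine integral_congr_ae (Filter.Eventually.of_forall fun x => ?_)
      simp only
      ring
    rw [integral_eq_zero_iff_of_nonneg
      (fun x => mul_nonneg (sq_nonneg _) (hq.weightOK.pos x).le) hd.1.2] at e3
    filter_upwards [e3] with x hx
    have h3 := (mul_eq_zero.1 hx).resolve_right (hq.weightOK.pos x).ne'
    linarith [pow_eq_zero_iff (two_ne_zero) |>.1 h3]
  · intro he
    refine ⟨h1.congr he.symm, fun κ' hκ' => ?_⟩
    rw [← h2 κ' hκ']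
    exact integral_congr_ae (he.mono fun x hx => by simp only [hx])

end VortexPair

namespace VortexPair

/-! ### Construction of the profiles -/

theorem mode_congr {n : ℕ} {ζ : ℂ} {f g : ℝ → ℝ} (h : ∀ s, 0 ≤ s → f s = g s) :
    mode n ζ f = mode n ζ g := funext fun x => by rw [mode, mode, h _ (sq_nonneg _)]

/-- Λ turns the coefficient φ into (n/2π)mφ and rotates ζ by i; taking φ = (2π/n)b/m and starting
from -iζ produces the given mode. Being in the range of Λ yields orthogonality to the kernel. -/
theorem RadialSolution.exists_preimage {q : ℝ → ℝ} (hq : AdmissibleProfile q) {n : ℕ} (hn : 2 ≤ n)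
    {φ α b : ℝ → ℝ} (hs : RadialSolution q n φ α b) (ζ : ℂ) :
    ∃ η, Nice q η ∧ LambdaPt q η (mode n ζ b) := by
  have hadm : Adm q fun s => invMean q s * (2 * Real.pi / n * b s) :=
    Adm.mul hq.weightOK hq.sym_invMean (hs.adm.const_mul hq.weightOK _)
  obtain ⟨β, hβ⟩ := exists_radialSolution hq hn hadm
  refine ⟨_, hβ.nice hq.weightOK hn (-Complex.I * ζ), ?_⟩
  have h := lambdaPt_mode hq hn hβ (-Complex.I * ζ)
  have e1 : Complex.I * (-Complex.I * ζ) = ζ := by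
    rw [← mul_assoc, mul_neg, Complex.I_mul_I, neg_neg, one_mul]
  rw [e1] at h
  refine (mode_congr (f := fun s => n / (2 * Real.pi) * (angMean q s * (invMean q s *
    (2 * Real.pi / n * b s)))) (g := b) fun s hs' => ?_) ▸ h
  have hn0 : (n : ℝ) ≠ 0 := by positivity
  have hp := Real.pi_ne_zero
  have hν := hq.invMean_mul hs'
  field_simp
  linear_combination b s * hν

theorem angle_eq (x : Plane) : angle x = Complex.arg (zc x) := by rw [angle, zc_apply]

theorem zc_pow_eq (n : ℕ) (x : Plane) :
    zc x ^ n = (‖x‖ ^ n * Real.cos (n * angle x) : ℝ) + (‖x‖ ^ n * Real.sin (n * angle x) : ℝ) * Complex.I := by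
  have h := Complex.norm_mul_exp_arg_mul_I (zc x)
  rw [LinearIsometryEquiv.norm_map, ← angle_eq] at h
  rw [← h, mul_pow, ← Complex.exp_nat_mul]
  rw [show (n : ℂ) * (angle x * Complex.I) = ((n * angle x : ℝ) : ℂ) * Complex.I by push_cast; ring,
    Complex.exp_mul_I]
  push_cast
  ring

theorem re_zc_pow (n : ℕ) (x : Plane) : (zc x ^ n).re = ‖x‖ ^ n * Real.cos (n * angle x) := by
  rw [zc_pow_eq]; simp [-Complex.ofReal_mul]

theorem im_zc_pow (n : ℕ) (x : Plane) : (zc x ^ n).im = ‖x‖ ^ n * Real.sin (n * angle x) := by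
  rw [zc_pow_eq]; simp [-Complex.ofReal_mul]

theorem mode_I (n : ℕ) (h : ℝ → ℝ) (x : Plane) :
    mode n (Complex.I * 1) h x = -(‖x‖ ^ n * Real.sin (n * angle x) * h (‖x‖ ^ 2)) := by
  rw [mode, mul_one, ← im_zc_pow]
  simp

theorem mul_potential {q : ℝ → ℝ} (hq : AdmissibleProfile q) {s : ℝ} (hs : 0 ≤ s) :
    angMean q s * potential q s = -4 * dq q s := by
  rw [potential, ← mul_assoc, mul_comm (angMean q s), hq.invMean_mul hs, one_mul]

/-- Since mV = -4q', a constant multiple of V is the right source: (n/2π) · (1/(2nπ)) · (-4q') =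
-q'/π² = g/2π, evaluated at s = r². -/
theorem lambdaPt_forcing {q : ℝ → ℝ} (hq : AdmissibleProfile q) {n : ℕ} (hn : 2 ≤ n)
    {α b : ℝ → ℝ}
    (hs : RadialSolution q n (fun s => (-1) ^ n / (2 * n * Real.pi) * potential q s) α b) :
    LambdaPt q (mode n 1 b) fun x => -forcing q n x := fun x => by
  refine (lambdaPt_mode hq hn hs 1 x).trans ?_
  simp only [mode_I, forcing, gCoef]
  have h := mul_potential hq (sq_nonneg ‖x‖)
  have hn0 : (n : ℝ) ≠ 0 := by positivity
  have hp := Real.pi_ne_zero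
  field_simp
  linear_combination -(‖x‖ ^ n * Real.sin (n * angle x)) * h

theorem axisProfile_mode (n : ℕ) (b : ℝ → ℝ) (r : ℝ) :
    axisProfile (mode n 1 b) r = r ^ n * b (r ^ 2) := by
  have h1 : zc !₂[r, 0] = (r : ℂ) := by apply Complex.ext <;> simp
  have h2 : ‖(!₂[r, 0] : Plane)‖ ^ 2 = r ^ 2 := by rw [normSq_eq]; simp
  rw [axisProfile, mode, h1, h2, one_mul, ← Complex.ofReal_pow, Complex.ofReal_re]

theorem mode_eq_axisProfile (n : ℕ) (b : ℝ → ℝ) (x : Plane) :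
    mode n 1 b x = axisProfile (mode n 1 b) ‖x‖ * Real.cos (n * angle x) := by
  rw [axisProfile_mode, mode, one_mul, re_zc_pow]
  ring

/-- The substitution u = s² in both integrals; the factor 1/2 from each turns 1/(2n) into 1/(4n). -/
theorem streamCoef_eq_green {n : ℕ} (hn : n ≠ 0) {b : ℝ → ℝ} (hb : ContinuousOn b (Set.Ici 0)) {r : ℝ} (hr : 0 < r) :
    streamCoef n (fun ρ => ρ ^ n * b (ρ ^ 2)) r = r ^ n * green n b (r ^ 2) := by
  have e1 : ∫ s in (0 : ℝ)..r, (s / r) ^ n * (s * (s ^ n * b (s ^ 2)))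
      = r ^ n * (r ^ 2 * mean n b (r ^ 2)) / 2 := by
    have h1 : ∫ s in (0 : ℝ)..r, ((fun u => u ^ n * b u) ∘ fun s => s ^ 2) s * (2 * s)
        = ∫ u in (0 : ℝ) ^ 2..r ^ 2, u ^ n * b u := by
      refine intervalIntegral.integral_comp_mul_deriv' (fun s _ => ?_) (by fun_prop) ?_
      · simpa using hasDerivAt_pow 2 s
      · refine ((continuousOn_id.pow n).mul hb).mono ?_
        rintro _ ⟨s, _, rfl⟩
        exact sq_nonneg s
    rw [zero_pow two_ne_zero, ← mul_pow_mean (by positivity)] at h1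
    have h2 : ∀ s, (s / r) ^ n * (s * (s ^ n * b (s ^ 2)))
        = (1 / (2 * r ^ n)) * (((fun u => u ^ n * b u) ∘ fun s => s ^ 2) s * (2 * s)) := fun s => by
      simp only [Function.comp]
      rw [div_pow]
      field_simp
      ring
    simp only [h2]
    rw [intervalIntegral.integral_const_mul, h1]
    field_simp
    ring
  have e2 : ∫ s in Set.Ioi r, (r / s) ^ n * (s * (s ^ n * b (s ^ 2)))
      = r ^ n * (∫ u in Set.Ioi (r ^ 2), b u) / 2 := by
    have himg : (fun s : ℝ => s ^ 2) '' Set.Ioi r = Set.Ioi (r ^ 2) := by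
      ext u
      constructor
      · rintro ⟨s, hs, rfl⟩
        exact pow_lt_pow_left₀ hs hr.le two_ne_zero
      · intro hu
        have hu : r ^ 2 < u := hu
        exact ⟨Real.sqrt u, (Real.lt_sqrt hr.le).2 hu, Real.sq_sqrt ((sq_nonneg r).trans hu.le)⟩
    have h1 := integral_image_eq_integral_abs_deriv_smul (f := fun s : ℝ => s ^ 2)
      (f' := fun s => 2 * s) (s := Set.Ioi r) measurableSet_Ioi
      (fun s _ => by simpa using (hasDerivAt_pow 2 s).hasDerivWithinAt)
      (fun s hs t ht h => (pow_left_inj₀ (hr.le.trans (le_of_lt hs)) (hr.le.trans (le_of_lt ht))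
        two_ne_zero).1 h) b
    rw [himg] at h1
    rw [h1, ← integral_const_mul, ← integral_div]
    refine setIntegral_congr_fun measurableSet_Ioi fun s hs => ?_
    have hs0 : 0 < s := hr.trans hs
    simp only [smul_eq_mul]
    rw [abs_of_pos (by positivity), div_pow]
    field_simp
  rw [streamCoef, e1, e2, green]
  have : (n : ℝ) ≠ 0 := by exact_mod_cast hn
  field_simp
  ring

theorem hasDerivAt_pow_mul_comp_sq {n : ℕ} {b : ℝ → ℝ} (hb : SmoothHalf b) {r : ℝ} (hr : 0 < r) :
    HasDerivAt (fun ρ => ρ ^ n * b (ρ ^ 2))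
      (n * r ^ (n - 1) * b (r ^ 2) + r ^ n * (dq b (r ^ 2) * (2 * r))) r := by
  have hr2 : 0 < r ^ 2 := by positivity
  have h1 := hasDerivAt_of_within (hb.hasDeriv hr2.le) hr2
  have h2 : HasDerivAt (fun ρ : ℝ => ρ ^ 2) (2 * r) r := by simpa using hasDerivAt_pow 2 r
  exact (hasDerivAt_pow n r).mul (HasDerivAt.comp r h1 h2)

/-- The radial factor of `B(r)`. -/
def fourthCoef (q α b : ℝ → ℝ) (s : ℝ) : ℝ :=
  2 * (dq α s * b s + -1 * (α s * dq b s)) + (-1 / (2 * Real.pi) * dq b s + -1 / Real.pi ^ 2 * dq q s)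

theorem coefB_eq {q φ α b : ℝ → ℝ} (hs : RadialSolution q 2 φ α b) {r : ℝ} (hr : 0 < r) :
    coefB q (axisProfile (mode 2 1 b)) r = r ^ 4 * fourthCoef q α b (r ^ 2) := by
  have ha : axisProfile (mode 2 1 b) = fun ρ => ρ ^ 2 * b (ρ ^ 2) :=
    funext fun ρ => axisProfile_mode 2 b ρ
  have hA : ∀ ρ, 0 < ρ → streamCoef 2 (fun ρ => ρ ^ 2 * b (ρ ^ 2)) ρ = ρ ^ 2 * α (ρ ^ 2) :=
    fun ρ hρ => by
      rw [streamCoef_eq_green two_ne_zero hs.adm.smooth.continuousOn hρ, hs.green_eq _ (sq_nonneg ρ)]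
  have hA' : deriv (streamCoef 2 fun ρ => ρ ^ 2 * b (ρ ^ 2)) r
      = 2 * r * α (r ^ 2) + r ^ 2 * (dq α (r ^ 2) * (2 * r)) := by
    refine HasDerivAt.deriv (HasDerivAt.congr_of_eventuallyEq (f := fun ρ => ρ ^ 2 * α (ρ ^ 2)) ?_ ?_)
    · simpa using hasDerivAt_pow_mul_comp_sq (n := 2) hs.smooth hr
    · filter_upwards [lt_mem_nhds hr] with ρ hρ using hA ρ hρ
  have ha' : deriv (fun ρ => ρ ^ 2 * b (ρ ^ 2)) r
      = 2 * r * b (r ^ 2) + r ^ 2 * (dq b (r ^ 2) * (2 * r)) := by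
    simpa using (hasDerivAt_pow_mul_comp_sq (n := 2) hs.adm.smooth hr).deriv
  rw [coefB, ha, hA', ha', hA r hr, fourthCoef, gCoef]
  field_simp
  ring

theorem forcingFour_eq {q φ α b : ℝ → ℝ} (hs : RadialSolution q 2 φ α b) (x : Plane) :
    forcingFour q (mode 2 1 b) x = (zc x ^ 4).im * fourthCoef q α b (‖x‖ ^ 2)
      + 2 / Real.pi * ((zc x ^ 2).im * b (‖x‖ ^ 2)) := by
  rw [im_zc_pow, im_zc_pow, forcingFour, coefC, axisProfile_mode]
  -- The coefficient B contains 1/r, so the origin is separate; there the angle is 0 by convention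
  -- and all sines vanish.
  rcases eq_or_ne x 0 with rfl | hx
  · simp [angle_eq]
  · rw [coefB_eq hs (norm_pos_iff.2 hx)]
    push_cast
    ring

/-- Existence of the profiles: the vorticities are combinations of angular modes. -/
theorem exists_profiles {q : ℝ → ℝ} (hq : AdmissibleProfile q) :
    ∃ (φ₂ α₂ b₂ φ₃ α₃ b₃ φ₄ α₄ b₄ φ₅ α₅ b₅ : ℝ → ℝ),
      RadialSolution q 2 φ₂ α₂ b₂ ∧ RadialSolution q 3 φ₃ α₃ b₃ ∧ RadialSolution q 4 φ₄ α₄ b₄ ∧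
      RadialSolution q 2 φ₅ α₅ b₅ ∧
      LambdaPt q (mode 2 1 b₂) (fun x => -forcing q 2 x) ∧
      LambdaPt q (mode 3 1 b₃) (fun x => -forcing q 3 x) ∧
      LambdaPt q (fun x => mode 4 1 b₄ x + mode 2 1 b₅ x)
        (fun x => -forcingFour q (mode 2 1 b₂) x) := by
  have hw := hq.weightOK
  obtain ⟨α₂, h₂⟩ := exists_radialSolution hq le_rfl
    (hq.adm_potential.const_mul hw ((-1) ^ 2 / (2 * (2 : ℕ) * Real.pi)))
  obtain ⟨α₃, h₃⟩ := exists_radialSolution hq (n := 3) (by norm_num)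
    (hq.adm_potential.const_mul hw ((-1) ^ 3 / (2 * (3 : ℕ) * Real.pi)))
  set b₂ := fun s => potential q s * α₂ s + (-1) ^ 2 / (2 * (2 : ℕ) * Real.pi) * potential q s
    with hb₂
  -- Because the source is itself a multiple of V, b₂ = (α₂ + const)V; its derivative is thus
  -- governed by V and V', both already controlled.
  have hdb : ∀ s, 0 ≤ s → dq b₂ s = (α₂ s + (-1) ^ 2 / (2 * (2 : ℕ) * Real.pi)) * dq (potential q) s
      + dq α₂ s * potential q s := fun s hs => by
    have h1 : ∀ s, 0 ≤ s → b₂ s = (α₂ s + (-1) ^ 2 / (2 * (2 : ℕ) * Real.pi)) * potential q s :=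
      fun s _ => by rw [hb₂]; ring
    have hsm := h₂.smooth.add (smoothHalf_const ((-1) ^ 2 / (2 * (2 : ℕ) * Real.pi)))
    rw [dq_congr h1 hs, dq_mul hsm hq.adm_potential.smooth hs,
      dq_add h₂.smooth (smoothHalf_const _) hs, dq_const _ hs]
    ring
  have adb : Adm q (dq b₂) :=
    ((Adm.mul hw (h₂.sym.add (Sym.const _)) hq.adm_dq_potential).add hw
      (Adm.mul hw h₂.sym_dq hq.adm_potential)).congr hdb
  have adm4 : Adm q (fourthCoef q α₂ b₂) :=
    (((Adm.mul hw h₂.sym_dq h₂.adm).add hw ((Adm.mul hw h₂.sym adb).const_mul hw (-1))).const_mul hw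
      2).add hw ((adb.const_mul hw _).add hw (hq.adm_dq.const_mul hw _))
  -- The factors π/2 here and 2 below invert n/2π: (4/2π)(π/2) = 1 reproduces the coefficient of sin
  -- 4θ, and (2/2π) · 2 = 2/π that of sin 2θ.
  obtain ⟨α₄, h₄⟩ := exists_radialSolution hq (n := 4) (by norm_num)
    (Adm.mul hw hq.sym_invMean (adm4.const_mul hw (Real.pi / 2)))
  obtain ⟨α₅, h₅⟩ := exists_radialSolution hq le_rfl
    (Adm.mul hw hq.sym_invMean (h₂.adm.const_mul hw 2))
  refine ⟨_, _, _, _, _, _, _, _, _, _, _, _, h₂, h₃, h₄, h₅, lambdaPt_forcing hq le_rfl h₂,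
    lambdaPt_forcing hq (by norm_num) h₃, fun x => ?_⟩
  refine ((lambdaPt_mode hq (by norm_num) h₄ 1).add (h₄.nice hw (by norm_num) 1)
    (h₅.nice hw le_rfl 1) (lambdaPt_mode hq le_rfl h₅ 1) x).trans ?_
  simp only [mode_I, forcingFour_eq h₂, im_zc_pow]
  have hν := hq.invMean_mul (sq_nonneg ‖x‖)
  have hp := Real.pi_ne_zero
  push_cast
  field_simp
  linear_combination (-(‖x‖ ^ 4 * 4 * Real.sin (4 * angle x) * Real.pi *
    fourthCoef q α₂ b₂ (‖x‖ ^ 2)) - ‖x‖ ^ 2 * 2 ^ 3 * Real.sin (angle x * 2) * b₂ (‖x‖ ^ 2)) * hν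

end VortexPair

namespace VortexPair

/-! ### The far field -/

/-- The vector u^⊥/|u|² is i z/|z|², whose conjugate is -i/z. The Biot-Savart integral becomes a
Cauchy integral, and the far field a geometric series. -/
theorem conj_zc_kernel (c : ℝ) (u : Plane) :
    starRingEnd ℂ (zc ((c / ‖u‖ ^ 2) • perp u)) = -Complex.I * (c / zc u) := by
  rw [map_smul, zc_perp, Complex.real_smul, map_mul, map_mul, Complex.conj_I, Complex.conj_ofReal,
    div_eq_mul_inv (c : ℂ), Complex.inv_def, Complex.normSq_eq_norm_sq, LinearIsometryEquiv.norm_map,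
    div_eq_mul_inv]
  push_cast
  ring

theorem conj_zc_biotSavart (ω : Plane → ℝ) (x : Plane) :
    starRingEnd ℂ (zc (biotSavart ω x))
      = -Complex.I / (2 * Real.pi) * ∫ y, (ω y / zc (x - y) : ℂ) := by
  rw [biotSavart, map_smul, Complex.real_smul, map_mul, Complex.conj_ofReal,
    show zc (∫ y : Plane, (ω y / ‖x - y‖ ^ 2) • perp (x - y))
      = ∫ y, zc ((ω y / ‖x - y‖ ^ 2) • perp (x - y)) from
      (zc.toContinuousLinearEquiv.integral_comp_comm _).symm, ← integral_conj]
  simp only [conj_zc_kernel]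
  rw [integral_const_mul]
  push_cast
  ring

/-- The reflected point `-x - 2 x_d`. -/
def reflect (d : ℝ) (x : Plane) : Plane := -x - (2 : ℝ) • center d

theorem zc_center (d : ℝ) : zc (center d) = d / 2 := by
  apply Complex.ext <;> simp [center]

theorem zc_reflect_sub (d : ℝ) (x y : Plane) :
    zc (reflect d x - y) = -(d + (zc x + zc y)) := by
  rw [reflect, map_sub, map_sub, map_neg, map_smul, zc_center, Complex.real_smul]
  push_cast
  ring

theorem continuous_reflect (d : ℝ) : Continuous (reflect d) := by unfold reflect; fun_prop

/-- The Cauchy integral describing the velocity at the reflected point. -/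
def far (ω : Plane → ℝ) (d : ℝ) (x : Plane) : ℂ := ∫ y, (ω y / (d + (zc x + zc y)) : ℂ)

theorem conj_zc_biotSavart_reflect (ω : Plane → ℝ) (d : ℝ) (x : Plane) :
    starRingEnd ℂ (zc (biotSavart ω (reflect d x))) = Complex.I / (2 * Real.pi) * far ω d x := by
  rw [conj_zc_biotSavart]
  simp only [zc_reflect_sub, div_neg, integral_neg, far]
  ring

theorem inv_add_sub_sum {d ζ : ℂ} (hd : d ≠ 0) (h : d + ζ ≠ 0) (K : ℕ) :
    (d + ζ)⁻¹ - ∑ k ∈ Finset.range K, (-1) ^ k / d ^ (k + 1) * ζ ^ k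
      = (-ζ) ^ K / (d ^ K * (d + ζ)) := by
  induction K with
  | zero => simp
  | succ K ih =>
    rw [Finset.sum_range_succ, ← sub_sub, ih]
    field_simp
    rw [neg_pow ζ]
    ring

/-- Moments of a vorticity. -/
def moment (ω : Plane → ℝ) (k : ℕ) : ℂ := ∫ y, (ω y : ℂ) * zc y ^ k

theorem integrable_decay_mul {E : Type*} [NormedAddCommGroup E] {q : ℝ → ℝ} {ω : Plane → ℝ} (hω : Nice q ω) {f : Plane → E}
    {C : ℝ} {N : ℕ} (hf : AEStronglyMeasurable f volume)
    (hb : ∀ y, ‖f y‖ ≤ C * ((1 + ‖y‖) ^ N * |ω y|)) : Integrable f := by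
  obtain ⟨D, hD⟩ := hω.decay (3 + N)
  refine DecayBy.integrable ((DecayBy.const_mul (f := fun y => (1 + ‖y‖) ^ N * |ω y|) C
    ⟨D, fun y => ?_⟩).of_le hb) hf
  rw [Real.norm_of_nonneg (by positivity), ← mul_assoc, ← pow_add]
  exact hD y

theorem norm_zc_add_le (x y : Plane) : ‖zc x + zc y‖ ≤ (1 + ‖x‖) * (1 + ‖y‖) := by
  refine (norm_add_le _ _).trans ?_
  rw [LinearIsometryEquiv.norm_map, LinearIsometryEquiv.norm_map]
  nlinarith [norm_nonneg x, norm_nonneg y, mul_nonneg (norm_nonneg x) (norm_nonneg y)]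

theorem Nice.integrable_mul_zc_add {q : ℝ → ℝ} {ω : Plane → ℝ} (hω : Nice q ω) (x : Plane) (k : ℕ) :
    Integrable fun y => (ω y : ℂ) * (zc x + zc y) ^ k := by
  have hz : Continuous fun y : Plane => zc y := zc.continuous
  refine integrable_decay_mul hω (C := (1 + ‖x‖) ^ k) (N := k)
    ((Complex.continuous_ofReal.comp hω.smooth.continuous).mul
      ((continuous_const.add hz).pow k)).aestronglyMeasurable fun y => ?_
  rw [norm_mul, norm_pow, Complex.norm_real, Real.norm_eq_abs]
  calc |ω y| * ‖zc x + zc y‖ ^ k ≤ |ω y| * ((1 + ‖x‖) * (1 + ‖y‖)) ^ k := by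
        gcongr; exact norm_zc_add_le x y
    _ = _ := by rw [mul_pow]; ring

theorem Nice.integrable_mul_zc {q : ℝ → ℝ} {ω : Plane → ℝ} (hω : Nice q ω) (k : ℕ) :
    Integrable fun y => (ω y : ℂ) * zc y ^ k := by
  simpa using hω.integrable_mul_zc_add 0 k

/-- In the binomial expansion the vanishing moments leave only the term free of y. -/
theorem integral_mul_zc_add {q : ℝ → ℝ} {ω : Plane → ℝ} (hω : Nice q ω) {k : ℕ}
    (hm : ∀ j, 1 ≤ j → j ≤ k → moment ω j = 0) (x : Plane) :
    ∫ y, (ω y : ℂ) * (zc x + zc y) ^ k = moment ω 0 * zc x ^ k := by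
  have e : ∀ y, (ω y : ℂ) * (zc x + zc y) ^ k = ∑ j ∈ Finset.range (k + 1),
      (zc x ^ (k - j) * (k.choose j : ℂ)) * ((ω y : ℂ) * zc y ^ j) := fun y => by
    rw [add_comm, add_pow, Finset.mul_sum]
    exact Finset.sum_congr rfl fun j _ => by ring
  simp only [e]
  rw [integral_finsetSum _ fun j _ => (hω.integrable_mul_zc j).const_mul _]
  simp only [integral_const_mul]
  rw [Finset.sum_eq_single 0]
  · simp [moment, mul_comm]
  · intro j hj hj0
    have : moment ω j = 0 := hm j (by omega) (by rw [Finset.mem_range] at hj; omega)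
    rw [show ∫ y, (ω y : ℂ) * zc y ^ j = 0 from this, mul_zero]
  · simp

/-- Taylor expansion of the far field, with a remainder of polynomial growth. -/
theorem exists_far_bound {q : ℝ → ℝ} {ω : Plane → ℝ} (hω : Nice q ω) (K : ℕ) :
    ∃ C, ∀ d : ℝ, 0 < d → ∀ x : Plane,
      ‖far ω d x - ∑ k ∈ Finset.range K, (-1) ^ k / (d : ℂ) ^ (k + 1) *
        ∫ y, (ω y : ℂ) * (zc x + zc y) ^ k‖ ≤ C / d ^ (K + 1) * (1 + ‖x‖) ^ (K + 1) := by
  let g : Plane → ℝ := fun y => (1 + ‖y‖) ^ (K + 1) * |ω y|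
  have gc : Continuous g := by
    have := hω.smooth.continuous
    fun_prop
  have gi : Integrable g := integrable_decay_mul hω (C := 1) (N := K + 1) gc.aestronglyMeasurable
    fun y => by rw [Real.norm_of_nonneg (by positivity), one_mul]
  obtain ⟨M, hM⟩ := hω.decay (K + 1)
  have g0 : ∀ y, 0 ≤ g y := fun y => by positivity
  have gM : ∀ y, |g y| ≤ M := fun y => by rw [abs_of_nonneg (g0 y)]; exact hM y
  obtain ⟨N, hN⟩ : ∃ N, N = ∫ y, nearKernel y := ⟨_, rfl⟩
  refine ⟨(∫ y, g y) + (M * N + ∫ y, g y), fun d hd x => ?_⟩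
  have hdc : (d : ℂ) ≠ 0 := by exact_mod_cast hd.ne'
  have i0 : Integrable fun y => (ω y / (d + (zc x + zc y)) : ℂ) := by
    obtain ⟨N, hN⟩ := hω.exists_bound
    have h1 := zc.toContinuousLinearEquiv.toContinuousLinearMap.integrable_comp
      (hω.integrable_kernel (reflect d x))
    have h2 := (Complex.conjCLE.toContinuousLinearMap.integrable_comp h1).const_mul (-Complex.I)
    refine h2.congr (Filter.Eventually.of_forall fun y => ?_)
    have := conj_zc_kernel (ω y) (reflect d x - y)
    simp only
    refine (congrArg (fun w => -Complex.I * w) this).trans ?_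
    rw [zc_reflect_sub, div_neg, ← mul_assoc]
    simp
  have is : ∀ k ∈ Finset.range K, Integrable fun y => (-1) ^ k / (d : ℂ) ^ (k + 1) *
      ((ω y : ℂ) * (zc x + zc y) ^ k) := fun k _ => (hω.integrable_mul_zc_add x k).const_mul _
  simp only [← integral_const_mul]
  rw [far, ← integral_finsetSum _ is, ← integral_sub i0 (integrable_finsetSum _ is)]
  have ir : Integrable fun y => (1 + ‖x‖) ^ (K + 1) / d ^ (K + 1) *
      (g y + g y * ‖reflect d x - y‖⁻¹) :=
    (gi.add (integrable_mul_inv_norm gi gM _)).const_mul _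
  refine (norm_integral_le_of_norm_le ir ?_).trans ?_
  · filter_upwards [Measure.ae_ne volume (reflect d x)] with y hy
    have hne : (d : ℂ) + (zc x + zc y) ≠ 0 := fun h => hy (by
      have h1 := zc_reflect_sub d x y
      rw [h, neg_zero] at h1
      exact (sub_eq_zero.1 ((LinearIsometryEquiv.map_eq_zero_iff zc).1 h1)).symm)
    set ζ := zc x + zc y with hζ
    have e1 : (ω y / (d + ζ) : ℂ) - ∑ k ∈ Finset.range K, (-1) ^ k / (d : ℂ) ^ (k + 1) *
        ((ω y : ℂ) * ζ ^ k) = ω y * ((-ζ) ^ K / (d ^ K * (d + ζ))) := by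
      rw [← inv_add_sub_sum hdc hne, mul_sub, Finset.mul_sum, div_eq_mul_inv]
      congr 1
      exact Finset.sum_congr rfl fun k _ => by ring
    have e2 : ‖reflect d x - y‖ = ‖(d : ℂ) + ζ‖ := by
      rw [← LinearIsometryEquiv.norm_map zc, zc_reflect_sub, norm_neg]
    rw [e1, e2, norm_mul, norm_div, norm_mul, norm_pow, norm_pow, norm_neg, Complex.norm_real,
      Complex.norm_real, Real.norm_eq_abs, Real.norm_of_nonneg hd.le]
    have hρ : 0 < ‖(d : ℂ) + ζ‖ := norm_pos_iff.2 hne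
    -- The exact remainder carries only d⁻ᴷ and is singular at the reflected point. Replacing one
    -- factor d by |d + ζ| + |ζ| gains a further 1/d and leaves a term with 1/|d + ζ|, whose
    -- integral is bounded uniformly. So the estimate holds for every x, not only for |x| small
    -- against d.
    have h1 : d ≤ ‖(d : ℂ) + ζ‖ + ‖ζ‖ := by
      have := norm_sub_le ((d : ℂ) + ζ) ζ
      rwa [add_sub_cancel_right, Complex.norm_real, Real.norm_of_nonneg hd.le] at this
    set ρ := ‖(d : ℂ) + ζ‖
    have h2 := norm_zc_add_le x y
    rw [← hζ] at h2
    have ha : 1 ≤ 1 + ‖x‖ := by linarith [norm_nonneg x]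
    have hb : 1 ≤ 1 + ‖y‖ := by linarith [norm_nonneg y]
    have hab : 1 ≤ (1 + ‖x‖) * (1 + ‖y‖) := one_le_mul_of_one_le_of_one_le ha hb
    set A := (1 + ‖x‖) * (1 + ‖y‖) with hA
    calc |ω y| * (‖ζ‖ ^ K / (d ^ K * ρ)) = |ω y| / d ^ (K + 1) * (‖ζ‖ ^ K * d / ρ) := by
          field_simp
          ring
      _ ≤ |ω y| / d ^ (K + 1) * (‖ζ‖ ^ K * (ρ + ‖ζ‖) / ρ) := by gcongr
      _ = |ω y| / d ^ (K + 1) * (‖ζ‖ ^ K + ‖ζ‖ ^ (K + 1) * ρ⁻¹) := by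
          field_simp
          ring
      _ ≤ |ω y| / d ^ (K + 1) * (A ^ (K + 1) + A ^ (K + 1) * ρ⁻¹) := by
          gcongr
          exact (pow_le_pow_left₀ (norm_nonneg _) h2 K).trans (pow_le_pow_right₀ hab (Nat.le_succ K))
      _ = _ := by simp only [g]; rw [hA, mul_pow]; ring
  · rw [integral_const_mul, integral_add gi (integrable_mul_inv_norm gi gM _)]
    have h3 := integral_mul_inv_norm_le gi gM (reflect d x)
    simp only [fun y => abs_of_nonneg (g0 y)] at h3
    rw [← hN] at h3
    calc (1 + ‖x‖) ^ (K + 1) / d ^ (K + 1) * ((∫ y, g y) + ∫ y, g y * ‖reflect d x - y‖⁻¹)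
        ≤ (1 + ‖x‖) ^ (K + 1) / d ^ (K + 1) *
          ((∫ y, g y) + (M * N + ∫ y, g y)) := by gcongr
      _ = _ := by ring

/-! ### Vanishing moments -/

theorem integral_comp_perp {E : Type*} [NormedAddCommGroup E] [NormedSpace ℝ E] (f : Plane → E) :
    ∫ y, f (perp y) = ∫ y, f y := by
  have h := (perpIso.measurePreserving (E := Plane)).integral_comp
    perpIso.toHomeomorph.measurableEmbedding f
  simpa only [perpIso_apply] using h

/-- A quarter turn multiplies zᵏ by iᵏ and ω by c, hence the moment by c iᵏ. -/
theorem moment_eq_zero_of_perp {ω : Plane → ℝ} {c : ℝ} {k : ℕ} (h : ∀ y, ω (perp y) = c * ω y)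
    (hc : (c : ℂ) * Complex.I ^ k ≠ 1) : moment ω k = 0 := by
  have h1 : moment ω k = (c * Complex.I ^ k) * moment ω k := by
    conv_lhs => rw [moment, ← integral_comp_perp]
    rw [moment, ← integral_const_mul]
    refine integral_congr_ae (Filter.Eventually.of_forall fun y => ?_)
    simp only [h, zc_perp]
    push_cast
    ring
  have h2 : (1 - c * Complex.I ^ k) * moment ω k = 0 := by linear_combination h1
  exact (mul_eq_zero.1 h2).resolve_left (sub_ne_zero.2 hc.symm)

theorem moment_zero_eq (ω : Plane → ℝ) : moment ω 0 = ((∫ y, ω y : ℝ) : ℂ) := by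
  simp only [moment, pow_zero, mul_one]
  exact integral_ofReal

theorem moment_wStar {q : ℝ → ℝ} {k : ℕ} (h1 : 1 ≤ k) (h3 : k ≤ 3) : moment (wStar q) k = 0 := by
  refine moment_eq_zero_of_perp (c := 1) (fun y => by rw [wStar, wStar, norm_perp, one_mul]) ?_
  interval_cases k <;> norm_num [Complex.ext_iff, pow_succ]

theorem moment_mode_two (b : ℝ → ℝ) {k : ℕ} (hk : k ≤ 1) : moment (mode 2 1 b) k = 0 := by
  refine moment_eq_zero_of_perp (c := -1) (fun y => ?_) ?_
  · rw [mode, mode, norm_perp, zc_perp, mul_pow, Complex.I_sq]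
    simp
  · interval_cases k <;> norm_num [Complex.ext_iff]

/-- The mode is odd under y ↦ -y. A quarter turn does not act on it by a real factor, so the
previous criterion is not available. -/
theorem moment_mode_three (b : ℝ → ℝ) : moment (mode 3 1 b) 0 = 0 := by
  rw [moment_zero_eq]
  have h : ∫ y, mode 3 1 b y = -∫ y, mode 3 1 b y := by
    conv_lhs => rw [← integral_neg_eq_self]
    rw [← integral_neg]
    refine integral_congr_ae (Filter.Eventually.of_forall fun y => ?_)
    simp only [mode, norm_neg, map_neg]
    rw [show (1 : ℂ) * (-zc y) ^ 3 = -(1 * zc y ^ 3) by ring, Complex.neg_re]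
    ring
  have : ∫ y, mode 3 1 b y = 0 := by linarith
  rw [this]
  simp

end VortexPair

namespace VortexPair

/-! ### The approximate vorticity -/

theorem Nice.const_mul {q : ℝ → ℝ} (hq : WeightOK q) {ω : Plane → ℝ} (c : ℝ) (h : Nice q ω) :
    Nice q fun x => c * ω x := by
  have hfd : fderiv ℝ (fun x => c * ω x) = fun x => c • fderiv ℝ ω x :=
    funext fun x => fderiv_const_mul (h.differentiable x) c
  refine ⟨contDiff_const.mul h.smooth, fun k => (h.decay k).const_mul c, fun k => ?_, ?_, ?_, ?_⟩
  · rw [hfd]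
    have e : DecayBy k fun x => ‖fderiv ℝ ω x‖ := (h.decay' k).mono fun x => by rw [norm_norm]
    exact (e.const_mul |c|).of_le fun x => by
      rw [norm_smul, Real.norm_eq_abs]
  · exact h.wsq.of_le (c := |c|) (l := 0) hq
      (contDiff_const.mul h.smooth).continuous.aestronglyMeasurable fun x => by
        rw [abs_mul, pow_zero, mul_one]
  · rw [hfd]
    exact h.wsq'.of_le (c := |c|) (l := 0) hq
      (h.continuous_fderiv.const_smul c).norm.aestronglyMeasurable fun x => by
        rw [abs_norm, abs_norm, norm_smul, pow_zero, mul_one, Real.norm_eq_abs]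
  · rw [show biotSavart (fun x => c * ω x) = fun x => c • biotSavart ω x from
      funext (biotSavart_const_mul c ω)]
    exact h.vel.const_smul c

/-- The corrections to the radial profile, with the moments that vanish by symmetry. -/
structure Corrections (q : ℝ → ℝ) (ω₂ ω₃ ω₄ : Plane → ℝ) : Prop where
  nice₂ : Nice q ω₂
  nice₃ : Nice q ω₃
  nice₄ : Nice q ω₄
  moment₂ : ∀ j < 2, moment ω₂ j = 0
  moment₃ : ∀ j < 1, moment ω₃ j = 0

namespace Corrections

variable {q : ℝ → ℝ} {ω₂ ω₃ ω₄ : Plane → ℝ}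

theorem nice (hq : AdmissibleProfile q) (h : Corrections q ω₂ ω₃ ω₄) (d : ℝ) :
    Nice q (approxVorticity q ω₂ ω₃ ω₄ d) :=
  (nice_wStar hq).add hq.weightOK (((h.nice₂.const_mul hq.weightOK _).add hq.weightOK
    (h.nice₃.const_mul hq.weightOK _)).add hq.weightOK (h.nice₄.const_mul hq.weightOK _))

theorem biotSavart_eq (hq : AdmissibleProfile q) (h : Corrections q ω₂ ω₃ ω₄) (d : ℝ) (x : Plane) :
    biotSavart (approxVorticity q ω₂ ω₃ ω₄ d) x = approxVelocity q ω₂ ω₃ ω₄ d x := by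
  have h2 := h.nice₂.const_mul hq.weightOK (1 / d ^ 2)
  have h3 := h.nice₃.const_mul hq.weightOK (1 / d ^ 3)
  have h4 := h.nice₄.const_mul hq.weightOK (1 / d ^ 4)
  have h23 := h2.add hq.weightOK h3
  refine ((nice_wStar hq).vel_add (h23.add hq.weightOK h4) x).trans ?_
  rw [h23.vel_add h4, h2.vel_add h3, biotSavart_const_mul, biotSavart_const_mul,
    biotSavart_const_mul, approxVelocity, vStar]

end Corrections

/-- The Taylor polynomial of the far field of the radial profile. -/
def farPoly (d : ℝ) (z : ℂ) : ℂ := ∑ k ∈ Finset.range 4, (-1) ^ k / (d : ℂ) ^ (k + 1) * z ^ k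

theorem exists_far_bound_of_moments {q : ℝ → ℝ} {ω : Plane → ℝ} (hω : Nice q ω) {K : ℕ}
    (hm : ∀ j < K, moment ω j = 0) :
    ∃ C, ∀ d : ℝ, 0 < d → ∀ x : Plane, ‖far ω d x‖ ≤ C / d ^ (K + 1) * (1 + ‖x‖) ^ (K + 1) := by
  obtain ⟨C, hC⟩ := exists_far_bound hω K
  refine ⟨C, fun d hd x => ?_⟩
  have := hC d hd x
  rwa [Finset.sum_eq_zero, sub_zero] at this
  intro k hk
  rw [Finset.mem_range] at hk
  rw [integral_mul_zc_add hω (fun j _ hj => hm j (by omega)), hm 0 (by omega), zero_mul, mul_zero]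

theorem exists_far_wStar_bound {q : ℝ → ℝ} (hq : AdmissibleProfile q) :
    ∃ C, ∀ d : ℝ, 0 < d → ∀ x : Plane,
      ‖far (wStar q) d x - farPoly d (zc x)‖ ≤ C / d ^ 5 * (1 + ‖x‖) ^ 5 := by
  obtain ⟨C, hC⟩ := exists_far_bound (nice_wStar hq) 4
  refine ⟨C, fun d hd x => ?_⟩
  have := hC d hd x
  rw [farPoly]
  convert this using 4 with k hk
  rw [Finset.mem_range] at hk
  rw [integral_mul_zc_add (nice_wStar hq) (fun j h1 h2 => moment_wStar h1 (by omega)),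
    moment_zero_eq, hq.mass, Complex.ofReal_one, one_mul]

theorem exists_moment_sum_bound {ω : Plane → ℝ} {K : ℕ} (hm : ∀ j < K, moment ω j = 0) :
    ∃ C, ∀ d : ℝ, 1 ≤ d →
      ‖∑ k ∈ Finset.range 4, (-1) ^ k / (d : ℂ) ^ (k + 1) * moment ω k‖ ≤ C / d ^ (K + 1) := by
  refine ⟨∑ k ∈ Finset.range 4, ‖moment ω k‖, fun d hd => ?_⟩
  have hd0 : 0 < d := by linarith
  refine (norm_sum_le _ _).trans ?_
  rw [Finset.sum_div]
  refine Finset.sum_le_sum fun k _ => ?_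
  rcases lt_or_ge k K with h | h
  · simp [hm k h]
  · rw [norm_mul, norm_div, norm_pow, norm_pow, norm_neg, norm_one, one_pow, Complex.norm_real,
      Real.norm_of_nonneg hd0.le, one_div, mul_comm, ← div_eq_mul_inv]
    gcongr

namespace Corrections

variable {q : ℝ → ℝ} {ω₂ ω₃ ω₄ : Plane → ℝ}

/-- The velocity at the reflected point, up to fifth order. -/
theorem exists_reflected_velocity_bound (hq : AdmissibleProfile q) (h : Corrections q ω₂ ω₃ ω₄) :
    ∃ C, 0 ≤ C ∧ ∀ d : ℝ, 0 < d → ∀ x : Plane,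
      ‖starRingEnd ℂ (zc (approxVelocity q ω₂ ω₃ ω₄ d (reflect d x)))
        - Complex.I / (2 * Real.pi) * farPoly d (zc x)‖ ≤ C / d ^ 5 * (1 + ‖x‖) ^ 5 := by
  obtain ⟨C₀, h₀⟩ := exists_far_wStar_bound hq
  obtain ⟨C₂, h₂⟩ := exists_far_bound_of_moments h.nice₂ h.moment₂
  obtain ⟨C₃, h₃⟩ := exists_far_bound_of_moments h.nice₃ h.moment₃
  obtain ⟨C₄, h₄⟩ := exists_far_bound_of_moments h.nice₄ (K := 0) (by simp)
  have bd : ∀ d : ℝ, 0 < d → ∀ x : Plane,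
      ‖starRingEnd ℂ (zc (approxVelocity q ω₂ ω₃ ω₄ d (reflect d x)))
        - Complex.I / (2 * Real.pi) * farPoly d (zc x)‖
      ≤ (|C₀| + |C₂| + |C₃| + |C₄|) / d ^ 5 * (1 + ‖x‖) ^ 5 := fun d hd x => by
    set A := 1 + ‖x‖ with hA
    have hA1 : 1 ≤ A := by linarith [norm_nonneg x]
    have e : starRingEnd ℂ (zc (approxVelocity q ω₂ ω₃ ω₄ d (reflect d x)))
        - Complex.I / (2 * Real.pi) * farPoly d (zc x)
        = Complex.I / (2 * Real.pi) * ((far (wStar q) d x - farPoly d (zc x))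
          + ((1 / d ^ 2 : ℝ) * far ω₂ d x + (1 / d ^ 3 : ℝ) * far ω₃ d x
            + (1 / d ^ 4 : ℝ) * far ω₄ d x)) := by
      rw [approxVelocity, vStar]
      simp only [map_add, map_smul, Complex.real_smul, map_mul, Complex.conj_ofReal,
        conj_zc_biotSavart_reflect]
      ring
    -- The correction of order d⁻ᵐ has 4 - m vanishing moments, so its far field is of order d⁻⁽⁵⁻ᵐ⁾
    -- and the product is of order d⁻⁵ for m = 2, 3, 4.
    have scale : ∀ {C : ℝ} {K m : ℕ} {f : ℂ}, K + m = 4 → ‖f‖ ≤ C / d ^ (K + 1) * A ^ (K + 1) →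
        ‖((1 / d ^ m : ℝ) : ℂ) * f‖ ≤ |C| / d ^ 5 * A ^ 5 := fun {C K m f} hK hf => by
      rw [norm_mul, Complex.norm_real, Real.norm_of_nonneg (by positivity)]
      calc 1 / d ^ m * ‖f‖ ≤ 1 / d ^ m * (|C| / d ^ (K + 1) * A ^ 5) := by
            gcongr
            refine hf.trans ?_
            gcongr
            · exact le_abs_self C
            · omega
        _ = |C| / d ^ 5 * A ^ 5 := by
            rw [← mul_assoc, div_mul_div_comm, one_mul, ← pow_add,
              show m + (K + 1) = 5 by omega]
    have hI : ‖Complex.I / (2 * Real.pi)‖ ≤ 1 := by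
      rw [norm_div, Complex.norm_I, norm_mul, Complex.norm_real, Real.norm_of_nonneg Real.pi_pos.le,
        Complex.norm_ofNat, div_le_one (by positivity)]
      linarith [Real.pi_gt_three]
    have b0 : ‖far (wStar q) d x - farPoly d (zc x)‖ ≤ |C₀| / d ^ 5 * A ^ 5 :=
      (h₀ d hd x).trans (by gcongr; exact le_abs_self _)
    have b2 := scale (m := 2) rfl (h₂ d hd x)
    have b3 := scale (m := 3) rfl (h₃ d hd x)
    have b4 := scale (m := 4) rfl (h₄ d hd x)
    rw [e, norm_mul]
    refine (mul_le_of_le_one_left (norm_nonneg _) hI).trans ?_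
    refine (norm_add_le _ _).trans ?_
    have t1 := norm_add_le ((1 / d ^ 2 : ℝ) * far ω₂ d x + (1 / d ^ 3 : ℝ) * far ω₃ d x)
      ((1 / d ^ 4 : ℝ) * far ω₄ d x)
    have t2 := norm_add_le ((1 / d ^ 2 : ℝ) * far ω₂ d x) ((1 / d ^ 3 : ℝ) * far ω₃ d x)
    have t3 : (|C₀| + |C₂| + |C₃| + |C₄|) / d ^ 5 * A ^ 5 = |C₀| / d ^ 5 * A ^ 5
      + |C₂| / d ^ 5 * A ^ 5 + |C₃| / d ^ 5 * A ^ 5 + |C₄| / d ^ 5 * A ^ 5 := by ring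
    linarith
  exact ⟨_, by positivity, bd⟩

theorem moment_eq (hq : AdmissibleProfile q) (h : Corrections q ω₂ ω₃ ω₄) (d : ℝ) (k : ℕ) :
    moment (approxVorticity q ω₂ ω₃ ω₄ d) k = moment (wStar q) k + ((1 / d ^ 2 : ℝ) * moment ω₂ k
      + (1 / d ^ 3 : ℝ) * moment ω₃ k + (1 / d ^ 4 : ℝ) * moment ω₄ k) := by
  have i0 := (nice_wStar hq).integrable_mul_zc k
  have i2 := (h.nice₂.integrable_mul_zc k).const_mul ((1 / d ^ 2 : ℝ) : ℂ)
  have i3 := (h.nice₃.integrable_mul_zc k).const_mul ((1 / d ^ 3 : ℝ) : ℂ)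
  have i4 := (h.nice₄.integrable_mul_zc k).const_mul ((1 / d ^ 4 : ℝ) : ℂ)
  have e : ∀ y, (approxVorticity q ω₂ ω₃ ω₄ d y : ℂ) * zc y ^ k = (wStar q y : ℂ) * zc y ^ k
      + (((1 / d ^ 2 : ℝ) : ℂ) * ((ω₂ y : ℂ) * zc y ^ k)
      + ((1 / d ^ 3 : ℝ) : ℂ) * ((ω₃ y : ℂ) * zc y ^ k)
      + ((1 / d ^ 4 : ℝ) : ℂ) * ((ω₄ y : ℂ) * zc y ^ k)) := fun y => by
    rw [approxVorticity]
    push_cast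
    ring
  simp only [moment, e]
  refine (integral_add i0 ((i2.add i3).add i4)).trans (congrArg _ ?_)
  refine (integral_add (i2.add i3) i4).trans ?_
  rw [integral_const_mul]
  refine congrArg (· + _) ((integral_add i2 i3).trans ?_)
  rw [integral_const_mul, integral_const_mul]

/-- Only the unit mass of w_* contributes below order d⁻⁵, giving 1/d; vanishing moments and powers
of 1/d balance for the corrections as in the far field. -/
theorem exists_farPoly_integral_bound (hq : AdmissibleProfile q) (h : Corrections q ω₂ ω₃ ω₄) :
    ∃ C, ∀ d : ℝ, 1 ≤ d →
      ‖(∫ x, (approxVorticity q ω₂ ω₃ ω₄ d x : ℂ) * farPoly d (zc x)) - 1 / d‖ ≤ C / d ^ 5 := by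
  obtain ⟨C₂, h₂⟩ := exists_moment_sum_bound h.moment₂
  obtain ⟨C₃, h₃⟩ := exists_moment_sum_bound h.moment₃
  obtain ⟨C₄, h₄⟩ := exists_moment_sum_bound (ω := ω₄) (K := 0) (by simp)
  refine ⟨C₂ + C₃ + C₄, fun d hd => ?_⟩
  have hd0 : 0 < d := by linarith
  have hN := h.nice hq d
  let c : ℕ → ℂ := fun k => (-1) ^ k / (d : ℂ) ^ (k + 1)
  have e1 : ∫ x, (approxVorticity q ω₂ ω₃ ω₄ d x : ℂ) * farPoly d (zc x)
      = ∑ k ∈ Finset.range 4, c k * moment (approxVorticity q ω₂ ω₃ ω₄ d) k := by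
    simp only [moment, ← integral_const_mul]
    rw [← integral_finsetSum _ fun k _ => (hN.integrable_mul_zc k).const_mul _]
    refine integral_congr_ae (Filter.Eventually.of_forall fun x => ?_)
    simp only [farPoly, Finset.mul_sum]
    exact Finset.sum_congr rfl fun k _ => by ring
  have e0 : ∑ k ∈ Finset.range 4, c k * moment (wStar q) k = 1 / d := by
    rw [Finset.sum_eq_single 0]
    · rw [moment_zero_eq, hq.mass]; simp [c]
    · intro k hk hk0
      rw [Finset.mem_range] at hk
      rw [moment_wStar (by omega) (by omega), mul_zero]
    · simp
  have e2 : (∑ k ∈ Finset.range 4, c k * moment (approxVorticity q ω₂ ω₃ ω₄ d) k) - 1 / d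
      = ((1 / d ^ 2 : ℝ) : ℂ) * (∑ k ∈ Finset.range 4, c k * moment ω₂ k)
      + ((1 / d ^ 3 : ℝ) : ℂ) * (∑ k ∈ Finset.range 4, c k * moment ω₃ k)
      + ((1 / d ^ 4 : ℝ) : ℂ) * (∑ k ∈ Finset.range 4, c k * moment ω₄ k) := by
    rw [← e0]
    simp only [h.moment_eq hq, Finset.mul_sum, ← Finset.sum_add_distrib, ← Finset.sum_sub_distrib]
    exact Finset.sum_congr rfl fun k _ => by ring
  have scale : ∀ {C : ℝ} {K m : ℕ} {f : ℂ}, K + m = 4 → ‖f‖ ≤ C / d ^ (K + 1) →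
      ‖((1 / d ^ m : ℝ) : ℂ) * f‖ ≤ C / d ^ 5 := fun {C K m f} hK hf => by
    rw [norm_mul, Complex.norm_real, Real.norm_of_nonneg (by positivity)]
    calc 1 / d ^ m * ‖f‖ ≤ 1 / d ^ m * (C / d ^ (K + 1)) := by gcongr
      _ = C / d ^ 5 := by
          rw [div_mul_div_comm, one_mul, ← pow_add, show m + (K + 1) = 5 by omega]
  have b2 := scale (m := 2) rfl (h₂ d hd)
  have b3 := scale (m := 3) rfl (h₃ d hd)
  have b4 := scale (m := 4) rfl (h₄ d hd)
  rw [e1, e2, add_div, add_div]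
  exact (norm_add_le _ _).trans (add_le_add ((norm_add_le _ _).trans (add_le_add b2 b3)) b4)

theorem abs_approxVorticity_le {d : ℝ} (hd : 1 ≤ d) (x : Plane) :
    |approxVorticity q ω₂ ω₃ ω₄ d x| ≤ |wStar q x| + (|ω₂ x| + |ω₃ x| + |ω₄ x|) := by
  have h1 : ∀ (m : ℕ) (a : ℝ), |1 / d ^ m * a| ≤ |a| := fun m a => by
    rw [abs_mul, abs_of_nonneg (by positivity)]
    exact mul_le_of_le_one_left (abs_nonneg _) (by
      rw [div_le_one (by positivity)]; exact one_le_pow₀ hd)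
  refine (abs_add_le _ _).trans (add_le_add le_rfl ?_)
  refine (abs_add_le _ _).trans (add_le_add ((abs_add_le _ _).trans (add_le_add ?_ ?_)) ?_) <;>
    exact h1 _ _

/-- The leading velocity at the partner vortex is 1/(2πd), and the prefactor 2/d makes this 1/(πd²).
The order d⁻⁶ of the error is needed because the speed later multiplies the center, of size d/2. -/
theorem exists_angularSpeed_bound (hq : AdmissibleProfile q) (h : Corrections q ω₂ ω₃ ω₄) :
    ∃ C, 0 ≤ C ∧ ∀ d : ℝ, 1 ≤ d →
      |angularSpeed d (approxVorticity q ω₂ ω₃ ω₄ d) - 1 / (Real.pi * d ^ 2)| ≤ C / d ^ 6 := by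
  obtain ⟨C₁, hC₁, h₁⟩ := h.exists_reflected_velocity_bound hq
  obtain ⟨C₂, h₂⟩ := h.exists_farPoly_integral_bound hq
  let W : Plane → ℝ := fun x => (1 + ‖x‖) ^ 5 * (|wStar q x| + (|ω₂ x| + |ω₃ x| + |ω₄ x|))
  have iW : Integrable W := by
    have i : ∀ {ω : Plane → ℝ}, Nice q ω → Integrable fun x => (1 + ‖x‖) ^ 5 * |ω x| :=
      fun {ω} hω => by
        have hc := hω.smooth.continuous
        exact integrable_decay_mul hω (C := 1) (N := 5)
          (by fun_prop : Continuous fun x => (1 + ‖x‖) ^ 5 * |ω x|).aestronglyMeasurable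
          fun y => by rw [Real.norm_of_nonneg (by positivity), one_mul]
    refine ((i (nice_wStar hq)).add (((i h.nice₂).add (i h.nice₃)).add (i h.nice₄))).congr
      (Filter.Eventually.of_forall fun x => ?_)
    simp only [W, Pi.add_apply]
    ring
  have bd : ∀ d : ℝ, 1 ≤ d →
      |angularSpeed d (approxVorticity q ω₂ ω₃ ω₄ d) - 1 / (Real.pi * d ^ 2)|
        ≤ 2 * (|C₂| + C₁ * ∫ x, W x) / d ^ 6 := fun d hd => by
    have hd0 : 0 < d := by linarith
    have hpi := Real.pi_pos
    set w := approxVorticity q ω₂ ω₃ ω₄ d with hw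
    have hN : Nice q w := h.nice hq d
    let V : Plane → ℂ := fun x => starRingEnd ℂ (zc (biotSavart w (reflect d x)))
    let E : Plane → ℂ := fun x => V x - Complex.I / (2 * Real.pi) * farPoly d (zc x)
    have cV : Continuous V :=
      Complex.continuous_conj.comp (zc.continuous.comp (hN.vel.comp (continuous_reflect d)))
    have cw : Continuous fun x => (w x : ℂ) := Complex.continuous_ofReal.comp hN.smooth.continuous
    have iV : Integrable fun x => (w x : ℂ) * V x := by
      obtain ⟨M, hM⟩ := hN.exists_vel_bound
      refine integrable_decay_mul hN (C := M) (N := 0) (cw.mul cV).aestronglyMeasurable fun y => ?_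
      rw [norm_mul, Complex.norm_real, Real.norm_eq_abs, RCLike.norm_conj,
        LinearIsometryEquiv.norm_map, pow_zero, one_mul, mul_comm]
      gcongr
      exact hM _
    have iP : Integrable fun x => (w x : ℂ) * farPoly d (zc x) := by
      have := integrable_finsetSum (Finset.range 4) fun k _ =>
        (hN.integrable_mul_zc k).const_mul ((-1) ^ k / (d : ℂ) ^ (k + 1))
      refine this.congr (Filter.Eventually.of_forall fun x => ?_)
      simp only [farPoly, Finset.mul_sum]
      exact Finset.sum_congr rfl fun k _ => by ring
    have bE : ∀ x, ‖E x‖ ≤ C₁ / d ^ 5 * (1 + ‖x‖) ^ 5 := fun x => by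
      have := h₁ d hd0 x
      rwa [← h.biotSavart_eq hq] at this
    have e1 : ∫ x, (w x : ℂ) * V x = Complex.I / (2 * Real.pi) *
        (∫ x, (w x : ℂ) * farPoly d (zc x)) + ∫ x, (w x : ℂ) * E x := by
      have iE : Integrable fun x => (w x : ℂ) * E x := by
        refine (iV.sub (iP.const_mul (Complex.I / (2 * Real.pi)))).congr
          (Filter.Eventually.of_forall fun x => ?_)
        simp only [Pi.sub_apply, E]
        ring
      rw [← integral_const_mul, ← integral_add (iP.const_mul _) iE]
      refine integral_congr_ae (Filter.Eventually.of_forall fun x => ?_)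
      simp only [E]
      ring
    have b1 : ‖∫ x, (w x : ℂ) * E x‖ ≤ C₁ / d ^ 5 * ∫ x, W x := by
      rw [← integral_const_mul]
      refine norm_integral_le_of_norm_le (iW.const_mul _) (Filter.Eventually.of_forall fun x => ?_)
      rw [norm_mul, Complex.norm_real, Real.norm_eq_abs]
      calc |w x| * ‖E x‖ ≤ (|wStar q x| + (|ω₂ x| + |ω₃ x| + |ω₄ x|)) *
            (C₁ / d ^ 5 * (1 + ‖x‖) ^ 5) :=
            mul_le_mul (abs_approxVorticity_le hd x) (bE x) (norm_nonneg _) (by positivity)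
        _ = _ := by simp only [W]; ring
    have e2 : ∫ x, biotSavart w (reflect d x) 1 * w x = -(∫ x, (w x : ℂ) * V x).im := by
      have := Complex.imCLM.integral_comp_comm iV
      rw [Complex.imCLM_apply] at this
      rw [← this, ← integral_neg]
      refine integral_congr_ae (Filter.Eventually.of_forall fun x => ?_)
      simp [V]
      ring
    obtain ⟨δ, hδ⟩ : ∃ δ, δ = (∫ x, (w x : ℂ) * farPoly d (zc x)) - 1 / d := ⟨_, rfl⟩
    have b2 : ‖δ‖ ≤ |C₂| / d ^ 5 := by
      rw [hδ]; exact (h₂ d hd).trans (by gcongr; exact le_abs_self _)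
    have e3 : ∫ x, (w x : ℂ) * farPoly d (zc x) = 1 / d + δ := by rw [hδ]; ring
    set e := ∫ x, (w x : ℂ) * E x
    have e4 : angularSpeed d w - 1 / (Real.pi * d ^ 2) = 2 / d * (1 / (2 * Real.pi) * δ.re + e.im) := by
      have e5 : angularSpeed d w = -(2 / d) * ∫ x, biotSavart w (reflect d x) 1 * w x := rfl
      have e6 : (Complex.I / (2 * Real.pi) * (1 / d + δ)).im = 1 / (2 * Real.pi) * (1 / d + δ.re) := by
        rw [show Complex.I / (2 * Real.pi) = ((1 / (2 * Real.pi) : ℝ) : ℂ) * Complex.I by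
          push_cast; ring, mul_assoc, Complex.im_ofReal_mul, Complex.I_mul_im, Complex.add_re,
          show (1 / (d : ℂ)) = ((1 / d : ℝ) : ℂ) by push_cast; ring, Complex.ofReal_re]
      rw [e5, e2, e1, e3, Complex.add_im, e6]
      field_simp
      ring
    have h3 : |1 / (2 * Real.pi) * δ.re| ≤ |C₂| / d ^ 5 := by
      rw [abs_mul, abs_of_nonneg (by positivity)]
      refine (mul_le_of_le_one_left (abs_nonneg _) ?_).trans ((Complex.abs_re_le_norm δ).trans b2)
      rw [div_le_one (by positivity)]
      linarith [Real.pi_gt_three]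
    have h4 : |e.im| ≤ C₁ / d ^ 5 * ∫ x, W x := (Complex.abs_im_le_norm e).trans b1
    rw [e4, abs_mul, abs_of_nonneg (by positivity)]
    calc 2 / d * |1 / (2 * Real.pi) * δ.re + e.im|
        ≤ 2 / d * (|C₂| / d ^ 5 + C₁ / d ^ 5 * ∫ x, W x) := by
          gcongr
          exact (abs_add_le _ _).trans (add_le_add h3 h4)
      _ = _ := by field_simp
  exact ⟨_, mul_nonneg two_pos.le (add_nonneg (abs_nonneg _) (mul_nonneg hC₁
    (integral_nonneg fun x => by positivity))), bd⟩

end Corrections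

end VortexPair

namespace VortexPair

/-! ### The strain fields of the distant vortex -/

/-- The strain field of order `d^{-2}`. -/
def strain₂ (x : Plane) : Plane :=
  vec (1 / (2 * Real.pi) * x 1) (-(1 / (2 * Real.pi) * (3 * x 0)))

/-- The strain field of order `d^{-3}`. -/
def strain₃ (x : Plane) : Plane :=
  vec (1 / (2 * Real.pi) * (zc x ^ 2).im) (1 / (2 * Real.pi) * (zc x ^ 2).re)

/-- The strain field of order `d^{-4}`. -/
def strain₄ (x : Plane) : Plane :=
  vec (-(1 / (2 * Real.pi) * (zc x ^ 3).im)) (-(1 / (2 * Real.pi) * (zc x ^ 3).re))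

theorem conj_zc_vec (a b : ℝ) : starRingEnd ℂ (zc (vec a b)) = a - b * Complex.I := by
  apply Complex.ext <;> simp

theorem conj_zc_strain₂ (x : Plane) : starRingEnd ℂ (zc (strain₂ x))
    = Complex.I / (2 * Real.pi) * (zc x + 2 * starRingEnd ℂ (zc x)) := by
  rw [strain₂, conj_zc_vec, zc_apply, show Complex.I / (2 * Real.pi)
    = ((1 / (2 * Real.pi) : ℝ) : ℂ) * Complex.I by push_cast; ring]
  apply Complex.ext <;> simp [-Complex.ofReal_mul, -Complex.ofReal_inv] <;> ring

theorem conj_zc_strain₃ (x : Plane) : starRingEnd ℂ (zc (strain₃ x))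
    = -(Complex.I / (2 * Real.pi) * zc x ^ 2) := by
  rw [strain₃, conj_zc_vec, show Complex.I / (2 * Real.pi)
    = ((1 / (2 * Real.pi) : ℝ) : ℂ) * Complex.I by push_cast; ring]
  apply Complex.ext <;> simp [-Complex.ofReal_mul, -Complex.ofReal_inv]

theorem conj_zc_strain₄ (x : Plane) : starRingEnd ℂ (zc (strain₄ x))
    = Complex.I / (2 * Real.pi) * zc x ^ 3 := by
  rw [strain₄, conj_zc_vec, show Complex.I / (2 * Real.pi)
    = ((1 / (2 * Real.pi) : ℝ) : ℂ) * Complex.I by push_cast; ring]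
  apply Complex.ext <;> simp [-Complex.ofReal_mul, -Complex.ofReal_inv]

theorem norm_vec_le_of_le {a b c : ℝ} (ha : |a| ≤ c) (hb : |b| ≤ c) : ‖vec a b‖ ≤ 2 * c :=
  (norm_vec_le a b).trans (by linarith)

theorem norm_strain_le (x : Plane) : ‖strain₂ x‖ ≤ 2 * (1 + ‖x‖) ^ 3 ∧
    ‖strain₃ x‖ ≤ 2 * (1 + ‖x‖) ^ 3 ∧ ‖strain₄ x‖ ≤ 2 * (1 + ‖x‖) ^ 3 := by
  have h0 := norm_nonneg x
  have h1 : 1 ≤ 1 + ‖x‖ := by linarith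
  have hp : 1 / (2 * Real.pi) * 3 ≤ 1 := by
    rw [div_mul_eq_mul_div, div_le_one (by positivity)]; linarith [Real.pi_gt_three]
  have hp0 : 0 ≤ 1 / (2 * Real.pi) := by positivity
  have key : ∀ {a : ℝ}, |a| ≤ 3 * (1 + ‖x‖) ^ 3 → |1 / (2 * Real.pi) * a| ≤ (1 + ‖x‖) ^ 3 :=
    fun {a} ha => by
      rw [abs_mul, abs_of_nonneg hp0]
      calc 1 / (2 * Real.pi) * |a| ≤ 1 / (2 * Real.pi) * (3 * (1 + ‖x‖) ^ 3) := by gcongr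
        _ = 1 / (2 * Real.pi) * 3 * (1 + ‖x‖) ^ 3 := by ring
        _ ≤ 1 * (1 + ‖x‖) ^ 3 := by gcongr
        _ = _ := one_mul _
  have l1 : ‖x‖ ≤ (1 + ‖x‖) ^ 3 := by
    calc ‖x‖ ≤ (1 + ‖x‖) ^ 1 := by linarith
      _ ≤ _ := pow_le_pow_right₀ h1 (by norm_num)
  have lz : ∀ k ≤ 3, ‖zc x ^ k‖ ≤ 3 * (1 + ‖x‖) ^ 3 := fun k hk => by
    rw [norm_pow, LinearIsometryEquiv.norm_map]
    calc ‖x‖ ^ k ≤ (1 + ‖x‖) ^ k := by gcongr; linarith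
      _ ≤ (1 + ‖x‖) ^ 3 := pow_le_pow_right₀ h1 hk
      _ ≤ _ := by linarith [pow_pos (by linarith : 0 < 1 + ‖x‖) 3]
  refine ⟨norm_vec_le_of_le (key ?_) ?_, norm_vec_le_of_le (key ?_) (key ?_),
    norm_vec_le_of_le ?_ ?_⟩
  · linarith [abs_coord_le x 1]
  · rw [abs_neg]
    refine key ?_
    rw [abs_mul, abs_of_pos (by norm_num : (0 : ℝ) < 3)]
    linarith [abs_coord_le x 0]
  · exact (Complex.abs_im_le_norm _).trans (lz 2 (by norm_num))
  · exact (Complex.abs_re_le_norm _).trans (lz 2 (by norm_num))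
  · rw [abs_neg]; exact key ((Complex.abs_im_le_norm _).trans (lz 3 le_rfl))
  · rw [abs_neg]; exact key ((Complex.abs_re_le_norm _).trans (lz 3 le_rfl))

theorem farPoly_eq {d : ℝ} (z : ℂ) :
    farPoly d z = 1 / d - z / d ^ 2 + z ^ 2 / d ^ 3 - z ^ 3 / d ^ 4 := by
  simp only [farPoly, Finset.sum_range_succ, Finset.sum_range_zero]
  ring

namespace Corrections

variable {q : ℝ → ℝ} {ω₂ ω₃ ω₄ : Plane → ℝ}

/-- The part of the velocity due to the distant vortex and the rotation. -/
def outerVelocity (q : ℝ → ℝ) (ω₂ ω₃ ω₄ : Plane → ℝ) (d : ℝ) (x : Plane) : Plane :=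
  -approxVelocity q ω₂ ω₃ ω₄ d (reflect d x)
    - angularSpeed d (approxVorticity q ω₂ ω₃ ω₄ d) • perp (x + center d)

theorem exists_outerVelocity_bound (hq : AdmissibleProfile q) (h : Corrections q ω₂ ω₃ ω₄) :
    ∃ C, 0 ≤ C ∧ ∀ d : ℝ, 1 ≤ d → ∀ x : Plane,
      ‖outerVelocity q ω₂ ω₃ ω₄ d x - ((1 / d ^ 2) • strain₂ x + (1 / d ^ 3) • strain₃ x
        + (1 / d ^ 4) • strain₄ x)‖ ≤ C / d ^ 5 * (1 + ‖x‖) ^ 5 := by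
  obtain ⟨C₁, hC₁, h₁⟩ := h.exists_reflected_velocity_bound hq
  obtain ⟨C₂, hC₂, h₂⟩ := h.exists_angularSpeed_bound hq
  refine ⟨C₁ + C₂, add_nonneg hC₁ hC₂, fun d hd x => ?_⟩
  have hd0 : 0 < d := by linarith
  have hx := norm_nonneg x
  have b1 := h₁ d hd0 x
  have b2 := h₂ d hd
  obtain ⟨Ω, hΩ⟩ : ∃ Ω, Ω = angularSpeed d (approxVorticity q ω₂ ω₃ ω₄ d) := ⟨_, rfl⟩
  obtain ⟨V, hV⟩ : ∃ V, V = starRingEnd ℂ (zc (approxVelocity q ω₂ ω₃ ω₄ d (reflect d x))) :=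
    ⟨_, rfl⟩
  rw [← hV] at b1
  rw [← hΩ] at b2
  -- The constant term i/(2πd) of the far field cancels the rotation of the center, (1/(πd²)) · d/2.
  -- The rotation of x itself joins the linear term of the far field, which accounts for the
  -- conjugate of z in `strain₂`.
  have e : starRingEnd ℂ (zc (outerVelocity q ω₂ ω₃ ω₄ d x - ((1 / d ^ 2) • strain₂ x
      + (1 / d ^ 3) • strain₃ x + (1 / d ^ 4) • strain₄ x)))
      = -(V - Complex.I / (2 * Real.pi) * farPoly d (zc x))
        + ((Ω - 1 / (Real.pi * d ^ 2) : ℝ) : ℂ) * (Complex.I * (starRingEnd ℂ (zc x) + d / 2)) := by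
    rw [outerVelocity, ← hΩ]
    simp only [map_sub, map_add, map_neg, map_smul, Complex.real_smul, map_mul,
      Complex.conj_ofReal, conj_zc_strain₂, conj_zc_strain₃, conj_zc_strain₄, zc_perp, zc_center,
      Complex.conj_I, ← hV, farPoly_eq, map_div₀, map_ofNat]
    have hdc : (d : ℂ) ≠ 0 := by exact_mod_cast hd0.ne'
    have hpc : (Real.pi : ℂ) ≠ 0 := by exact_mod_cast Real.pi_ne_zero
    push_cast
    field_simp
    ring
  rw [← LinearIsometryEquiv.norm_map zc, ← RCLike.norm_conj, e]
  refine (norm_add_le _ _).trans ?_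
  rw [norm_neg, norm_mul, norm_mul, Complex.norm_I, one_mul, Complex.norm_real, Real.norm_eq_abs]
  have b3 : ‖starRingEnd ℂ (zc x) + (d : ℂ) / 2‖ ≤ d * (1 + ‖x‖) ^ 5 := by
    refine (norm_add_le _ _).trans ?_
    rw [RCLike.norm_conj, LinearIsometryEquiv.norm_map, norm_div, Complex.norm_real,
      Real.norm_of_nonneg hd0.le, Complex.norm_ofNat]
    calc ‖x‖ + d / 2 ≤ d * (1 + ‖x‖) ^ 1 := by nlinarith
      _ ≤ d * (1 + ‖x‖) ^ 5 := by
          gcongr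
          · linarith
          · norm_num
  calc _ ≤ C₁ / d ^ 5 * (1 + ‖x‖) ^ 5 + C₂ / d ^ 6 * (d * (1 + ‖x‖) ^ 5) := by gcongr
    _ = _ := by field_simp

end Corrections

/-! ### Cancellation of the leading orders -/

theorem fderiv_wStar_apply {q : ℝ → ℝ} (hq : AdmissibleProfile q) (x u : Plane) :
    fderiv ℝ (wStar q) x u = 2 * dq q (‖x‖ ^ 2) / Real.pi * (x 0 * u 0 + x 1 * u 1) := by
  rw [(fderiv_wStar hq x).fderiv, smul_apply, dotForm_apply, smul_eq_mul]

theorem fderiv_wStar_vStar {q : ℝ → ℝ} (hq : AdmissibleProfile q) (x : Plane) :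
    fderiv ℝ (wStar q) x (vStar q x) = 0 := by
  rw [fderiv_wStar_apply hq, vStar_eq_vec hq, vec_zero, vec_one]
  ring

/-- The field `strain₂` is a pure strain minus the rotation x^⊥/π; only the strain is seen by the
radial gradient ∇w_*. -/
theorem fderiv_wStar_strain₂ {q : ℝ → ℝ} (hq : AdmissibleProfile q) (x : Plane) :
    fderiv ℝ (wStar q) x (strain₂ x) = forcing q 2 x := by
  have h := im_zc_pow 2 x
  rw [fderiv_wStar_apply hq, strain₂, vec_zero, vec_one]
  rw [forcing, gCoef, show -(2 * dq q (‖x‖ ^ 2)) / Real.pi / (2 * Real.pi) * (-1) ^ 2 * ‖x‖ ^ 2 *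
    Real.sin ((2 : ℕ) * angle x) = -(2 * dq q (‖x‖ ^ 2)) / Real.pi / (2 * Real.pi) *
    (‖x‖ ^ 2 * Real.sin ((2 : ℕ) * angle x)) by ring, ← h, pow_two (zc x), Complex.mul_im, zc_re,
    zc_im]
  ring

theorem fderiv_wStar_strain₃ {q : ℝ → ℝ} (hq : AdmissibleProfile q) (x : Plane) :
    fderiv ℝ (wStar q) x (strain₃ x) = forcing q 3 x := by
  have h := im_zc_pow 3 x
  rw [fderiv_wStar_apply hq, strain₃, vec_zero, vec_one]
  rw [forcing, gCoef, show -(2 * dq q (‖x‖ ^ 2)) / Real.pi / (2 * Real.pi) * (-1) ^ 3 * ‖x‖ ^ 3 *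
    Real.sin ((3 : ℕ) * angle x) = (2 * dq q (‖x‖ ^ 2)) / Real.pi / (2 * Real.pi) *
    (‖x‖ ^ 3 * Real.sin ((3 : ℕ) * angle x)) by ring, ← h, pow_succ (zc x) 2, Complex.mul_im, zc_re,
    zc_im]
  ring

/-- Four sources meet at order d⁻⁴. `strain₄` on ∇w_* gives the r⁴g term of B, the self-interaction
of ω⁽²⁾ the bracket A₂'a₂ - A₂a₂', the strain part of `strain₂` on ∇ω⁽²⁾ the term 2a₂ - ra₂', and
its rotation part the coefficient C of sin 2θ. -/
theorem fourth_order {q φ α b : ℝ → ℝ} (hq : AdmissibleProfile q) (hs : RadialSolution q 2 φ α b)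
    (x : Plane) :
    fderiv ℝ (wStar q) x (strain₄ x)
      + fderiv ℝ (mode 2 1 b) x (biotSavart (mode 2 1 b) x + strain₂ x)
      = forcingFour q (mode 2 1 b) x := by
  rw [forcingFour_eq hs, fderiv_wStar_apply hq, biotSavart_mode le_rfl hs,
    (hs.adm.smooth.hasFDerivAt_mode 2 1 x).fderiv, modeDeriv_apply, fourthCoef]
  simp only [modeVel, mode, strain₂, strain₄, PiLp.add_apply, vec_zero, vec_one, map_add]
  generalize dq α (‖x‖ ^ 2) = α₁
  generalize α (‖x‖ ^ 2) = α₀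
  generalize dq b (‖x‖ ^ 2) = b₁
  generalize b (‖x‖ ^ 2) = b₀
  generalize dq q (‖x‖ ^ 2) = q₁
  simp [pow_succ, -Complex.ofReal_mul, -Complex.ofReal_inv]
  field_simp
  ring

end VortexPair

namespace VortexPair

/-! ### The residual -/

/-- The pairing is bilinear in expansions in 1/d without first-order terms. The hypotheses cancel
orders 0, 2, 3 and 4, every remaining product has order between 5 and 8, and the error R is of order
5 by assumption. -/
theorem abs_residual_le {L₀ L₂ L₃ L₄ : Plane →L[ℝ] ℝ} {v₀ V₂ V₃ V₄ R : Plane} {d ρ : ℝ} (hd : 1 ≤ d)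
    (h₀ : L₀ v₀ = 0) (h₂ : L₂ v₀ + L₀ V₂ = 0) (h₃ : L₃ v₀ + L₀ V₃ = 0)
    (h₄ : L₄ v₀ + L₀ V₄ + L₂ V₂ = 0) (hR : ‖R‖ ≤ ρ / d ^ 5) :
    |(L₀ + ((1 / d ^ 2) • L₂ + (1 / d ^ 3) • L₃ + (1 / d ^ 4) • L₄))
      (v₀ + ((1 / d ^ 2) • V₂ + (1 / d ^ 3) • V₃ + (1 / d ^ 4) • V₄) + R)|
      ≤ (‖L₀‖ + (‖L₂‖ + ‖L₃‖ + ‖L₄‖)) * (‖V₂‖ + ‖V₃‖ + ‖V₄‖ + ρ) / d ^ 5 := by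
  have hd0 : 0 < d := by linarith
  obtain ⟨e, he⟩ : ∃ e, e = 1 / d := ⟨_, rfl⟩
  have he0 : 0 ≤ e := by rw [he]; positivity
  have he1 : e ≤ 1 := by rw [he, div_le_one hd0]; exact hd
  have ep : ∀ n : ℕ, 1 / d ^ n = e ^ n := fun n => by rw [he, one_div_pow]
  rw [div_eq_mul_one_div _ (d ^ 5), ep] at hR
  rw [div_eq_mul_one_div _ (d ^ 5), ep, ep, ep, ep]
  set L := L₀ + (e ^ 2 • L₂ + e ^ 3 • L₃ + e ^ 4 • L₄) with hL
  have hpow : ∀ n : ℕ, e ^ n ≤ 1 := fun n => pow_le_one₀ he0 he1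
  have hsm : ∀ (n : ℕ) (M : Plane →L[ℝ] ℝ), ‖e ^ n • M‖ ≤ ‖M‖ := fun n M => by
    rw [norm_smul, Real.norm_of_nonneg (by positivity)]
    exact mul_le_of_le_one_left (norm_nonneg _) (hpow n)
  have hLn : ‖L‖ ≤ ‖L₀‖ + (‖L₂‖ + ‖L₃‖ + ‖L₄‖) :=
    (norm_add_le _ _).trans (add_le_add le_rfl ((norm_add_le _ _).trans (add_le_add
      ((norm_add_le _ _).trans (add_le_add (hsm _ _) (hsm _ _))) (hsm _ _))))
  have key : L (v₀ + (e ^ 2 • V₂ + e ^ 3 • V₃ + e ^ 4 • V₄) + R)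
      = e ^ 5 * ((L₂ V₃ + L₃ V₂) + e ^ 1 * (L₂ V₄ + L₃ V₃ + L₄ V₂) + e ^ 2 * (L₃ V₄ + L₄ V₃)
        + e ^ 3 * L₄ V₄) + L R := by
    rw [map_add, hL]
    simp only [add_apply, smul_apply, map_add, map_smul, smul_eq_mul]
    linear_combination h₀ + e ^ 2 * h₂ + e ^ 3 * h₃ + e ^ 4 * h₄
  have b : ∀ (M : Plane →L[ℝ] ℝ) (V : Plane), |M V| ≤ ‖M‖ * ‖V‖ := fun M V => M.le_opNorm V
  have bp : ∀ (n : ℕ) (a : ℝ), |e ^ n * a| ≤ |a| := fun n a => by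
    rw [abs_mul, abs_of_nonneg (by positivity)]
    exact mul_le_of_le_one_left (abs_nonneg _) (hpow n)
  have b1 : |(L₂ V₃ + L₃ V₂) + e ^ 1 * (L₂ V₄ + L₃ V₃ + L₄ V₂) + e ^ 2 * (L₃ V₄ + L₄ V₃)
        + e ^ 3 * L₄ V₄| ≤ (‖L₀‖ + (‖L₂‖ + ‖L₃‖ + ‖L₄‖)) * (‖V₂‖ + ‖V₃‖ + ‖V₄‖) := by
    have t1 := abs_add_le ((L₂ V₃ + L₃ V₂) + e ^ 1 * (L₂ V₄ + L₃ V₃ + L₄ V₂)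
      + e ^ 2 * (L₃ V₄ + L₄ V₃)) (e ^ 3 * L₄ V₄)
    have t2 := abs_add_le ((L₂ V₃ + L₃ V₂) + e ^ 1 * (L₂ V₄ + L₃ V₃ + L₄ V₂))
      (e ^ 2 * (L₃ V₄ + L₄ V₃))
    have t3 := abs_add_le (L₂ V₃ + L₃ V₂) (e ^ 1 * (L₂ V₄ + L₃ V₃ + L₄ V₂))
    have t4 := bp 1 (L₂ V₄ + L₃ V₃ + L₄ V₂)
    have t5 := bp 2 (L₃ V₄ + L₄ V₃)
    have t6 := bp 3 (L₄ V₄)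
    have t7 := abs_add_le (L₂ V₃) (L₃ V₂)
    have t8 := abs_add_three (L₂ V₄) (L₃ V₃) (L₄ V₂)
    have t9 := abs_add_le (L₃ V₄) (L₄ V₃)
    have n0 : 0 ≤ ‖L₀‖ * (‖V₂‖ + ‖V₃‖ + ‖V₄‖) + ‖L₂‖ * ‖V₂‖ := by positivity
    have t10 : (‖L₀‖ + (‖L₂‖ + ‖L₃‖ + ‖L₄‖)) * (‖V₂‖ + ‖V₃‖ + ‖V₄‖)
      = ‖L₀‖ * (‖V₂‖ + ‖V₃‖ + ‖V₄‖) + ‖L₂‖ * ‖V₂‖ + (‖L₂‖ * ‖V₃‖ + ‖L₃‖ * ‖V₂‖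
        + (‖L₂‖ * ‖V₄‖ + ‖L₃‖ * ‖V₃‖ + ‖L₄‖ * ‖V₂‖) + (‖L₃‖ * ‖V₄‖ + ‖L₄‖ * ‖V₃‖)
        + ‖L₄‖ * ‖V₄‖) := by ring
    linarith [b L₂ V₃, b L₃ V₂, b L₂ V₄, b L₃ V₃, b L₄ V₂, b L₃ V₄, b L₄ V₃, b L₄ V₄]
  have b2 : |L R| ≤ (‖L₀‖ + (‖L₂‖ + ‖L₃‖ + ‖L₄‖)) * (ρ * e ^ 5) :=
    (b L R).trans (mul_le_mul hLn hR (norm_nonneg _) (by positivity))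
  rw [key]
  refine (abs_add_le _ _).trans ?_
  rw [abs_mul, abs_of_nonneg (by positivity : 0 ≤ e ^ 5)]
  calc _ ≤ e ^ 5 * ((‖L₀‖ + (‖L₂‖ + ‖L₃‖ + ‖L₄‖)) * (‖V₂‖ + ‖V₃‖ + ‖V₄‖))
        + (‖L₀‖ + (‖L₂‖ + ‖L₃‖ + ‖L₄‖)) * (ρ * e ^ 5) := by gcongr
    _ = _ := by ring

namespace Corrections

variable {q : ℝ → ℝ} {ω₂ ω₃ ω₄ : Plane → ℝ}

/-- The sum of the norms of the gradients of all profiles. -/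
def gradSum (q : ℝ → ℝ) (ω₂ ω₃ ω₄ : Plane → ℝ) (x : Plane) : ℝ :=
  ‖fderiv ℝ (wStar q) x‖ + (‖fderiv ℝ ω₂ x‖ + ‖fderiv ℝ ω₃ x‖ + ‖fderiv ℝ ω₄ x‖)

theorem fderiv_eq (hq : AdmissibleProfile q) (h : Corrections q ω₂ ω₃ ω₄) (d : ℝ) (x : Plane) :
    fderiv ℝ (approxVorticity q ω₂ ω₃ ω₄ d) x = fderiv ℝ (wStar q) x
      + ((1 / d ^ 2) • fderiv ℝ ω₂ x + (1 / d ^ 3) • fderiv ℝ ω₃ x + (1 / d ^ 4) • fderiv ℝ ω₄ x) :=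
  (((nice_wStar hq).differentiable x).hasFDerivAt.add
    ((((h.nice₂.differentiable x).hasFDerivAt.const_mul _).add
      ((h.nice₃.differentiable x).hasFDerivAt.const_mul _)).add
      ((h.nice₄.differentiable x).hasFDerivAt.const_mul _))).fderiv

theorem steadyResidual_eq (q : ℝ → ℝ) (ω₂ ω₃ ω₄ : Plane → ℝ) (d : ℝ) (x : Plane) :
    steadyResidual q ω₂ ω₃ ω₄ d x = fderiv ℝ (approxVorticity q ω₂ ω₃ ω₄ d) x
      (approxVelocity q ω₂ ω₃ ω₄ d x + outerVelocity q ω₂ ω₃ ω₄ d x) := by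
  rw [steadyResidual, pairResidual, outerVelocity, reflect]
  congr 1
  abel

theorem continuous_steadyResidual (hq : AdmissibleProfile q) (h : Corrections q ω₂ ω₃ ω₄) (d : ℝ) :
    Continuous (steadyResidual q ω₂ ω₃ ω₄ d) := by
  have hN := h.nice hq d
  have hv := hN.vel
  rw [show biotSavart (approxVorticity q ω₂ ω₃ ω₄ d) = _ from funext (h.biotSavart_eq hq d)] at hv
  have hp : Continuous (perp : Plane → Plane) := by
    have := perpL.continuous
    rwa [show (perpL : Plane → Plane) = perp from funext perpL_apply] at this
  refine hN.continuous_fderiv.clm_apply ((hv.sub (hv.comp (continuous_reflect d))).sub ?_)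
  have hc : Continuous fun x : Plane => perp (x + center d) :=
    hp.comp (continuous_id.add continuous_const)
  exact hc.const_smul (angularSpeed d (approxVorticity q ω₂ ω₃ ω₄ d))

/-- Combining K[ω⁽ⁿ⁾] with the strain of the same order into one velocity, the profile equations
become precisely the cancellations order by order. The velocities grow polynomially, and the
gradients are kept as a factor to supply decay. -/
theorem exists_residual_bound (hq : AdmissibleProfile q) (h : Corrections q ω₂ ω₃ ω₄)
    (h₂ : LambdaPt q ω₂ fun x => -forcing q 2 x) (h₃ : LambdaPt q ω₃ fun x => -forcing q 3 x)
    (h₄ : LambdaPt q ω₄ fun x => -forcingFour q ω₂ x)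
    (h₄' : ∀ x, fderiv ℝ (wStar q) x (strain₄ x)
      + fderiv ℝ ω₂ x (biotSavart ω₂ x + strain₂ x) = forcingFour q ω₂ x) :
    ∃ C, 0 ≤ C ∧ ∀ d : ℝ, 1 ≤ d → ∀ x : Plane,
      |steadyResidual q ω₂ ω₃ ω₄ d x| ≤ C / d ^ 5 * ((1 + ‖x‖) ^ 5 * gradSum q ω₂ ω₃ ω₄ x) := by
  obtain ⟨C, hC, hb⟩ := h.exists_outerVelocity_bound hq
  obtain ⟨M₂, hM₂⟩ := h.nice₂.exists_vel_bound
  obtain ⟨M₃, hM₃⟩ := h.nice₃.exists_vel_bound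
  obtain ⟨M₄, hM₄⟩ := h.nice₄.exists_vel_bound
  have p₂ := (norm_nonneg _).trans (hM₂ 0)
  have p₃ := (norm_nonneg _).trans (hM₃ 0)
  have p₄ := (norm_nonneg _).trans (hM₄ 0)
  refine ⟨(M₂ + 2) + (M₃ + 2) + (M₄ + 2) + C, by positivity, fun d hd x => ?_⟩
  have hd0 : 0 < d := by linarith
  have hA : 1 ≤ 1 + ‖x‖ := by linarith [norm_nonneg x]
  have hA0 : 0 < 1 + ‖x‖ := by linarith
  have hs := norm_strain_le x
  have hA3 : (1 + ‖x‖) ^ 3 ≤ (1 + ‖x‖) ^ 5 := pow_le_pow_right₀ hA (by norm_num)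
  have hA5 : 1 ≤ (1 + ‖x‖) ^ 5 := one_le_pow₀ hA
  have bV : ∀ {M : ℝ} {u s : Plane}, 0 ≤ M → ‖u‖ ≤ M → ‖s‖ ≤ 2 * (1 + ‖x‖) ^ 3 →
      ‖u + s‖ ≤ (M + 2) * (1 + ‖x‖) ^ 5 := fun {M u s} hM hu hs => by
    refine (norm_add_le _ _).trans ?_
    nlinarith
  set R := outerVelocity q ω₂ ω₃ ω₄ d x - ((1 / d ^ 2) • strain₂ x + (1 / d ^ 3) • strain₃ x
        + (1 / d ^ 4) • strain₄ x) with hR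
  have hRb : ‖R‖ ≤ C * (1 + ‖x‖) ^ 5 / d ^ 5 := (hb d hd x).trans (le_of_eq (by ring))
  have e : approxVelocity q ω₂ ω₃ ω₄ d x + outerVelocity q ω₂ ω₃ ω₄ d x = vStar q x
      + ((1 / d ^ 2) • (biotSavart ω₂ x + strain₂ x) + (1 / d ^ 3) • (biotSavart ω₃ x + strain₃ x)
        + (1 / d ^ 4) • (biotSavart ω₄ x + strain₄ x)) + R := by
    rw [hR, approxVelocity]
    simp only [smul_add]
    abel
  rw [steadyResidual_eq, e, h.fderiv_eq hq]
  refine (abs_residual_le hd (fderiv_wStar_vStar hq x) ?_ ?_ ?_ hRb).trans ?_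
  · rw [map_add, fderiv_wStar_strain₂ hq]
    linear_combination h₂ x
  · rw [map_add, fderiv_wStar_strain₃ hq]
    linear_combination h₃ x
  · rw [map_add (fderiv ℝ (wStar q) x)]
    linear_combination h₄ x + h₄' x
  · have g0 : 0 ≤ gradSum q ω₂ ω₃ ω₄ x := by unfold gradSum; positivity
    calc _ ≤ gradSum q ω₂ ω₃ ω₄ x * ((M₂ + 2) * (1 + ‖x‖) ^ 5 + (M₃ + 2) * (1 + ‖x‖) ^ 5
          + (M₄ + 2) * (1 + ‖x‖) ^ 5 + C * (1 + ‖x‖) ^ 5) / d ^ 5 := by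
          unfold gradSum
          gcongr
          · exact bV p₂ (hM₂ x) hs.1
          · exact bV p₃ (hM₃ x) hs.2.1
          · exact bV p₄ (hM₄ x) hs.2.2
      _ = _ := by ring

theorem gradSum_nonneg (x : Plane) : 0 ≤ gradSum q ω₂ ω₃ ω₄ x := by unfold gradSum; positivity

theorem planeWsq_gradSum (hq : AdmissibleProfile q) (h : Corrections q ω₂ ω₃ ω₄) :
    PlaneWsq q (gradSum q ω₂ ω₃ ω₄) := by
  have m : ∀ {ω : Plane → ℝ}, Nice q ω → AEStronglyMeasurable (fun x => ‖fderiv ℝ ω x‖) volume :=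
    fun hω => hω.continuous_fderiv.norm.aestronglyMeasurable
  have hw := hq.weightOK
  exact (nice_wStar hq).wsq'.add hw ((h.nice₂.wsq'.add hw h.nice₃.wsq' (m h.nice₂) (m h.nice₃)).add
    hw h.nice₄.wsq' ((m h.nice₂).add (m h.nice₃)) (m h.nice₄)) (m (nice_wStar hq))
    (((m h.nice₂).add (m h.nice₃)).add (m h.nice₄))

theorem decay_gradSum (hq : AdmissibleProfile q) (h : Corrections q ω₂ ω₃ ω₄) (k : ℕ) :
    DecayBy k (gradSum q ω₂ ω₃ ω₄) := by
  have e : ∀ {ω : Plane → ℝ}, Nice q ω → DecayBy k fun x => ‖fderiv ℝ ω x‖ :=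
    fun hω => (hω.decay' k).mono fun x => by rw [norm_norm]
  exact (e (nice_wStar hq)).add (((e h.nice₂).add (e h.nice₃)).add (e h.nice₄))

/-- A vorticity with a pointwise bound of fifth order is of fifth order in `X` and uniformly. -/
theorem exists_norm_bound (hq : AdmissibleProfile q) {Φ : Plane → ℝ} (hΦ : PlaneWsq q Φ)
    (hΦd : DecayBy 5 Φ) (hΦ0 : ∀ x, 0 ≤ Φ x) {F : ℝ → Plane → ℝ}
    (hF : ∀ d, AEStronglyMeasurable (F d) volume) {C : ℝ} (hC : 0 ≤ C)
    (hb : ∀ d : ℝ, 1 ≤ d → ∀ x, |F d x| ≤ C / d ^ 5 * ((1 + ‖x‖) ^ 5 * Φ x)) :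
    ∃ C' : ℝ, ∀ d : ℝ, 1 ≤ d → InX q (F d) ∧ normX q (F d) ≤ C' / d ^ 5 ∧
      ∀ x, |F d x| ≤ C' / d ^ 5 := by
  obtain ⟨S, hS⟩ := hΦd
  have hS0 : 0 ≤ S := (by positivity : (0 : ℝ) ≤ _).trans (hS 0)
  -- The exponent 10 is the square of the fifth-power growth in the pointwise bound.
  set I := ∫ x, (1 + ‖x‖) ^ 10 * (Φ x ^ 2 * weight q x) with hI
  refine ⟨C * (Real.sqrt I + S), fun d hd => ?_⟩
  have hd0 : 0 < d := by linarith
  have hX : InX q (F d) := by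
    refine (hΦ.of_le (c := C / d ^ 5) (l := 5) hq.weightOK (hF d) fun x => ?_).inX hq (hF d)
    rw [abs_of_nonneg (hΦ0 x), mul_assoc]
    exact hb d hd x
  refine ⟨hX, ?_, fun x => ?_⟩
  · have h1 : innerX q (F d) (F d) ≤ (C / d ^ 5) ^ 2 * I := by
      rw [innerX, hI, ← integral_const_mul]
      refine integral_mono (hX.integrable_mul hq.weightOK hX) ((hΦ 10).const_mul _) fun x => ?_
      have hw := hq.weightOK.pos x
      simp only
      rw [← pow_two, ← sq_abs]
      calc |F d x| ^ 2 * weight q x ≤ (C / d ^ 5 * ((1 + ‖x‖) ^ 5 * Φ x)) ^ 2 * weight q x := by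
            gcongr; exact hb d hd x
        _ = _ := by ring
    calc normX q (F d) ≤ Real.sqrt ((C / d ^ 5) ^ 2 * I) := Real.sqrt_le_sqrt h1
      _ = C / d ^ 5 * Real.sqrt I := by
          rw [Real.sqrt_mul (sq_nonneg _), Real.sqrt_sq (by positivity)]
      _ ≤ C / d ^ 5 * (Real.sqrt I + S) := by gcongr; linarith
      _ = _ := by ring
  · have h2 := hS x
    rw [Real.norm_of_nonneg (hΦ0 x)] at h2
    calc |F d x| ≤ C / d ^ 5 * ((1 + ‖x‖) ^ 5 * Φ x) := hb d hd x
      _ ≤ C / d ^ 5 * (Real.sqrt I + S) := by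
          gcongr
          linarith [Real.sqrt_nonneg I]
      _ = _ := by ring

end Corrections

end VortexPair

end

/-! ### Assembly of the profiles and the residual estimate. -/

open VortexPair

/-- The equations for the profiles have, up to a.e. equality, exactly one solution in
`X ∩ D(Λ) ∩ Ker(Λ)^⊥` each; these solutions are smooth, and for their smooth representatives
the residual of the vortex-pair equation is `O(d^{-5})` in `X` and uniformly on the plane. -/
theorem proposition2p5 (q : ℝ → ℝ) (hq : AdmissibleProfile q) :
    ∃ ω₂ ω₃ ω₄ : Plane → ℝ,
      ContDiff ℝ (⊤ : ℕ∞) ω₂ ∧ ContDiff ℝ (⊤ : ℕ∞) ω₃ ∧ ContDiff ℝ (⊤ : ℕ∞) ω₄ ∧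
      (∀ x : Plane, ω₂ x = axisProfile ω₂ ‖x‖ * Real.cos (2 * angle x)) ∧
      (∀ ω : Plane → ℝ, IsProfile q (forcing q 2) ω ↔ ω =ᵐ[MeasureTheory.volume] ω₂) ∧
      (∀ ω : Plane → ℝ, IsProfile q (forcing q 3) ω ↔ ω =ᵐ[MeasureTheory.volume] ω₃) ∧
      (∀ ω : Plane → ℝ, IsProfile q (forcingFour q ω₂) ω ↔ ω =ᵐ[MeasureTheory.volume] ω₄) ∧
      ∃ C d₀ : ℝ, 0 < d₀ ∧ ∀ d : ℝ, d₀ ≤ d →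
        InX q (steadyResidual q ω₂ ω₃ ω₄ d) ∧
        normX q (steadyResidual q ω₂ ω₃ ω₄ d) ≤ C / d ^ 5 ∧
        ∀ x : Plane, |steadyResidual q ω₂ ω₃ ω₄ d x| ≤ C / d ^ 5 := by
  obtain ⟨φ₂, α₂, b₂, φ₃, α₃, b₃, φ₄, α₄, b₄, φ₅, α₅, b₅, s₂, s₃, s₄, s₅, l₂, l₃, l₄⟩ :=
    exists_profiles hq
  have hw := hq.weightOK
  have n₂ := s₂.nice hw le_rfl 1
  have n₃ := s₃.nice hw (by norm_num) 1
  have n₄ := s₄.nice hw (by norm_num) 1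
  have n₅ := s₅.nice hw le_rfl 1
  obtain ⟨η₂, hη₂, e₂⟩ := s₂.exists_preimage hq le_rfl 1
  obtain ⟨η₃, hη₃, e₃⟩ := s₃.exists_preimage hq (by norm_num) 1
  obtain ⟨η₄, hη₄, e₄⟩ := s₄.exists_preimage hq (by norm_num) 1
  obtain ⟨η₅, hη₅, e₅⟩ := s₅.exists_preimage hq le_rfl 1
  have hc : Corrections q (mode 2 1 b₂) (mode 3 1 b₃) fun x => mode 4 1 b₄ x + mode 2 1 b₅ x :=
    ⟨n₂, n₃, n₄.add hw n₅, fun j hj => moment_mode_two b₂ (by omega), fun j hj => by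
      rw [Nat.lt_one_iff.1 hj]; exact moment_mode_three b₃⟩
  refine ⟨mode 2 1 b₂, mode 3 1 b₃, fun x => mode 4 1 b₄ x + mode 2 1 b₅ x, n₂.smooth, n₃.smooth,
    hc.nice₄.smooth, fun x => by simpa using mode_eq_axisProfile 2 b₂ x,
    isProfile_iff hq n₂ l₂ hη₂ e₂, isProfile_iff hq n₃ l₃ hη₃ e₃,
    isProfile_iff hq hc.nice₄ l₄ (hη₄.add hw hη₅) (e₄.add hη₄ hη₅ e₅), ?_⟩
  obtain ⟨C, hC, hb⟩ := hc.exists_residual_bound hq l₂ l₃ l₄ (fourth_order hq s₂)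
  obtain ⟨C', h⟩ := Corrections.exists_norm_bound hq (hc.planeWsq_gradSum hq)
    (hc.decay_gradSum hq 5) Corrections.gradSum_nonneg
    (fun d => (hc.continuous_steadyResidual hq d).aestronglyMeasurable) hC hb
  -- All expansions are uniform for d ≥ 1, so d₀ = 1 will do.
  exact ⟨C', 1, one_pos, h⟩
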